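/- Let $d\in\{2,3\}$, let $\Omega\subset\mathbb R^d$ be a polygonal/polyhedral domain, and let $\mathcal T_h$ be a finite conforming mesh of $\Omega$ by non-degenerate $d$-simplices $K$. Each boundary facet of the mesh belongs to exactly one of two disjoint parts of $\partial\Omega$, the Dirichlet part $\Gamma_D\neq\emptyset$ and the Neumann part $\Gamma_N$. Let $f,f^O\in L^2(\Omega)$, $g_N,g_N^O\in L^2(\Gamma_N)$, let $g_D,g_D^O$ be Dirichlet data on $\Gamma_D$, and let $\nu$ be equal to a constant $\nu_K>0$ on each $K\in\mathcal T_h$. Write $(\cdot,\cdot)_\omega$ and $\langle\cdot,\cdot\rangle_\gamma$ for the $L^2$ inner products on $\omega\subset\Omega$ and $\gamma\subset\partial\Omega$ (and the duality pairing, defined by Green's formula, for normal traces of $H(\mathrm{div};\Omega)$ fields), omit $\omega$ if $\omega=\Omega$, and put $|||\boldsymbol v|||_K^2=(\nu^{-1}\boldsymbol v,\boldsymbol v)_K$. Let $(u,\boldsymbol q)\in H^1(\Omega)\times H(\mathrm{div};\Omega)$ be the weak solution of $$\boldsymbol q=-\nu\nabla u,\quad \nabla\cdot\boldsymbol q=f\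 \text{ in }\Omega,\qquad u=g_D\ \text{ on }\Gamma_D,\qquad \boldsymbol q\cdot\boldsymbol n=g_N\ \text{ on }\Gamma_N,$$ and let $$s=\ell^O(u,\boldsymbol q),\qquad \ell^O(w,\boldsymbol v)=(f^O,w)+\langle g_D^O,\boldsymbol v\cdot\boldsymbol n\rangle_{\Gamma_D}+\langle g_N^O,w\rangle_{\Gamma_N}.$$ Let $\tilde u_h,\tilde\xi_h\in H^1(\Omega)$ with $\tilde u_h=g_D$ and $\tilde\xi_h=g_D^O$ on $\Gamma_D$, let $\tilde{\boldsymbol q}_h,\tilde{\boldsymbol\zeta}_h\in H(\mathrm{div};\Omega)$ have normal components in $L^2(\Gamma_N)$, and let $\kappa>0$. Set $$\mathcal B=(f^O,\tilde u_h)+\langle g_N^O,\tilde u_h\rangle_{\Gamma_N}+(f,\tilde\xi_h)-\langle g_N,\tilde\xi_h\rangle_{\Gamma_N}-(\nu\nabla\tilde u_h,\nabla\tilde\xi_h).$$ For $K\in\mathcal T_h$ with diameter $h_K$ and a facet $e$ of $K$ with opposite vertex $\boldsymbol x_e$, let $$C_1=\frac{h_K}{\pi},\qquad C_2^2=\frac{|e|}{d\,|K|}\,\frac{h_K}{\pi}\Bigl(2\max_{\boldsymbol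 x\in e}|\boldsymbol x-\boldsymbol x_e|+\frac{d\,h_K}{\pi}\Bigr).$$ In each formula below, either all upper or all lower signs are to be taken. (1) Zero-order equilibrated fluxes. Suppose that $(\nabla\cdot\tilde{\boldsymbol q}_h,1)_K=(f,1)_K$ and $(\nabla\cdot\tilde{\boldsymbol\zeta}_h,1)_K=(f^O,1)_K$ for all $K\in\mathcal T_h$, and that $\langle\tilde{\boldsymbol q}_h\cdot\boldsymbol n,1\rangle_e=\langle g_N,1\rangle_e$ and $\langle\tilde{\boldsymbol\zeta}_h\cdot\boldsymbol n,1\rangle_e=-\langle g_N^O,1\rangle_e$ for all facets $e\subset\Gamma_N$. Then $$\pm s\ \ge\ \pm\mathcal B-\frac1{4\kappa}\sum_{K\in\mathcal T_h}(\eta_K^{0\mp})^2,$$ where $$\begin{aligned}\eta_K^{0\mp}={}&|||\pm(\tilde{\boldsymbol\zeta}_h+\nu\nabla\tilde\xi_h)-\kappa(\tilde{\boldsymbol q}_h+\nu\nabla\tilde u_h)|||_K+C_1\nu_K^{-1/2}\|\pm(f^O-\nabla\cdot\tilde{\boldsymbol\zeta}_h)-\kappa(f-\nabla\cdot\tilde{\boldsymbol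 q}_h)\|_{L^2(K)}\\&+\sum_{e\subset\Gamma_N\cap\partial K}C_2\,\nu_K^{-1/2}\|\mp(g_N^O+\tilde{\boldsymbol\zeta}_h\cdot\boldsymbol n)-\kappa(g_N-\tilde{\boldsymbol q}_h\cdot\boldsymbol n)\|_{L^2(e)}.\end{aligned}$$ (2) Projected equilibrated fluxes. Let $\hat q,\bar q\ge0$ be integers, let $\Pi_K$ and $\Pi_e$ be the $L^2(K)$- and $L^2(e)$-orthogonal projections onto the polynomials of degree at most $\hat q$ on $K$ and at most $\bar q$ on $e$, and suppose that $\nabla\cdot\tilde{\boldsymbol q}_h|_K=\Pi_Kf$ and $\nabla\cdot\tilde{\boldsymbol\zeta}_h|_K=\Pi_Kf^O$ for all $K\in\mathcal T_h$, and that $\tilde{\boldsymbol q}_h\cdot\boldsymbol n|_e=\Pi_eg_N$ and $\tilde{\boldsymbol\zeta}_h\cdot\boldsymbol n|_e=-\Pi_eg_N^O$ for all facets $e\subset\Gamma_N$. Then $$\pm s\ \ge\ \pm\mathcal B-\frac1{4\kappa}\sum_{K\in\mathcal T_h}(\eta_K^{\pi\mp})^2,$$ where $$\begin{aligned}\eta_K^{\pi\mp}={}&|||\pm(\tilde{\boldsymbol\zeta}_h+\nu\nabla\tilde\xi_h)-\kappa(\tilde{\boldsymbol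 q}_h+\nu\nabla\tilde u_h)|||_K+C_1\nu_K^{-1/2}\|\pm(f^O-\Pi_Kf^O)-\kappa(f-\Pi_Kf)\|_{L^2(K)}\\&+\sum_{e\subset\Gamma_N\cap\partial K}C_2\,\nu_K^{-1/2}\|\mp(g_N^O-\Pi_eg_N^O)-\kappa(g_N-\Pi_eg_N)\|_{L^2(e)}.\end{aligned}$$ If moreover $\tilde\xi_h$ is piecewise polynomial on $\mathcal T_h$ of degree at most $\min(\hat q,\bar q)$, then $\mathcal B=\ell^O(\tilde u_h,\tilde{\boldsymbol q}_h)-(\tilde{\boldsymbol q}_h+\nu\nabla\tilde u_h,\nabla\tilde\xi_h)$, and hence $$\pm s\ \ge\ \pm\ell^O(\tilde u_h,\tilde{\boldsymbol q}_h)\mp(\tilde{\boldsymbol q}_h+\nu\nabla\tilde u_h,\nabla\tilde\xi_h)-\frac1{4\kappa}\sum_{K\in\mathcal T_h}(\eta_K^{\pi\mp})^2.$$ -/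

import Mathlib

open MeasureTheory Filter Topology
open scoped ContDiff

noncomputable section

/-- The ambient space `ℝ^d` with its Euclidean structure. -/
abbrev Space (d : ℕ) := EuclideanSpace ℝ (Fin d)

/-! ### Function spaces -/

/-- `Du` is the weak gradient of `u` on the open set `Ω`. -/
def IsWeakGradient {d : ℕ} (Ω : Set (Space d)) (u : Space d → ℝ) (Du : Space d → Space d) :
    Prop :=
  ∀ φ : Space d → ℝ, ContDiff ℝ ∞ φ → HasCompactSupport φ → tsupport φ ⊆ Ω →
    ∫ x in Ω, u x • gradient φ x = - ∫ x in Ω, φ x • Du x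

/-- `dq` is the weak divergence of the vector field `q` on the open set `Ω`. -/
def IsWeakDivergence {d : ℕ} (Ω : Set (Space d)) (q : Space d → Space d) (dq : Space d → ℝ) :
    Prop :=
  ∀ φ : Space d → ℝ, ContDiff ℝ ∞ φ → HasCompactSupport φ → tsupport φ ⊆ Ω →
    ∫ x in Ω, inner ℝ (q x) (gradient φ x) = - ∫ x in Ω, φ x * dq x

/-- An element of `H¹(Ω)`, together with (a representative of) its weak gradient. -/
structure SobolevH1 {d : ℕ} (Ω : Set (Space d)) where
  toFun : Space d → ℝ
  grad : Space d → Space d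
  memLp_toFun : MemLp toFun 2 (volume.restrict Ω)
  memLp_grad : MemLp grad 2 (volume.restrict Ω)
  isWeakGradient : IsWeakGradient Ω toFun grad

/-- An element of `H(div; Ω)`, together with (a representative of) its weak divergence. -/
structure SobolevHDiv {d : ℕ} (Ω : Set (Space d)) where
  toFun : Space d → Space d
  div : Space d → ℝ
  memLp_toFun : MemLp toFun 2 (volume.restrict Ω)
  memLp_div : MemLp div 2 (volume.restrict Ω)
  isWeakDivergence : IsWeakDivergence Ω toFun div

/-! ### Simplicial meshes -/

/-- The closed simplex spanned by a finite set of vertices. -/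
def cell {d : ℕ} (K : Finset (Space d)) : Set (Space d) := convexHull ℝ (K : Set (Space d))

/-- A finite conforming mesh of `Ω` by non-degenerate closed `d`-simplices, each simplex being
given by its set of vertices. Two simplices meet in their common face (possibly empty), and
`Ω` is the interior of the union of the simplices. -/
structure SimplicialMesh {d : ℕ} (Ω : Set (Space d)) where
  elements : Finset (Finset (Space d))
  card_eq : ∀ K ∈ elements, K.card = d + 1
  affineIndependent : ∀ K ∈ elements, AffineIndependent ℝ ((↑) : K → Space d)
  inter_eq : ∀ K ∈ elements, ∀ L ∈ elements,
    cell K ∩ cell L = convexHull ℝ ((K : Set (Space d)) ∩ (L : Set (Space d)))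
  interior_eq : interior (⋃ K ∈ elements, cell K) = Ω

open scoped Classical in
/-- The facets lying on the boundary of `Ω`: those belonging to exactly one element. -/
def SimplicialMesh.boundaryFacets {d : ℕ} {Ω : Set (Space d)} (M : SimplicialMesh Ω) :
    Finset (Finset (Space d)) :=
  (M.elements.biUnion fun K => K.powersetCard d).filter fun e => ∃! K, K ∈ M.elements ∧ e ⊆ K

open scoped Classical in
/-- A partition of the boundary of `Ω` into a (non-empty) Dirichlet part and a Neumann part, both
made of boundary facets of the mesh. -/
structure BoundaryPartition {d : ℕ} {Ω : Set (Space d)} (M : SimplicialMesh Ω) where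
  dirichlet : Finset (Finset (Space d))
  neumann : Finset (Finset (Space d))
  union_eq : dirichlet ∪ neumann = M.boundaryFacets
  disjoint : Disjoint dirichlet neumann
  nonempty : dirichlet.Nonempty

/-- Lebesgue measure on the element `K`. -/
def elementMeasure {d : ℕ} (K : Finset (Space d)) : Measure (Space d) :=
  volume.restrict (cell K)

/-- `(d-1)`-dimensional surface measure on the facet `e`. -/
def facetMeasure {d : ℕ} (e : Finset (Space d)) : Measure (Space d) :=
  (μHE[d - 1]).restrict (cell e)

/-! ### Traces -/

/-- `T ∈ L²(e)` is the trace on the facet `e`, taken from the element `K`, of the `H¹` function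
`w` with gradient `Dw`: it is the `L²(e)` limit of the restrictions of smooth functions converging
to `w` in `H¹(K)`. -/
def IsTraceFrom {d : ℕ} (K e : Finset (Space d)) (w : Space d → ℝ) (Dw : Space d → Space d)
    (T : Space d → ℝ) : Prop :=
  MemLp T 2 (facetMeasure e) ∧
  ∃ φ : ℕ → Space d → ℝ, (∀ n, ContDiff ℝ ∞ (φ n)) ∧
    Tendsto (fun n => eLpNorm (fun x => φ n x - w x) 2 (elementMeasure K)) atTop (𝓝 0) ∧
    Tendsto (fun n => eLpNorm (fun x => gradient (φ n) x - Dw x) 2 (elementMeasure K))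
      atTop (𝓝 0) ∧
    Tendsto (fun n => eLpNorm (fun x => φ n x - T x) 2 (facetMeasure e)) atTop (𝓝 0)

/-- `T` is the trace of `w ∈ H¹(Ω)` on the boundary facet `e`. -/
def IsTrace {d : ℕ} {Ω : Set (Space d)} (M : SimplicialMesh Ω) (w : SobolevH1 Ω)
    (e : Finset (Space d)) (T : Space d → ℝ) : Prop :=
  ∃ K ∈ M.elements, e ⊆ K ∧ IsTraceFrom K e w.toFun w.grad T

open scoped Classical in
/-- The trace of `w ∈ H¹(Ω)` on the boundary facet `e`. It always exists, and is unique almost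
everywhere on `e`. -/
def traceOn {d : ℕ} {Ω : Set (Space d)} (M : SimplicialMesh Ω) (w : SobolevH1 Ω)
    (e : Finset (Space d)) : Space d → ℝ :=
  if h : ∃ T, IsTrace M w e T then h.choose else 0

/-- `w = g` on the Dirichlet boundary, in the sense of traces. -/
def EqOnDirichlet {d : ℕ} {Ω : Set (Space d)} {M : SimplicialMesh Ω} (B : BoundaryPartition M)
    (w : SobolevH1 Ω) (g : Space d → ℝ) : Prop :=
  ∀ e ∈ B.dirichlet, IsTrace M w e g

/-- `⟨g, w⟩` on the Neumann boundary, for `w ∈ H¹(Ω)`. -/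
def neumannPairing {d : ℕ} {Ω : Set (Space d)} {M : SimplicialMesh Ω} (B : BoundaryPartition M)
    (g : Space d → ℝ) (w : SobolevH1 Ω) : ℝ :=
  ∑ e ∈ B.neumann, ∫ x, g x * traceOn M w e x ∂(facetMeasure e)

/-- The left-hand side `(q, ∇w) + (∇·q, w)` of Green's formula. -/
def greenForm {d : ℕ} {Ω : Set (Space d)} (q : SobolevHDiv Ω) (w : SobolevH1 Ω) : ℝ :=
  (∫ x in Ω, inner ℝ (q.toFun x) (w.grad x)) + ∫ x in Ω, q.div x * w.toFun x

/-- The normal component of `q ∈ H(div; Ω)` on the Neumann boundary is the square integrable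
function `qn`. The normal trace of `q` is defined, as usual, by Green's formula with test functions
in `H¹(Ω)` which vanish on the Dirichlet boundary. -/
def IsNormalTrace {d : ℕ} {Ω : Set (Space d)} {M : SimplicialMesh Ω} (B : BoundaryPartition M)
    (q : SobolevHDiv Ω) (qn : Space d → ℝ) : Prop :=
  (∀ e ∈ B.neumann, MemLp qn 2 (facetMeasure e)) ∧
  ∀ w : SobolevH1 Ω, EqOnDirichlet B w 0 → greenForm q w = neumannPairing B qn w

open scoped Classical in
/-- The duality pairing `⟨g, q·n⟩` on the Dirichlet boundary, where `g` is the Dirichlet trace of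
some `G ∈ H¹(Ω)` and `qn` is the normal component of `q ∈ H(div; Ω)` on the Neumann boundary:
it is given by Green's formula `(q, ∇G) + (∇·q, G) - ⟨qn, G⟩`, the value being independent of the
choice of the extension `G`. -/
def dirichletPairing {d : ℕ} {Ω : Set (Space d)} {M : SimplicialMesh Ω} (B : BoundaryPartition M)
    (g : Space d → ℝ) (q : SobolevHDiv Ω) (qn : Space d → ℝ) : ℝ :=
  if h : ∃ G : SobolevH1 Ω, EqOnDirichlet B G g then
    greenForm q h.choose - neumannPairing B qn h.choose
  else 0

/-! ### The model problem -/

/-- The data of the primal and adjoint problems: the diffusion coefficient `nu`, equal to the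
positive constant `nuK K` on the element `K`, the source terms `f`, `fO` and the Neumann and
Dirichlet data `gN`, `gNO`, `gD`, `gDO`. -/
structure ProblemData {d : ℕ} {Ω : Set (Space d)} {M : SimplicialMesh Ω}
    (B : BoundaryPartition M) where
  nu : Space d → ℝ
  nuK : Finset (Space d) → ℝ
  nuK_pos : ∀ K ∈ M.elements, 0 < nuK K
  nu_eq : ∀ K ∈ M.elements, ∀ᵐ x ∂(elementMeasure K), nu x = nuK K
  f : Space d → ℝ
  gD : Space d → ℝ
  gN : Space d → ℝ
  fO : Space d → ℝ
  gDO : Space d → ℝ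
  gNO : Space d → ℝ
  memLp_f : MemLp f 2 (volume.restrict Ω)
  memLp_fO : MemLp fO 2 (volume.restrict Ω)
  memLp_gN : ∀ e ∈ B.neumann, MemLp gN 2 (facetMeasure e)
  memLp_gNO : ∀ e ∈ B.neumann, MemLp gNO 2 (facetMeasure e)

/-- `(u, q)` is the exact weak solution of the mixed problem `q = -ν ∇u`, `∇·q = f` in `Ω`,
`u = gD` on the Dirichlet boundary and `q·n = gN` on the Neumann boundary. -/
structure IsExactSolution {d : ℕ} {Ω : Set (Space d)} {M : SimplicialMesh Ω}
    {B : BoundaryPartition M} (D : ProblemData B) (u : SobolevH1 Ω) (q : SobolevHDiv Ω) : Prop where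
  flux_eq : ∀ᵐ x ∂(volume.restrict Ω), q.toFun x = -(D.nu x • u.grad x)
  div_eq : ∀ᵐ x ∂(volume.restrict Ω), q.div x = D.f x
  eqOnDirichlet : EqOnDirichlet B u D.gD
  isNormalTrace : IsNormalTrace B q D.gN

/-- The output functional `ℓᴼ(w, v) = (fO, w) + ⟨gDO, v·n⟩ + ⟨gNO, w⟩`, where `vn` is the normal
component of `v` on the Neumann boundary. -/
def outputFunctional {d : ℕ} {Ω : Set (Space d)} {M : SimplicialMesh Ω} {B : BoundaryPartition M}
    (D : ProblemData B) (w : SobolevH1 Ω) (v : SobolevHDiv Ω) (vn : Space d → ℝ) : ℝ :=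
  (∫ x in Ω, D.fO x * w.toFun x) + dirichletPairing B D.gDO v vn + neumannPairing B D.gNO w

/-! ### Reconstructions -/

/-- `(w, v)` and `(ξ, ζ)` are potential and zero-order equilibrated flux reconstructions of the
primal and adjoint problems; `vn` and `ζn` are the normal components of the fluxes `v` and `ζ`
on the Neumann boundary. -/
structure IsZeroOrderReconstruction {d : ℕ} {Ω : Set (Space d)} {M : SimplicialMesh Ω}
    {B : BoundaryPartition M} (D : ProblemData B) (w : SobolevH1 Ω) (v : SobolevHDiv Ω)
    (vn : Space d → ℝ) (ξ : SobolevH1 Ω) (ζ : SobolevHDiv Ω) (ζn : Space d → ℝ) : Prop where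
  primal_potential : EqOnDirichlet B w D.gD
  adjoint_potential : EqOnDirichlet B ξ D.gDO
  primal_trace : IsNormalTrace B v vn
  adjoint_trace : IsNormalTrace B ζ ζn
  primal_div : ∀ K ∈ M.elements,
    ∫ x, v.div x ∂(elementMeasure K) = ∫ x, D.f x ∂(elementMeasure K)
  adjoint_div : ∀ K ∈ M.elements,
    ∫ x, ζ.div x ∂(elementMeasure K) = ∫ x, D.fO x ∂(elementMeasure K)
  primal_neumann : ∀ e ∈ B.neumann,
    ∫ x, vn x ∂(facetMeasure e) = ∫ x, D.gN x ∂(facetMeasure e)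
  adjoint_neumann : ∀ e ∈ B.neumann,
    ∫ x, ζn x ∂(facetMeasure e) = ∫ x, -D.gNO x ∂(facetMeasure e)

/-- The polynomial function on `ℝ^d` defined by `p`. -/
def polyFun {d : ℕ} (p : MvPolynomial (Fin d) ℝ) (x : Space d) : ℝ :=
  MvPolynomial.eval (fun i => x i) p

open scoped Classical in
/-- The `L²(μ)`-orthogonal projection of `g` onto (the restrictions to the support of `μ` of) the
polynomials of degree at most `k`; used when `μ` is the measure of an element or of a facet. -/
def polyProj {d : ℕ} (μ : Measure (Space d)) (k : ℕ) (g : Space d → ℝ) : Space d → ℝ :=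
  if h : ∃ p : MvPolynomial (Fin d) ℝ, p.totalDegree ≤ k ∧
      ∀ r : MvPolynomial (Fin d) ℝ, r.totalDegree ≤ k →
        ∫ x, (g x - polyFun p x) * polyFun r x ∂μ = 0
  then polyFun h.choose else 0

/-- `(w, v)` and `(ξ, ζ)` are potential and projected equilibrated flux reconstructions of the
primal and adjoint problems for the pair of degrees `(k, l)`; `vn` and `ζn` are the normal
components of the fluxes `v` and `ζ` on the Neumann boundary. -/
structure IsProjectedReconstruction {d : ℕ} {Ω : Set (Space d)} {M : SimplicialMesh Ω}
    {B : BoundaryPartition M} (D : ProblemData B) (k l : ℕ) (w : SobolevH1 Ω) (v : SobolevHDiv Ω)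
    (vn : Space d → ℝ) (ξ : SobolevH1 Ω) (ζ : SobolevHDiv Ω) (ζn : Space d → ℝ) : Prop where
  primal_potential : EqOnDirichlet B w D.gD
  adjoint_potential : EqOnDirichlet B ξ D.gDO
  primal_trace : IsNormalTrace B v vn
  adjoint_trace : IsNormalTrace B ζ ζn
  primal_div : ∀ K ∈ M.elements, ∀ᵐ x ∂(elementMeasure K),
    v.div x = polyProj (elementMeasure K) k D.f x
  adjoint_div : ∀ K ∈ M.elements, ∀ᵐ x ∂(elementMeasure K),
    ζ.div x = polyProj (elementMeasure K) k D.fO x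
  primal_neumann : ∀ e ∈ B.neumann, ∀ᵐ x ∂(facetMeasure e),
    vn x = polyProj (facetMeasure e) l D.gN x
  adjoint_neumann : ∀ e ∈ B.neumann, ∀ᵐ x ∂(facetMeasure e),
    ζn x = -polyProj (facetMeasure e) l D.gNO x

/-- `w` is, on each element of the mesh, a polynomial of degree at most `m`. -/
def IsPiecewisePolynomial {d : ℕ} {Ω : Set (Space d)} (M : SimplicialMesh Ω) (m : ℕ)
    (w : SobolevH1 Ω) : Prop :=
  ∀ K ∈ M.elements, ∃ p : MvPolynomial (Fin d) ℝ, p.totalDegree ≤ m ∧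
    ∀ᵐ x ∂(elementMeasure K), w.toFun x = polyFun p x

/-! ### The bounds -/

/-- The `L²(μ)` norm of a scalar function. -/
def normL2 {d : ℕ} (μ : Measure (Space d)) (g : Space d → ℝ) : ℝ :=
  Real.sqrt (∫ x, g x ^ 2 ∂μ)

/-- The energy norm `(ν⁻¹ v, v)^(1/2)` on the element `K`. -/
def energyNorm {d : ℕ} (nu : Space d → ℝ) (K : Finset (Space d)) (v : Space d → Space d) : ℝ :=
  Real.sqrt (∫ x, (nu x)⁻¹ * inner ℝ (v x) (v x) ∂(elementMeasure K))

/-- The constant `C₁ = h_K / π`, with `h_K` the diameter of `K`. -/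
def constC1 {d : ℕ} (K : Finset (Space d)) : ℝ := Metric.diam (cell K) / Real.pi

/-- The constant `C₂` of the facet `e` of `K` opposite to the vertex `a`:
`C₂² = (|e| / (d |K|)) (h_K / π) (2 max_{x ∈ e} |x - a| + d h_K / π)`. -/
def constC2 {d : ℕ} (K e : Finset (Space d)) (a : Space d) : ℝ :=
  Real.sqrt ((facetMeasure e).real Set.univ / (d * (elementMeasure K).real Set.univ) *
    (Metric.diam (cell K) / Real.pi) *
    (2 * sSup ((fun x => dist x a) '' cell e) + d * Metric.diam (cell K) / Real.pi))

open scoped Classical in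
/-- The local indicator `η_K` for the combined potential `w, ξ` and flux `v, ζ` reconstructions and
the sign `σ = ±1`. Here `rf, rfO` are the residuals in the element and `rg e, rgO e` those on
the Neumann facet `e`; the last sum runs over the Neumann facets of `K`, each of them being indexed
by the opposite vertex `a`. -/
def localIndicator {d : ℕ} {Ω : Set (Space d)} {M : SimplicialMesh Ω} {B : BoundaryPartition M}
    (D : ProblemData B) (σ κ : ℝ) (w : SobolevH1 Ω) (v : SobolevHDiv Ω) (ξ : SobolevH1 Ω) (ζ : SobolevHDiv Ω)
    (rf rfO : Space d → ℝ) (rg rgO : Finset (Space d) → Space d → ℝ) (K : Finset (Space d)) : ℝ :=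
  energyNorm D.nu K (fun x => σ • (ζ.toFun x + D.nu x • ξ.grad x) -
      κ • (v.toFun x + D.nu x • w.grad x))
  + constC1 K * (Real.sqrt (D.nuK K))⁻¹ *
      normL2 (elementMeasure K) (fun x => σ * rfO x - κ * rf x)
  + ∑ a ∈ K.filter (fun a => K.erase a ∈ B.neumann),
      constC2 K (K.erase a) a * (Real.sqrt (D.nuK K))⁻¹ *
        normL2 (facetMeasure (K.erase a))
          (fun x => -σ * rgO (K.erase a) x - κ * rg (K.erase a) x)

/-- The indicator `η_K` of zero-order equilibrated reconstructions. -/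
def etaZeroOrder {d : ℕ} {Ω : Set (Space d)} {M : SimplicialMesh Ω} {B : BoundaryPartition M}
    (D : ProblemData B) (σ κ : ℝ) (w : SobolevH1 Ω) (v : SobolevHDiv Ω) (vn : Space d → ℝ)
    (ξ : SobolevH1 Ω) (ζ : SobolevHDiv Ω) (ζn : Space d → ℝ) (K : Finset (Space d)) : ℝ :=
  localIndicator D σ κ w v ξ ζ (fun x => D.f x - v.div x) (fun x => D.fO x - ζ.div x)
    (fun _ x => D.gN x - vn x) (fun _ x => D.gNO x + ζn x) K

/-- The indicator `η_K` of projected equilibrated reconstructions. -/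
def etaProjected {d : ℕ} {Ω : Set (Space d)} {M : SimplicialMesh Ω} {B : BoundaryPartition M}
    (D : ProblemData B) (k l : ℕ) (σ κ : ℝ) (w : SobolevH1 Ω) (v : SobolevHDiv Ω)
    (ξ : SobolevH1 Ω) (ζ : SobolevHDiv Ω) (K : Finset (Space d)) : ℝ :=
  localIndicator D σ κ w v ξ ζ
    (fun x => D.f x - polyProj (elementMeasure K) k D.f x)
    (fun x => D.fO x - polyProj (elementMeasure K) k D.fO x)
    (fun e x => D.gN x - polyProj (facetMeasure e) l D.gN x)
    (fun e x => D.gNO x - polyProj (facetMeasure e) l D.gNO x) K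

/-- The computable expression
`(fO, w) + ⟨gNO, w⟩ + (f, ξ) - ⟨gN, ξ⟩ - (ν ∇w, ∇ξ)`. -/
def centralValue {d : ℕ} {Ω : Set (Space d)} {M : SimplicialMesh Ω} {B : BoundaryPartition M}
    (D : ProblemData B) (w ξ : SobolevH1 Ω) : ℝ :=
  (∫ x in Ω, D.fO x * w.toFun x) + neumannPairing B D.gNO w
    + (∫ x in Ω, D.f x * ξ.toFun x) - neumannPairing B D.gN ξ
    - ∫ x in Ω, inner ℝ (D.nu x • w.grad x) (ξ.grad x)

/-- The alternative expression `ℓᴼ(w, v) - (v + ν ∇w, ∇ξ)`. -/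
def centralValueAlt {d : ℕ} {Ω : Set (Space d)} {M : SimplicialMesh Ω} {B : BoundaryPartition M}
    (D : ProblemData B) (w : SobolevH1 Ω) (v : SobolevHDiv Ω) (vn : Space d → ℝ) (ξ : SobolevH1 Ω) : ℝ :=
  outputFunctional D w v vn - ∫ x in Ω, inner ℝ (v.toFun x + D.nu x • w.grad x) (ξ.grad x)

end

/-! Put `e = u - w`. It vanishes on the Dirichlet boundary, so Green's formula may be tested with it
for the three fluxes `q`, `v` and `ζ`. Substituting the resulting identities gives, for a sign `σ`,
the exact representation `σ (s - 𝓑) = κ (ν∇e, ∇e) - (Z, ∇e) + (r, e) - ⟨g, e⟩` (`output_error_eq`),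
where `Z`, `r`, `g` are the combined residuals appearing in the indicators. The parameter `κ` enters
through a multiple of the primal weak equation tested with `e`, that is, through zero.

The representation splits over the elements. Equilibration makes `r` orthogonal to constants on each
element and `g` on each Neumann facet, so a constant may be subtracted from `e` in these terms. With
`x = ν_K^(1/2) ‖∇e‖_K`, the Poincaré inequality with `C₁` and the trace inequality with `C₂` bound
the last three terms on `K` by `η_K x`, and `κ x² - η_K x ≥ -η_K²/(4κ)` (`neg_indicator_sq_le`).
Summation gives (1). A projected flux is a zero-order one with the same indicator, which gives (2).
For piecewise polynomial `ξ` the projection residuals are orthogonal to `ξ`, which yields the other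
form of the central value.

The analytic core is the sharp constant `h/π`, the Payne–Weinberger inequality
`Convex.payne_weinberger`. It rests on a one-dimensional Poincaré inequality with log-concave weight
(`variance_logConcave_weight`). Section volumes of a convex body are log-concave by Prékopa's
theorem, whence the inequality for functions of one linear coordinate (`Convex.variance_ridge_le`).
Repeated bisection reduces a general function to that case on thin needles. The constant `C₂` then
follows from Gauss' formula for the field `φ² (x - a)` on a simplex with apex `a`
(`trace_le_constC2`).

Smooth functions are dense in `H¹` of a simplex (`Convex.exists_smooth_approx`), by dilation and
mollification. This transfers the inequalities to Sobolev functions and gives existence of traces;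
their uniqueness follows from a trace bound passed to the limit. -/

noncomputable section

/-! ### Weighted Poincaré inequalities on an interval. -/

/-- A one-dimensional Dirichlet inequality for the weight `exp V` with `V` convex. -/
theorem dirichlet_exp_weight {a b k : ℝ} (hab : a < b) (hk : 0 < k) (hkab : k * (b - a) < Real.pi)
    {V V' V'' G G' : ℝ → ℝ} (hV : ∀ x, HasDerivAt V (V' x) x) (hV' : ∀ x, HasDerivAt V' (V'' x) x)
    (hV''c : Continuous V'') (hV'' : ∀ x ∈ Set.Icc a b, 0 ≤ V'' x)
    (hG : ∀ x, HasDerivAt G (G' x) x) (hG'c : Continuous G') (hGa : G a = 0) (hGb : G b = 0) :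
    k ^ 2 * ∫ x in a..b, G x ^ 2 * Real.exp (V x) ≤ ∫ x in a..b, G' x ^ 2 * Real.exp (V x) := by
  have hVc : Continuous V := continuous_iff_continuousAt.2 fun x => (hV x).continuousAt
  have hV'c : Continuous V' := continuous_iff_continuousAt.2 fun x => (hV' x).continuousAt
  have hGc : Continuous G := continuous_iff_continuousAt.2 fun x => (hG x).continuousAt
  set m := (a + b) / 2
  have hcos : ∀ x ∈ Set.Icc a b, 0 < Real.cos (k * (x - m)) := by
    intro x hx
    apply Real.cos_pos_of_mem_Ioo
    have h1 : x - m ≤ (b - a) / 2 := by simp only [m]; linarith [hx.2]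
    have h2 : -((b - a) / 2) ≤ x - m := by simp only [m]; linarith [hx.1]
    constructor
    · have := mul_le_mul_of_nonneg_left h2 hk.le
      nlinarith
    · have := mul_le_mul_of_nonneg_left h1 hk.le
      nlinarith
  -- A solution of the Riccati equation `c' = -k² - c²`, centred at the midpoint. The strict bound
  -- `k (b - a) < π` keeps the tangent finite on the closed interval.
  set c : ℝ → ℝ := fun x => -k * Real.tan (k * (x - m))
  have hc : ∀ x ∈ Set.Icc a b, HasDerivAt c (-(k ^ 2) - c x ^ 2) x := by
    intro x hx
    have h0 := (hcos x hx).ne'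
    have h1 : HasDerivAt (fun x => k * (x - m)) k x := by
      simpa using ((hasDerivAt_id x).sub_const m).const_mul k
    have h2 := ((Real.hasDerivAt_tan h0).comp x h1).const_mul (-k)
    refine h2.congr_deriv ?_
    simp only [c, Real.tan_eq_sin_div_cos]
    field_simp
    have := Real.sin_sq_add_cos_sq (k * (x - m))
    linear_combination this
  -- `Q = h exp(V) G²` vanishes at both ends, so `Q'` may be subtracted under the integral. This `h`
  -- completes the square in `G'` and leaves a remainder `G² (V''/2 + V'²/4)`, nonnegative by
  -- convexity of `V`.
  set h : ℝ → ℝ := fun x => -V' x / 2 + c x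
  set Q : ℝ → ℝ := fun x => h x * Real.exp (V x) * G x ^ 2
  set Q' : ℝ → ℝ := fun x => ((-V'' x / 2 + (-(k ^ 2) - c x ^ 2)) * Real.exp (V x)
    + h x * (Real.exp (V x) * V' x)) * G x ^ 2 + h x * Real.exp (V x) * (2 * G x * G' x)
  have hQ : ∀ x ∈ Set.Icc a b, HasDerivAt Q (Q' x) x := by
    intro x hx
    have h1 : HasDerivAt h (-V'' x / 2 + (-(k ^ 2) - c x ^ 2)) x :=
      (((hV' x).neg).div_const 2).add (hc x hx)
    have h2 := (h1.mul ((hV x).exp)).mul ((hG x).pow 2)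
    refine h2.congr_deriv ?_
    simp [Q']
  have hcc : ContinuousOn c (Set.Icc a b) := fun x hx => (hc x hx).continuousAt.continuousWithinAt
  have hhc : ContinuousOn h (Set.Icc a b) := (hV'c.neg.div_const 2).continuousOn.add hcc
  have hQ'c : ContinuousOn Q' (Set.Icc a b) := by
    simp only [Q']
    have e1 := hVc.rexp
    fun_prop
  have hint : IntervalIntegrable Q' volume a b := by
    apply ContinuousOn.intervalIntegrable
    rwa [Set.uIcc_of_le hab.le]
  have hFTC : ∫ x in a..b, Q' x = 0 := by
    rw [intervalIntegral.integral_eq_sub_of_hasDerivAt (f := Q) _ hint]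
    · simp [Q, hGa, hGb]
    · rwa [Set.uIcc_of_le hab.le]
  have i1 : IntervalIntegrable (fun x => G x ^ 2 * Real.exp (V x)) volume a b :=
    (Continuous.mul (hGc.pow 2) hVc.rexp).intervalIntegrable _ _
  have i2 : IntervalIntegrable (fun x => G' x ^ 2 * Real.exp (V x)) volume a b :=
    (Continuous.mul (hG'c.pow 2) hVc.rexp).intervalIntegrable _ _
  have key : ∫ x in a..b, (k ^ 2 * (G x ^ 2 * Real.exp (V x)) + Q' x)
      ≤ ∫ x in a..b, G' x ^ 2 * Real.exp (V x) := by
    apply intervalIntegral.integral_mono_on hab.le ((i1.const_mul _).add hint) i2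
    intro x hx
    have e : 0 < Real.exp (V x) := Real.exp_pos _
    have h3 : G' x ^ 2 * Real.exp (V x) - (k ^ 2 * (G x ^ 2 * Real.exp (V x)) + Q' x)
        = Real.exp (V x) * ((G' x - h x * G x) ^ 2 + G x ^ 2 * (V'' x / 2 + V' x ^ 2 / 4)) := by
      simp only [Q', h]; ring
    have : 0 ≤ Real.exp (V x) * ((G' x - h x * G x) ^ 2
        + G x ^ 2 * (V'' x / 2 + V' x ^ 2 / 4)) := by
      have := hV'' x hx
      positivity
    linarith
  rw [intervalIntegral.integral_add (i1.const_mul _) hint, hFTC, add_zero,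
    intervalIntegral.integral_const_mul] at key
  exact key

/-- Poincaré inequality on an interval for the weight `exp (-V)`, `V` convex and smooth: mean zero
version. -/
theorem poincare_exp_weight_of_mean_zero {a b k : ℝ} (hab : a < b) (hk : 0 < k)
    (hkab : k * (b - a) < Real.pi)
    {V V' V'' g g' : ℝ → ℝ} (hV : ∀ x, HasDerivAt V (V' x) x) (hV' : ∀ x, HasDerivAt V' (V'' x) x)
    (hV''c : Continuous V'') (hV'' : ∀ x ∈ Set.Icc a b, 0 ≤ V'' x)
    (hg : ∀ x, HasDerivAt g (g' x) x) (hg'c : Continuous g')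
    (hmean : ∫ x in a..b, g x * Real.exp (-V x) = 0) :
    k ^ 2 * ∫ x in a..b, g x ^ 2 * Real.exp (-V x)
      ≤ ∫ x in a..b, g' x ^ 2 * Real.exp (-V x) := by
  have hVc : Continuous V := continuous_iff_continuousAt.2 fun x => (hV x).continuousAt
  have hgc : Continuous g := continuous_iff_continuousAt.2 fun x => (hg x).continuousAt
  have hp : Continuous fun x => Real.exp (-V x) := by fun_prop
  set p : ℝ → ℝ := fun x => Real.exp (-V x)
  -- Duality: the primitive of `g exp(-V)` vanishes at both ends because the weighted mean is zero,
  -- so the Dirichlet inequality applies to it with the reciprocal weight `exp V`.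
  set G : ℝ → ℝ := fun t => ∫ x in a..t, g x * p x
  have hG : ∀ x, HasDerivAt G (g x * p x) x := fun x =>
    intervalIntegral.integral_hasDerivAt_right ((hgc.mul hp).intervalIntegrable _ _)
      ((hgc.mul hp).stronglyMeasurableAtFilter _ _) (hgc.mul hp).continuousAt
  have hGc : Continuous G := continuous_iff_continuousAt.2 fun x => (hG x).continuousAt
  have hGa : G a = 0 := by simp [G]
  have hGb : G b = 0 := hmean
  have h1 := dirichlet_exp_weight hab hk hkab hV hV' hV''c hV'' hG (hgc.mul hp) hGa hGb
  have hA : ∫ x in a..b, (g x * p x) ^ 2 * Real.exp (V x) = ∫ x in a..b, g x ^ 2 * p x := by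
    congr 1; ext x
    simp only [p, Real.exp_neg]
    field_simp
  rw [hA] at h1
  have h2 : ∫ x in a..b, g x ^ 2 * p x = - ∫ x in a..b, g' x * G x := by
    have := intervalIntegral.integral_mul_deriv_eq_deriv_mul (a := a) (b := b) (u := g) (v := G)
      (u' := g') (v' := fun x => g x * p x) (fun x _ => hg x) (fun x _ => hG x)
      (hg'c.intervalIntegrable _ _) ((hgc.mul hp).intervalIntegrable _ _)
    rw [hGa, hGb] at this
    simp only [mul_zero, sub_self, zero_sub] at this
    rw [← this]
    congr 1; ext x; ring
  set A := ∫ x in a..b, g x ^ 2 * p x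
  set B := ∫ x in a..b, g' x ^ 2 * p x
  have i1 : IntervalIntegrable (fun x => g' x ^ 2 * p x) volume a b :=
    ((hg'c.pow 2).mul hp).intervalIntegrable _ _
  have i2 : IntervalIntegrable (fun x => G x ^ 2 * Real.exp (V x)) volume a b :=
    (Continuous.mul (hGc.pow 2) hVc.rexp).intervalIntegrable _ _
  -- Young's inequality, balanced so that with `A = -∫ g' G` it gives `2k² A ≤ B + k⁴ ∫ G² exp V`.
  -- The Dirichlet inequality bounds the last term by `k² A`, which is absorbed.
  have h3 : ∫ x in a..b, -2 * k ^ 2 * (g' x * G x) ≤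
      ∫ x in a..b, (g' x ^ 2 * p x + k ^ 4 * (G x ^ 2 * Real.exp (V x))) := by
    apply intervalIntegral.integral_mono_on hab.le _ (i1.add (i2.const_mul _))
    · intro x hx
      have e1 : p x = Real.exp (-V x / 2) ^ 2 := by
        simp only [p, ← Real.exp_nat_mul]; congr 1; push_cast; ring
      have e2 : Real.exp (V x) = Real.exp (V x / 2) ^ 2 := by
        rw [← Real.exp_nat_mul]; congr 1; push_cast; ring
      have e3 : Real.exp (-V x / 2) * Real.exp (V x / 2) = 1 := by
        rw [← Real.exp_add]; ring_nf; simp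
      rw [e1, e2]
      have := sq_nonneg (g' x * Real.exp (-V x / 2) + k ^ 2 * (G x * Real.exp (V x / 2)))
      have e4 : g' x * Real.exp (-V x / 2) * (k ^ 2 * (G x * Real.exp (V x / 2)))
        = k ^ 2 * (g' x * G x) := by
        linear_combination g' x * G x * k ^ 2 * e3
      nlinarith
    · exact ((hg'c.mul hGc).const_mul _).intervalIntegrable _ _
  rw [intervalIntegral.integral_add i1 (i2.const_mul _), intervalIntegral.integral_const_mul,
    intervalIntegral.integral_const_mul] at h3
  have h4 : 0 < k ^ 2 := by positivity
  have h5 := mul_le_mul_of_nonneg_left h1 h4.le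
  nlinarith

/-- Variance form of the Poincaré inequality on an interval for the weight `exp (-V)`. -/
theorem variance_exp_weight {a b k : ℝ} (hab : a < b) (hk : 0 < k)
    (hkab : k * (b - a) < Real.pi)
    {V V' V'' g g' : ℝ → ℝ} (hV : ∀ x, HasDerivAt V (V' x) x) (hV' : ∀ x, HasDerivAt V' (V'' x) x)
    (hV''c : Continuous V'') (hV'' : ∀ x ∈ Set.Icc a b, 0 ≤ V'' x)
    (hg : ∀ x, HasDerivAt g (g' x) x) (hg'c : Continuous g') :
    k ^ 2 * ((∫ x in a..b, g x ^ 2 * Real.exp (-V x)) * (∫ x in a..b, Real.exp (-V x))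
        - (∫ x in a..b, g x * Real.exp (-V x)) ^ 2)
      ≤ (∫ x in a..b, g' x ^ 2 * Real.exp (-V x)) * ∫ x in a..b, Real.exp (-V x) := by
  have hVc : Continuous V := continuous_iff_continuousAt.2 fun x => (hV x).continuousAt
  have hgc : Continuous g := continuous_iff_continuousAt.2 fun x => (hg x).continuousAt
  have hp : Continuous fun x => Real.exp (-V x) := by fun_prop
  have i0 : IntervalIntegrable (fun x => Real.exp (-V x)) volume a b := hp.intervalIntegrable _ _
  have i1 : IntervalIntegrable (fun x => g x * Real.exp (-V x)) volume a b :=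
    (hgc.mul hp).intervalIntegrable _ _
  have i2 : IntervalIntegrable (fun x => g x ^ 2 * Real.exp (-V x)) volume a b :=
    ((hgc.pow 2).mul hp).intervalIntegrable _ _
  -- Multiplying through by the mass `P` avoids a quotient, so that the inequality passes to limits
  -- and stays meaningful for weights of zero mass.
  set P := ∫ x in a..b, Real.exp (-V x)
  have hP : 0 < P := intervalIntegral.intervalIntegral_pos_of_pos i0 (fun x => Real.exp_pos _) hab
  set S := ∫ x in a..b, g x * Real.exp (-V x)
  set m := S / P
  have hm : m * P = S := by simp only [m]; field_simp
  have h := poincare_exp_weight_of_mean_zero hab hk hkab hV hV' hV''c hV''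
    (g := fun x => g x - m) (fun x => (hg x).sub_const m) hg'c (by
      have : ∀ x, (g x - m) * Real.exp (-V x) = g x * Real.exp (-V x) - m * Real.exp (-V x) :=
        fun x => by ring
      simp_rw [this]
      rw [intervalIntegral.integral_sub i1 (i0.const_mul _), intervalIntegral.integral_const_mul]
      linarith)
  have e : ∫ x in a..b, (g x - m) ^ 2 * Real.exp (-V x)
      = (∫ x in a..b, g x ^ 2 * Real.exp (-V x)) - 2 * m * S + m ^ 2 * P := by
    have : ∀ x, (g x - m) ^ 2 * Real.exp (-V x) = g x ^ 2 * Real.exp (-V x)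
      - 2 * m * (g x * Real.exp (-V x)) + m ^ 2 * Real.exp (-V x) := fun x => by ring
    simp_rw [this]
    rw [intervalIntegral.integral_add (i2.sub (i1.const_mul _)) (i0.const_mul _),
      intervalIntegral.integral_sub i2 (i1.const_mul _), intervalIntegral.integral_const_mul,
      intervalIntegral.integral_const_mul]
  rw [e] at h
  have h' := mul_le_mul_of_nonneg_right h hP.le
  refine le_trans (le_of_eq ?_) h'
  rw [← hm]
  ring

/-- The normalised bump is a probability density. The uniform bound serves as domination when the
mollified potentials are sent to their limit. -/
theorem ContDiffBump.norm_convolution_le {E : Type*} [NormedAddCommGroup E] [NormedSpace ℝ E]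
    [FiniteDimensional ℝ E] [MeasurableSpace E] [BorelSpace E] {μ : Measure E}
    [IsLocallyFiniteMeasure μ] [μ.IsOpenPosMeasure]
    (φ : ContDiffBump (0 : E)) {V : E → ℝ} {C : ℝ} (hC : ∀ x, |V x| ≤ C) (x : E) :
    |convolution (φ.normed μ) V (ContinuousLinearMap.lsmul ℝ ℝ) μ x| ≤ C := by
  have h1 : |∫ s, φ.normed μ s • V (x - s) ∂μ| ≤ ∫ s, φ.normed μ s * C ∂μ := by
    rw [← Real.norm_eq_abs]
    apply norm_integral_le_of_norm_le
    · exact φ.integrable_normed.mul_const C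
    · refine Eventually.of_forall fun s => ?_
      rw [norm_smul, Real.norm_of_nonneg (φ.nonneg_normed s)]
      exact mul_le_mul_of_nonneg_left (hC _) (φ.nonneg_normed s)
  rw [integral_mul_const, φ.integral_normed, one_mul] at h1
  exact h1

/-- Smooth approximation of convex functions of one variable, locally uniformly bounded. -/
theorem ConvexOn.exists_smooth_approx {α β a b : ℝ} {V : ℝ → ℝ}
    (hV : ConvexOn ℝ (Set.Ioo α β) V) (ha : α < a) (hab : a < b) (hb : b < β) :
    ∃ (W : ℕ → ℝ → ℝ) (C : ℝ), (∀ n, ContDiff ℝ ∞ (W n)) ∧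
      (∀ n, ∀ x ∈ Set.Icc a b, 0 ≤ deriv (deriv (W n)) x) ∧ (∀ n x, |W n x| ≤ C) ∧
      ∀ x ∈ Set.Icc a b, Tendsto (fun n => W n x) atTop (𝓝 (V x)) := by
  set a' := (α + a) / 2
  set b' := (b + β) / 2
  have ha1 : α < a' := by simp only [a']; linarith
  have ha2 : a' < a := by simp only [a']; linarith
  have hb1 : b < b' := by simp only [b']; linarith
  have hb2 : b' < β := by simp only [b']; linarith
  have hab' : a' ≤ b' := by linarith
  have hsub : Set.Icc a' b' ⊆ Set.Ioo α β := fun x hx => ⟨by linarith [hx.1], by linarith [hx.2]⟩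
  have hVc : ContinuousOn V (Set.Icc a' b') := (hV.continuousOn isOpen_Ioo).mono hsub
  -- Clamping the argument to `[a', b']` gives a bounded continuous function on the line, which can
  -- be mollified; it still equals `V` on `[a', b']`.
  set U : ℝ → ℝ := fun x => V (Set.projIcc a' b' hab' x)
  have hUc : Continuous U :=
    (continuousOn_iff_continuous_domRestrict.1 hVc).comp continuous_projIcc
  have hUV : ∀ x ∈ Set.Icc a' b', U x = V x := fun x hx => by
    simp only [U]; rw [Set.projIcc_of_mem hab' hx]
  obtain ⟨C, hC⟩ := isCompact_Icc.exists_bound_of_continuousOn hVc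
  have hUC : ∀ x, |U x| ≤ C := fun x => hC _ (Set.projIcc a' b' hab' x).2
  set r := min (a - a') (b' - b) / 2
  have hr : 0 < r := by
    have := lt_min (sub_pos.2 ha2) (sub_pos.2 hb1)
    simp only [r]; linarith
  have hr1 : 2 * r ≤ a - a' := by simp only [r]; linarith [min_le_left (a - a') (b' - b)]
  have hr2 : 2 * r ≤ b' - b := by simp only [r]; linarith [min_le_right (a - a') (b' - b)]
  set φ : ℕ → ContDiffBump (0 : ℝ) := fun n =>
    ⟨r / (n + 2), r / (n + 1), by positivity, by
      apply div_lt_div_of_pos_left hr (by positivity); linarith⟩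
  have hφr : ∀ n, (φ n).rOut ≤ r := fun n => by
    apply div_le_self hr.le; linarith [Nat.cast_nonneg (α := ℝ) n]
  set W : ℕ → ℝ → ℝ := fun n =>
    convolution ((φ n).normed volume) U (ContinuousLinearMap.lsmul ℝ ℝ) volume
  have hWs : ∀ n, ContDiff ℝ ∞ (W n) := fun n =>
    (φ n).hasCompactSupport_normed.contDiff_convolution_left _ (φ n).contDiff_normed
      hUc.locallyIntegrable
  refine ⟨W, C, hWs, fun n x hx => ?_, fun n x => (φ n).norm_convolution_le hUC x, fun x hx => ?_⟩
  -- A convolution averages translates by less than `r`. From `(a - r, b + r)` these stay inside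
  -- `[a', b']` because `2r ≤ a - a'` and `2r ≤ b' - b`, and there `U` is the convex function `V`.
  · have hconv : ConvexOn ℝ (Set.Ioo (a - r) (b + r)) (W n) := by
      refine ⟨convex_Ioo _ _, fun y hy z hz s t hs ht hst => ?_⟩
      have hint : ∀ w, Integrable (fun u => (φ n).normed volume u • U (w - u)) volume := by
        intro w
        have h1 : Continuous fun u => (φ n).normed volume u • U (w - u) :=
          (φ n).continuous_normed.smul (hUc.comp (by fun_prop))
        exact h1.integrable_of_hasCompactSupport
          ((φ n).hasCompactSupport_normed.smul_right)
      change ∫ u, (φ n).normed volume u • U (s • y + t • z - u) ≤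
        s • (∫ u, (φ n).normed volume u • U (y - u)) + t • ∫ u, (φ n).normed volume u • U (z - u)
      have iy : Integrable (fun u => s • ((φ n).normed volume u • U (y - u))) := (hint y).smul s
      have iz : Integrable (fun u => t • ((φ n).normed volume u • U (z - u))) := (hint z).smul t
      rw [← integral_smul, ← integral_smul, ← integral_add iy iz]
      apply integral_mono (hint _) (iy.add iz)
      intro u
      by_cases hu : u ∈ Function.support ((φ n).normed volume)
      · rw [(φ n).support_normed_eq, mem_ball_zero_iff, Real.norm_eq_abs] at hu
        have hu' := abs_lt.1 (hu.trans_le (hφr n))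
        have hy' : y - u ∈ Set.Icc a' b' := ⟨by linarith [hy.1], by linarith [hy.2]⟩
        have hz' : z - u ∈ Set.Icc a' b' := ⟨by linarith [hz.1], by linarith [hz.2]⟩
        have e : s • y + t • z - u = s • (y - u) + t • (z - u) := by
          simp only [smul_eq_mul]; linear_combination u * hst
        have hyz : s • y + t • z - u ∈ Set.Icc a' b' := by
          rw [e]; exact convex_Icc _ _ hy' hz' hs ht hst
        simp only [Pi.add_apply, hUV _ hy', hUV _ hz', hUV _ hyz]
        rw [e]
        have h2 := hV.2 (hsub hy') (hsub hz') hs ht hst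
        have h3 := mul_le_mul_of_nonneg_left h2 ((φ n).nonneg_normed (μ := volume) u)
        simp only [smul_eq_mul] at h3 ⊢
        linarith
      · simp [Function.notMem_support.1 hu]
    have hd1 : Differentiable ℝ (W n) := (hWs n).differentiable (by simp)
    have hm := hconv.monotoneOn_deriv (fun y _ => hd1 y)
    have h4 : 0 ≤ derivWithin (deriv (W n)) (Set.Ioo (a - r) (b + r)) x := hm.derivWithin_nonneg
    rwa [derivWithin_of_isOpen isOpen_Ioo ⟨by linarith [hx.1], by linarith [hx.2]⟩] at h4
  · rw [← hUV x ⟨by linarith [hx.1], by linarith [hx.2]⟩]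
    apply ContDiffBump.convolution_tendsto_right_of_continuous _ hUc
    have : Tendsto (fun n : ℕ => r * (1 / ((n : ℝ) + 1))) atTop (𝓝 (r * 0)) :=
      tendsto_one_div_add_atTop_nhds_zero_nat.const_mul r
    rw [mul_zero] at this
    refine this.congr fun n => ?_
    simp only [φ]; ring

/-- Variance form of the Poincaré inequality on an interval for the weight `exp (-V)` with `V`
convex. -/
theorem variance_convex_exp_weight {α β a b : ℝ} {V g g' : ℝ → ℝ}
    (hV : ConvexOn ℝ (Set.Ioo α β) V) (ha : α < a) (hab : a < b) (hb : b < β)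
    (hg : ∀ x, HasDerivAt g (g' x) x) (hg'c : Continuous g') :
    Real.pi ^ 2 * ((∫ x in a..b, g x ^ 2 * Real.exp (-V x)) * (∫ x in a..b, Real.exp (-V x))
        - (∫ x in a..b, g x * Real.exp (-V x)) ^ 2)
      ≤ (b - a) ^ 2 * ((∫ x in a..b, g' x ^ 2 * Real.exp (-V x)) *
        ∫ x in a..b, Real.exp (-V x)) := by
  have hgc : Continuous g := continuous_iff_continuousAt.2 fun x => (hg x).continuousAt
  obtain ⟨W, C, hWs, hW2, hWC, hWV⟩ := hV.exists_smooth_approx ha hab hb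
  have hlim : ∀ f : ℝ → ℝ, Continuous f → Tendsto (fun n => ∫ x in a..b, f x * Real.exp (-W n x))
      atTop (𝓝 (∫ x in a..b, f x * Real.exp (-V x))) := by
    intro f hf
    apply intervalIntegral.tendsto_integral_filter_of_dominated_convergence
      (fun x => |f x| * Real.exp C)
    · refine Eventually.of_forall fun n => ?_
      exact (hf.mul (hWs n).continuous.neg.rexp).aestronglyMeasurable
    · refine Eventually.of_forall fun n => Eventually.of_forall fun x _ => ?_
      rw [norm_mul, Real.norm_eq_abs, Real.norm_of_nonneg (Real.exp_pos _).le]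
      gcongr
      linarith [neg_abs_le (W n x), hWC n x]
    · exact (hf.abs.mul continuous_const).intervalIntegrable _ _
    · refine Eventually.of_forall fun x hx => ?_
      rw [Set.uIoc_of_le hab.le] at hx
      exact ((Real.continuous_exp.tendsto _).comp (hWV x ⟨hx.1.le, hx.2⟩).neg).const_mul _
  have h0 := hlim (fun _ => 1) continuous_const
  simp only [one_mul] at h0
  have h1 := hlim g hgc
  have h2 := hlim (fun x => g x ^ 2) (hgc.pow 2)
  have h3 := hlim (fun x => g' x ^ 2) (hg'c.pow 2)
  have key : ∀ k : ℝ, 0 < k → k * (b - a) < Real.pi →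
      k ^ 2 * ((∫ x in a..b, g x ^ 2 * Real.exp (-V x)) * (∫ x in a..b, Real.exp (-V x))
        - (∫ x in a..b, g x * Real.exp (-V x)) ^ 2)
      ≤ (∫ x in a..b, g' x ^ 2 * Real.exp (-V x)) * ∫ x in a..b, Real.exp (-V x) := by
    intro k hk hkab
    refine le_of_tendsto_of_tendsto' (((h2.mul h0).sub (h1.pow 2)).const_mul (k ^ 2))
      (h3.mul h0) fun n => ?_
    have hd : ContDiff ℝ ∞ (deriv (W n)) :=
      ((contDiff_infty_iff_deriv).1 (hWs n)).2
    exact variance_exp_weight hab hk hkab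
      (fun x => ((hWs n).differentiable (by simp) x).hasDerivAt)
      (fun x => (hd.differentiable (by simp) x).hasDerivAt)
      (hd.continuous_deriv (by simp)) (hW2 n) hg hg'c
  set X := (∫ x in a..b, g x ^ 2 * Real.exp (-V x)) * (∫ x in a..b, Real.exp (-V x))
        - (∫ x in a..b, g x * Real.exp (-V x)) ^ 2
  set Y := (∫ x in a..b, g' x ^ 2 * Real.exp (-V x)) * ∫ x in a..b, Real.exp (-V x)
  have hba : 0 < b - a := sub_pos.2 hab
  -- The inequality is available only for `k < π / (b - a)`; the sharp constant is the limit from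
  -- the left.
  have hlim2 : Tendsto (fun k : ℝ => k ^ 2 * X) (𝓝[<] (Real.pi / (b - a)))
      (𝓝 ((Real.pi / (b - a)) ^ 2 * X)) := by
    apply tendsto_nhdsWithin_of_tendsto_nhds
    exact (Continuous.tendsto (by fun_prop) _)
  have h5 : (Real.pi / (b - a)) ^ 2 * X ≤ Y := by
    refine le_of_tendsto hlim2 ?_
    have : Set.Ioo 0 (Real.pi / (b - a)) ∈ 𝓝[<] (Real.pi / (b - a)) :=
      Ioo_mem_nhdsLT (by positivity)
    filter_upwards [this] with k hk
    exact key k hk.1 (by rw [← lt_div_iff₀ hba]; exact hk.2)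
  have h6 := mul_le_mul_of_nonneg_left h5 (sq_nonneg (b - a))
  refine le_trans (le_of_eq ?_) h6
  field_simp

/-- **Payne–Weinberger inequality in dimension one**: the Poincaré inequality, in variance form, on
an interval of length `B - A` with a log-concave weight `p`. -/
theorem variance_logConcave_weight {A B : ℝ} {p g g' : ℝ → ℝ}
    (hp0 : ∀ x, 0 ≤ p x) (hpi : Integrable p) (hps : ∀ x, x ∉ Set.Icc A B → p x = 0)
    (hlc : ∀ x y s t, 0 < s → 0 < t → s + t = 1 → p x ^ s * p y ^ t ≤ p (s * x + t * y))
    (hg : ∀ x, HasDerivAt g (g' x) x) (hg'c : Continuous g') :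
    Real.pi ^ 2 * ((∫ x, g x ^ 2 * p x) * (∫ x, p x) - (∫ x, g x * p x) ^ 2)
      ≤ (B - A) ^ 2 * ((∫ x, g' x ^ 2 * p x) * ∫ x, p x) := by
  have hgc : Continuous g := continuous_iff_continuousAt.2 fun x => (hg x).continuousAt
  -- Log-concavity makes the positivity set an interval, inside which `p = exp(-V)` with `V = -log
  -- p` convex.
  set I : Set ℝ := {x | 0 < p x}
  have hIconv : Convex ℝ I := by
    intro x hx y hy s t hs ht hst
    rcases hs.eq_or_lt with rfl | hs
    · obtain rfl : t = 1 := by linarith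
      simpa using hy
    rcases ht.eq_or_lt with rfl | ht
    · obtain rfl : s = 1 := by linarith
      simpa using hx
    exact lt_of_lt_of_le (mul_pos (Real.rpow_pos_of_pos hx _) (Real.rpow_pos_of_pos hy _))
      (hlc x y s t hs ht hst)
  have hIAB : I ⊆ Set.Icc A B := fun x hx => by
    by_contra h
    exact (ne_of_gt hx) (hps x h)
  have hI0 : ∀ x, x ∉ I → p x = 0 := fun x hx => le_antisymm (not_lt.1 hx) (hp0 x)
  by_cases hII : I.Subsingleton
  · have h0 : p =ᵐ[volume] 0 := by
      have hn : volume I = 0 := hII.measure_zero _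
      filter_upwards [measure_eq_zero_iff_ae_notMem.1 hn] with x hx
      exact hI0 x hx
    have h1 : ∫ x, p x = 0 := integral_eq_zero_of_ae h0
    have h2 : ∫ x, g x * p x = 0 := integral_eq_zero_of_ae (by
      filter_upwards [h0] with x hx; simp [hx])
    simp [h1, h2]
  rw [Set.not_subsingleton_iff] at hII
  have hbb : BddBelow I := ⟨A, fun x hx => (hIAB hx).1⟩
  have hba : BddAbove I := ⟨B, fun x hx => (hIAB hx).2⟩
  set α := sInf I
  set β := sSup I
  have hαβ : α < β := by
    obtain ⟨x, hx, y, hy, hxy⟩ := hII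
    rcases lt_or_gt_of_ne hxy with h | h
    · exact (csInf_le hbb hx).trans_lt (h.trans_le (le_csSup hba hy))
    · exact (csInf_le hbb hy).trans_lt (h.trans_le (le_csSup hba hx))
  have hIoo : Set.Ioo α β ⊆ I := by
    intro x hx
    obtain ⟨y, hy, hyx⟩ := exists_lt_of_csInf_lt hII.nonempty hx.1
    obtain ⟨z, hz, hxz⟩ := exists_lt_of_lt_csSup hII.nonempty hx.2
    exact hIconv.ordConnected.out hy hz ⟨hyx.le, hxz.le⟩
  have hIIcc : I ⊆ Set.Icc α β := fun x hx => ⟨csInf_le hbb hx, le_csSup hba hx⟩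
  have hAα : A ≤ α := le_csInf hII.nonempty fun x hx => (hIAB hx).1
  have hβB : β ≤ B := csSup_le hII.nonempty fun x hx => (hIAB hx).2
  set V : ℝ → ℝ := fun x => -Real.log (p x)
  have hpV : ∀ x ∈ Set.Ioo α β, p x = Real.exp (-V x) := fun x hx => by
    simp only [V, neg_neg]; rw [Real.exp_log (hIoo hx)]
  have hV : ConvexOn ℝ (Set.Ioo α β) V := by
    refine convexOn_iff_forall_pos.2 ⟨convex_Ioo _ _, fun x hx y hy s t hs ht hst => ?_⟩
    have hx' : 0 < p x := hIoo hx
    have hy' : 0 < p y := hIoo hy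
    have h1 := Real.log_le_log (mul_pos (Real.rpow_pos_of_pos hx' s) (Real.rpow_pos_of_pos hy' t))
      (hlc x y s t hs ht hst)
    rw [Real.log_mul (Real.rpow_pos_of_pos hx' s).ne' (Real.rpow_pos_of_pos hy' t).ne',
      Real.log_rpow hx', Real.log_rpow hy'] at h1
    simp only [V, smul_eq_mul]
    linarith
  have hfi : ∀ f : ℝ → ℝ, Continuous f → Integrable (fun x => f x * p x) := by
    intro f hf
    have h1 : IntegrableOn (fun x => f x * p x) (Set.Icc A B) :=
      hpi.integrableOn.continuousOn_mul hf.continuousOn isCompact_Icc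
    refine (integrableOn_iff_integrable_of_support_subset ?_).1 h1
    intro x hx
    by_contra h
    exact hx (by simp [hps x h])
  have hfe : ∀ f : ℝ → ℝ, ∫ x, f x * p x = ∫ x in Set.Ioo α β, f x * p x := by
    intro f
    rw [← integral_Icc_eq_integral_Ioo, setIntegral_eq_integral_of_forall_compl_eq_zero]
    intro x hx
    rw [hI0 x (fun h => hx (hIIcc h)), mul_zero]
  -- At the ends of its support the weight may jump or tend to zero, so compact subintervals exhaust
  -- `(α, β)`; the factor one third ensures `a n < b n` already for `n = 0`.
  set a : ℕ → ℝ := fun n => α + (β - α) / 3 * (1 / ((n : ℝ) + 1))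
  set b : ℕ → ℝ := fun n => β - (β - α) / 3 * (1 / ((n : ℝ) + 1))
  have hn1 : ∀ n : ℕ, 1 / ((n : ℝ) + 1) ≤ 1 := fun n => by
    rw [div_le_one (by positivity)]; linarith [Nat.cast_nonneg (α := ℝ) n]
  have hn0 : ∀ n : ℕ, 0 < 1 / ((n : ℝ) + 1) := fun n => by positivity
  have han : ∀ n, α < a n := fun n => by
    have := mul_pos (show 0 < (β - α) / 3 by linarith) (hn0 n)
    simp only [a]; linarith
  have hbn : ∀ n, b n < β := fun n => by
    have := mul_pos (show 0 < (β - α) / 3 by linarith) (hn0 n)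
    simp only [b]; linarith
  have habn : ∀ n, a n < b n := fun n => by
    have := mul_le_mul_of_nonneg_left (hn1 n) (show 0 ≤ (β - α) / 3 by linarith)
    simp only [a, b]; linarith
  have hta : Tendsto a atTop (𝓝 α) := by
    have := (tendsto_one_div_add_atTop_nhds_zero_nat (𝕜 := ℝ)).const_mul ((β - α) / 3)
    simpa [a] using this.const_add α
  have htb : Tendsto b atTop (𝓝 β) := by
    have := (tendsto_one_div_add_atTop_nhds_zero_nat (𝕜 := ℝ)).const_mul ((β - α) / 3)
    simpa [b] using this.const_sub β
  have hlim : ∀ f : ℝ → ℝ, Continuous f →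
      Tendsto (fun n => ∫ x in (a n)..(b n), f x * Real.exp (-V x)) atTop
        (𝓝 (∫ x, f x * p x)) := by
    intro f hf
    have h1 := (aecover_Ioo_of_Icc (μ := volume) hta htb).integral_tendsto_of_countably_generated
      (hfi f hf).restrict
    rw [hfe]
    refine h1.congr fun n => ?_
    have hs : Set.Icc (a n) (b n) ⊆ Set.Ioo α β := fun x hx =>
      ⟨(han n).trans_le hx.1, hx.2.trans_lt (hbn n)⟩
    rw [Measure.restrict_restrict measurableSet_Icc, Set.inter_eq_left.2 hs,
      intervalIntegral.integral_of_le (habn n).le, ← integral_Icc_eq_integral_Ioc]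
    exact setIntegral_congr_fun measurableSet_Icc fun x hx => by
      simp only [hpV x (hs hx)]
  have h0 := hlim (fun _ => 1) continuous_const
  simp only [one_mul] at h0
  have h1 := hlim g hgc
  have h2 := hlim (fun x => g x ^ 2) (hgc.pow 2)
  have h3 := hlim (fun x => g' x ^ 2) (hg'c.pow 2)
  refine le_of_tendsto_of_tendsto' (((h2.mul h0).sub (h1.pow 2)).const_mul (Real.pi ^ 2))
    ((h3.mul h0).const_mul ((B - A) ^ 2)) fun n => ?_
  refine (variance_convex_exp_weight hV (han n) (habn n) (hbn n) hg hg'c).trans ?_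
  apply mul_le_mul_of_nonneg_right
  · have := habn n
    have := han n
    have := hbn n
    apply pow_le_pow_left₀ <;> linarith
  · apply mul_nonneg <;> apply intervalIntegral.integral_nonneg (habn n).le <;> intros <;> positivity

/-! ### Brunn–Minkowski, Prékopa–Leindler and log-concavity. -/

/-- The one-dimensional Brunn–Minkowski inequality for compact sets. -/
theorem IsCompact.volume_add_le {K L C : Set ℝ} (hK : IsCompact K) (hL : IsCompact L)
    (hK0 : K.Nonempty) (hL0 : L.Nonempty) (hC : ∀ x ∈ K, ∀ y ∈ L, x + y ∈ C) :
    volume K + volume L ≤ volume C := by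
  -- The translates `K + min L` and `max K + L` both lie in `C`, and they can meet only in the point
  -- `max K + min L`.
  set a := sSup K
  set b := sInf L
  have ha : a ∈ K := hK.sSup_mem hK0
  have hb : b ∈ L := hL.sInf_mem hL0
  have h1 : volume ((fun x => x + b) '' K) = volume K := by
    rw [Set.image_add_right, measure_preimage_add_right]
  have h2 : volume ((fun x => a + x) '' L) = volume L := by
    rw [Set.image_add_left, measure_preimage_add]
  have hd : AEDisjoint volume ((fun x => x + b) '' K) ((fun x => a + x) '' L) := by
    refine measure_mono_null (t := {a + b}) ?_ (by simp)
    rintro _ ⟨⟨x, hx, rfl⟩, ⟨y, hy, hxy⟩⟩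
    have h3 : x ≤ a := le_csSup hK.bddAbove hx
    have h4 : b ≤ y := csInf_le hL.bddBelow hy
    simp only [Set.mem_singleton_iff] at hxy ⊢
    linarith
  have hm : NullMeasurableSet ((fun x => a + x) '' L) volume :=
    (hL.image (by fun_prop)).measurableSet.nullMeasurableSet
  rw [← h1, ← h2, ← measure_union₀ hm hd]
  apply measure_mono
  rintro _ (⟨x, hx, rfl⟩ | ⟨x, hx, rfl⟩)
  · exact hC _ hx _ hb
  · exact hC _ ha _ hx

/-- The one-dimensional Brunn–Minkowski inequality. -/
theorem volume_convex_combination_le {A B C : Set ℝ} {s t : ℝ} (hs : 0 < s) (ht : 0 < t)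
    (hA : MeasurableSet A) (hB : MeasurableSet B) (hA0 : A.Nonempty) (hB0 : B.Nonempty)
    (hC : ∀ x ∈ A, ∀ y ∈ B, s * x + t * y ∈ C) :
    ENNReal.ofReal s * volume A + ENNReal.ofReal t * volume B ≤ volume C := by
  obtain ⟨x0, hx0⟩ := hA0
  obtain ⟨y0, hy0⟩ := hB0
  rw [hA.measure_eq_iSup_isCompact, hB.measure_eq_iSup_isCompact]
  simp only [ENNReal.mul_iSup, iSup_and']
  refine ENNReal.biSup_add_biSup_le' ⟨∅, by simp⟩ ⟨∅, by simp⟩ fun K hK L hL => ?_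
  -- The compact sets supplied by inner regularity may be empty, in which case the additive
  -- inequality would not apply; adjoining the fixed points `x0`, `y0` repairs this.
  have key := IsCompact.volume_add_le (C := C) ((hK.2.insert x0).image (f := fun x => s * x) (by fun_prop))
    ((hL.2.insert y0).image (f := fun x => t * x) (by fun_prop))
    ((Set.insert_nonempty _ _).image _) ((Set.insert_nonempty _ _).image _) (by
      rintro _ ⟨x, hx, rfl⟩ _ ⟨y, hy, rfl⟩
      exact hC _ (Set.insert_subset hx0 hK.1 hx) _ (Set.insert_subset hy0 hL.1 hy))
  refine le_trans ?_ key
  have e : ∀ (r : ℝ) (S : Set ℝ), 0 < r → volume ((fun x => r * x) '' S)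
      = ENNReal.ofReal r * volume S := fun r S hr => by
    have := Measure.addHaar_image_homothety (volume : Measure ℝ) 0 r S
    have h2 : (AffineMap.homothety (0 : ℝ) r : ℝ → ℝ) = fun x => r * x := by
      ext x; simp [AffineMap.homothety_apply]
    rw [h2] at this
    simpa [abs_of_pos hr] using this
  rw [e _ _ hs, e _ _ ht]
  gcongr <;> exact Set.subset_insert _ _

/-- A sup-normalised additive form of the one-dimensional Prékopa–Leindler inequality. -/
theorem lintegral_add_le_of_min_le {U V W : ℝ → ENNReal} {s t : ℝ} (hs : 0 < s) (ht : 0 < t)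
    (hU : Measurable U) (hV : Measurable V) (hW : Measurable W)
    (hU1 : (⨆ x, U x) = 1) (hV1 : (⨆ x, V x) = 1)
    (h : ∀ x y, min (U x) (V y) ≤ W (s * x + t * y)) :
    ENNReal.ofReal s * (∫⁻ x, U x) + ENNReal.ofReal t * (∫⁻ x, V x) ≤ ∫⁻ x, W x := by
  -- Layer-cake formula for functions bounded by one: only the levels in `(0, 1)` count.
  have cake : ∀ f : ℝ → ENNReal, Measurable f → (∀ x, f x ≤ 1) →
      ∫⁻ x, f x = ∫⁻ r in Set.Ioo (0 : ℝ) 1, volume {x | ENNReal.ofReal r < f x} := by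
    intro f hf hf1
    have h1 : ∀ x, f x ≠ ⊤ := fun x => ne_top_of_le_ne_top ENNReal.one_ne_top (hf1 x)
    have h2 := lintegral_eq_lintegral_meas_lt (volume : Measure ℝ) (f := fun x => (f x).toReal)
      (Eventually.of_forall fun x => ENNReal.toReal_nonneg) hf.ennreal_toReal.aemeasurable
    simp only [ENNReal.ofReal_toReal (h1 _)] at h2
    rw [h2]
    have h3 : ∀ r ∈ Set.Ioi (0 : ℝ), volume {a | r < (f a).toReal} =
        (Set.Ioo (0 : ℝ) 1).indicator (fun r => volume {x | ENNReal.ofReal r < f x}) r := by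
      intro r hr
      by_cases hr1 : r < 1
      · rw [Set.indicator_of_mem (show r ∈ Set.Ioo (0 : ℝ) 1 from ⟨hr, hr1⟩)]
        congr 1; ext x
        simp only [Set.mem_ofPred_eq]
        rw [ENNReal.ofReal_lt_iff_lt_toReal (le_of_lt hr) (h1 x)]
      · rw [Set.indicator_of_notMem (fun hh => hr1 hh.2)]
        convert measure_empty (μ := (volume : Measure ℝ))
        ext x
        simp only [Set.mem_ofPred_eq, Set.mem_empty_iff_false, iff_false, not_lt]
        refine le_trans ?_ (not_lt.1 hr1)
        simpa using ENNReal.toReal_mono ENNReal.one_ne_top (hf1 x)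
    rw [setLIntegral_congr_fun measurableSet_Ioi h3, lintegral_indicator measurableSet_Ioo,
      Measure.restrict_restrict measurableSet_Ioo]
    congr 2
    exact Set.inter_eq_left.2 fun x hx => hx.1
  have hU' : ∀ x, U x ≤ 1 := fun x => hU1 ▸ le_iSup U x
  have hV' : ∀ x, V x ≤ 1 := fun x => hV1 ▸ le_iSup V x
  have hW' : ∫⁻ x, min (W x) 1 ≤ ∫⁻ x, W x := lintegral_mono fun x => min_le_left _ _
  refine le_trans ?_ hW'
  have hmeas : ∀ f : ℝ → ENNReal, Measurable fun r : ℝ => volume {x | ENNReal.ofReal r < f x} := by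
    intro f
    apply Antitone.measurable
    intro r r' hr
    exact measure_mono fun x hx => lt_of_le_of_lt (ENNReal.ofReal_le_ofReal hr) hx
  rw [cake U hU hU', cake V hV hV', cake _ (hW.min measurable_const) (fun x => min_le_right _ _),
    ← lintegral_const_mul _ (hmeas U), ← lintegral_const_mul _ (hmeas V),
    ← lintegral_add_left ((hmeas U).const_mul _)]
  apply setLIntegral_mono' measurableSet_Ioo
  intro r hr
  -- Since both suprema equal one, both superlevel sets are nonempty at the same level `r < 1`. This
  -- is what the normalisation is for: Brunn–Minkowski requires nonempty sets.
  have hr1 : ENNReal.ofReal r < 1 := by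
    rw [← ENNReal.ofReal_one]; exact (ENNReal.ofReal_lt_ofReal_iff one_pos).2 hr.2
  apply volume_convex_combination_le hs ht (measurableSet_lt measurable_const hU)
    (measurableSet_lt measurable_const hV)
  · rw [← hU1] at hr1; exact lt_iSup_iff.1 hr1
  · rw [← hV1] at hr1; exact lt_iSup_iff.1 hr1
  · intro x hx y hy
    exact lt_min ((lt_min hx hy).trans_le (h x y)) hr1

theorem ENNReal.rpow_mul_rpow_le_add {s t : ℝ} (hs : 0 < s) (ht : 0 < t) (hst : s + t = 1)
    (a b : ENNReal) : a ^ s * b ^ t ≤ ENNReal.ofReal s * a + ENNReal.ofReal t * b := by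
  by_cases ha : a = ⊤
  · simp [ha, ENNReal.mul_top, hs]
  by_cases hb : b = ⊤
  · simp [hb, ENNReal.mul_top, ht]
  lift a to NNReal using ha
  lift b to NNReal using hb
  have := NNReal.geom_mean_le_arith_mean2_weighted s.toNNReal t.toNNReal a b (by
    rw [← Real.toNNReal_add hs.le ht.le, hst, Real.toNNReal_one])
  rw [Real.coe_toNNReal _ hs.le, Real.coe_toNNReal _ ht.le] at this
  rw [← ENNReal.coe_rpow_of_nonneg _ hs.le, ← ENNReal.coe_rpow_of_nonneg _ ht.le, ENNReal.ofReal,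
    ENNReal.ofReal]
  exact_mod_cast this

/-- The one-dimensional Prékopa–Leindler inequality for bounded functions. -/
theorem prekopa_leindler_of_bounded {u v w : ℝ → ENNReal} {s t : ℝ} (hs : 0 < s) (ht : 0 < t)
    (hst : s + t = 1) (hu : Measurable u) (hv : Measurable v) (hw : Measurable w)
    (hub : (⨆ x, u x) ≠ ⊤) (hvb : (⨆ x, v x) ≠ ⊤)
    (h : ∀ x y, u x ^ s * v y ^ t ≤ w (s * x + t * y)) :
    (∫⁻ x, u x) ^ s * (∫⁻ x, v x) ^ t ≤ ∫⁻ x, w x := by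
  set M := ⨆ x, u x
  set N := ⨆ x, v x
  by_cases hM : M = 0
  · have : ∀ x, u x = 0 := fun x => le_antisymm (hM ▸ le_iSup u x) zero_le
    simp [this, hs]
  by_cases hN : N = 0
  · have : ∀ x, v x = 0 := fun x => le_antisymm (hN ▸ le_iSup v x) zero_le
    simp [this, ht]
  set c := M ^ s * N ^ t
  have hc0 : c ≠ 0 := mul_ne_zero (by simp [ENNReal.rpow_eq_zero_iff, hM, hub])
    (by simp [ENNReal.rpow_eq_zero_iff, hN, hvb])
  have hct : c ≠ ⊤ := ENNReal.mul_ne_top (ENNReal.rpow_ne_top_of_nonneg hs.le hub)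
    (ENNReal.rpow_ne_top_of_nonneg ht.le hvb)
  have e : ∀ a b : ENNReal, (M⁻¹ * a) ^ s * (N⁻¹ * b) ^ t = c⁻¹ * (a ^ s * b ^ t) := by
    intro a b
    rw [ENNReal.mul_rpow_of_nonneg _ _ hs.le, ENNReal.mul_rpow_of_nonneg _ _ ht.le,
      ENNReal.inv_rpow, ENNReal.inv_rpow, ENNReal.mul_inv (Or.inr (ENNReal.rpow_ne_top_of_nonneg ht.le hvb))
      (Or.inl (ENNReal.rpow_ne_top_of_nonneg hs.le hub))]
    ring
  -- Dividing by the suprema produces the normalisation. The minimum is bounded by the geometric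
  -- mean since `s + t = 1`, and the arithmetic–geometric inequality afterwards turns the additive
  -- conclusion into the multiplicative one.
  have key := lintegral_add_le_of_min_le (U := fun x => M⁻¹ * u x) (V := fun x => N⁻¹ * v x)
    (W := fun x => c⁻¹ * w x) hs ht (hu.const_mul _) (hv.const_mul _) (hw.const_mul _)
    (by rw [← ENNReal.mul_iSup]; exact ENNReal.inv_mul_cancel hM hub)
    (by rw [← ENNReal.mul_iSup]; exact ENNReal.inv_mul_cancel hN hvb)
    (fun x y => by
      refine le_trans ?_ (mul_le_mul_right (h x y) c⁻¹)
      rw [← e]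
      set a := M⁻¹ * u x
      set b := N⁻¹ * v y
      calc min a b = min a b ^ s * min a b ^ t := by
            rw [← ENNReal.rpow_add_of_nonneg _ _ hs.le ht.le, hst, ENNReal.rpow_one]
        _ ≤ a ^ s * b ^ t := by
            gcongr
            · exact min_le_left _ _
            · exact min_le_right _ _)
  have h2 := (ENNReal.rpow_mul_rpow_le_add hs ht hst _ _).trans key
  rw [lintegral_const_mul _ hu, lintegral_const_mul _ hv, lintegral_const_mul _ hw, e] at h2
  have h3 := mul_le_mul_right h2 c
  rwa [← mul_assoc, ENNReal.mul_inv_cancel hc0 hct, one_mul, ← mul_assoc,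
    ENNReal.mul_inv_cancel hc0 hct, one_mul] at h3

/-- The one-dimensional **Prékopa–Leindler inequality**. -/
theorem prekopa_leindler {u v w : ℝ → ENNReal} {s t : ℝ} (hs : 0 < s) (ht : 0 < t)
    (hst : s + t = 1) (hu : Measurable u) (hv : Measurable v) (hw : Measurable w)
    (h : ∀ x y, u x ^ s * v y ^ t ≤ w (s * x + t * y)) :
    (∫⁻ x, u x) ^ s * (∫⁻ x, v x) ^ t ≤ ∫⁻ x, w x := by
  -- Truncation at integer heights and monotone convergence remove the boundedness assumption.
  have hsup : ∀ f : ℝ → ENNReal, Measurable f → ∫⁻ x, f x = ⨆ n : ℕ, ∫⁻ x, min (f x) n := by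
    intro f hf
    rw [← lintegral_iSup (fun n => hf.min measurable_const)]
    · congr 1; ext x
      change f x = ⨆ i : ℕ, (f x ⊓ (i : ENNReal))
      rw [← inf_iSup_eq, ENNReal.iSup_natCast, inf_top_eq]
    · intro n m hnm x
      exact min_le_min le_rfl (by exact_mod_cast hnm)
  have hpow : ∀ (f : ℕ → ENNReal) (r : ℝ), 0 < r → (⨆ n, f n) ^ r = ⨆ n, f n ^ r := fun f r hr =>
    (ENNReal.orderIsoRpow r hr).map_iSup f
  rw [hsup u hu, hsup v hv, hpow _ _ hs, hpow _ _ ht]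
  rw [ENNReal.iSup_mul]
  refine iSup_le fun n => ?_
  rw [ENNReal.mul_iSup]
  refine iSup_le fun m => ?_
  apply prekopa_leindler_of_bounded hs ht hst (hu.min measurable_const) (hv.min measurable_const) hw
  · exact ne_top_of_le_ne_top (ENNReal.natCast_ne_top n) (iSup_le fun x => min_le_right _ _)
  · exact ne_top_of_le_ne_top (ENNReal.natCast_ne_top m) (iSup_le fun x => min_le_right _ _)
  · intro x y
    refine le_trans ?_ (h x y)
    gcongr <;> exact min_le_left _ _

/-- Log-concavity of a non-negative function. -/
def LogConcave {E : Type*} [AddCommGroup E] [Module ℝ E] (f : E → ENNReal) : Prop :=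
  ∀ x y : E, ∀ s t : ℝ, 0 < s → 0 < t → s + t = 1 → f x ^ s * f y ^ t ≤ f (s • x + t • y)

/-- Integrating this indicator over all but one coordinate gives the section-volume function of a
convex body. -/
theorem Convex.logConcave_indicator {E : Type*} [AddCommGroup E] [Module ℝ E] {K : Set E}
    (hK : Convex ℝ K) : LogConcave (K.indicator (1 : E → ENNReal)) := by
  intro x y s t hs ht hst
  by_cases hx : x ∈ K
  · by_cases hy : y ∈ K
    · simp [hx, hy, hK hx hy hs.le ht.le hst]
    · simp [hy, ht]
  · simp [hx, hs]

/-- **Prékopa's theorem**: integrating out one real variable preserves log-concavity. -/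
theorem LogConcave.lintegral_real {E : Type*} [AddCommGroup E] [Module ℝ E] [MeasurableSpace E]
    {f : E × ℝ → ENNReal} (hf : LogConcave f) (hfm : Measurable f) :
    LogConcave fun x => ∫⁻ y, f (x, y) := by
  intro x x' s t hs ht hst
  apply prekopa_leindler hs ht hst (hfm.comp measurable_prodMk_left)
    (hfm.comp measurable_prodMk_left) (hfm.comp measurable_prodMk_left)
  intro y y'
  exact hf (x, y) (x', y') s t hs ht hst

/-- Induction on the number of coordinates: the head coordinate is split off and integrated out by
Prékopa's theorem, the remaining ones by the induction hypothesis, and Tonelli reassembles the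
integral. -/
theorem LogConcave.lintegral_pi {E : Type*} [AddCommGroup E] [Module ℝ E] [MeasurableSpace E]
    {n : ℕ} {f : E × (Fin n → ℝ) → ENNReal} (hf : LogConcave f) (hfm : Measurable f) :
    LogConcave fun x => ∫⁻ y, f (x, y) := by
  induction n with
  | zero =>
    intro x x' s t hs ht hst
    have h0 : ∀ z, ∫⁻ y : Fin 0 → ℝ, f (z, y) = f (z, default) := fun z => by
      rw [lintegral_unique]; simp [volume_pi]
      exact congrArg (fun y => f (z, y)) (Subsingleton.elim _ _)
    simp only [h0]
    refine (hf (x, default) (x', default) s t hs ht hst).trans (le_of_eq ?_)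
    congr 1
    exact Prod.ext rfl (Subsingleton.elim _ _)
  | succ n ih =>
    set e := MeasurableEquiv.piFinSuccAbove (fun _ : Fin (n + 1) => ℝ) 0
    have he : MeasurePreserving e.symm volume volume :=
      (volume_preserving_piFinSuccAbove (fun _ : Fin (n + 1) => ℝ) 0).symm
    have hec : ∀ p, e.symm p = Fin.cons p.1 p.2 := fun p => by
      simp [e, MeasurableEquiv.piFinSuccAbove, Fin.insertNthEquiv, Fin.insertNth_zero']
    set F : (E × (Fin n → ℝ)) × ℝ → ENNReal := fun q => f (q.1.1, e.symm (q.2, q.1.2))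
    have hF : LogConcave F := by
      intro p q s t hs ht hst
      have h := hf (p.1.1, e.symm (p.2, p.1.2)) (q.1.1, e.symm (q.2, q.1.2)) s t hs ht hst
      refine h.trans (le_of_eq ?_)
      simp only [F]
      congr 1
      ext i
      · rfl
      · refine Fin.cases ?_ (fun j => ?_) i <;> simp [hec]
    have hFm : Measurable F := by
      apply hfm.comp
      exact (measurable_fst.comp measurable_fst).prodMk
        (e.symm.measurable.comp (measurable_snd.prodMk (measurable_snd.comp measurable_fst)))
    have hG := ih (hF.lintegral_real hFm) hFm.lintegral_prod_right'
    convert hG using 2 with x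
    have h1 := he.lintegral_comp (f := fun y => f (x, y)) (hfm.comp measurable_prodMk_left)
    rw [← h1, Measure.volume_eq_prod, lintegral_prod_symm _ (by
      exact (hfm.comp (measurable_const.prodMk e.symm.measurable)).aemeasurable)]

/-! ### Payne–Weinberger for functions of one linear coordinate. -/

/-- Orthonormal coordinates of `ℝ^(n+1)` whose first coordinate is `⟪θ, ·⟫`. -/
theorem exists_measurePreserving_coordinates {n : ℕ} {θ : Space (n + 1)} (hθ : ‖θ‖ = 1) :
    ∃ S : (ℝ × (Fin n → ℝ)) ≃ₗ[ℝ] Space (n + 1),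
      MeasurePreserving S volume volume ∧ (∀ p, inner ℝ θ (S p) = p.1) ∧
      ∀ p, ‖S p‖ ^ 2 = p.1 ^ 2 + ∑ i, p.2 i ^ 2 := by
  have hcard : Module.finrank ℝ (Space (n + 1)) = Fintype.card (Fin (n + 1)) := by simp
  obtain ⟨b, hb⟩ := Orthonormal.exists_orthonormalBasis_extension_of_card_eq (𝕜 := ℝ) hcard
    (v := fun _ => θ) (s := {0}) (by
      constructor
      · intro i; simpa using hθ
      · intro i j hij
        exact absurd (Subsingleton.elim i j) hij)
  have hb0 : b 0 = θ := hb 0 rfl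
  set e := MeasurableEquiv.piFinSuccAbove (fun _ : Fin (n + 1) => ℝ) 0
  have he : MeasurePreserving e.symm volume volume :=
    (volume_preserving_piFinSuccAbove (fun _ : Fin (n + 1) => ℝ) 0).symm
  have hec : ∀ p, e.symm p = Fin.cons p.1 p.2 := fun p => by
    simp [e, MeasurableEquiv.piFinSuccAbove, Fin.insertNthEquiv, Fin.insertNth_zero']
  let L : (ℝ × (Fin n → ℝ)) ≃ₗ[ℝ] Space (n + 1) :=
    { toFun := fun p => WithLp.toLp 2 (Fin.cons p.1 p.2 : Fin (n + 1) → ℝ)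
      map_add' := fun p q => by
        ext i; refine Fin.cases ?_ (fun j => ?_) i <;> simp
      map_smul' := fun c p => by
        ext i; refine Fin.cases ?_ (fun j => ?_) i <;> simp
      invFun := fun x => (x 0, fun i => x i.succ)
      left_inv := fun p => by simp
      right_inv := fun x => by
        ext i; refine Fin.cases ?_ (fun j => ?_) i <;> simp }
  have hL : MeasurePreserving L volume volume := by
    have h1 := (PiLp.volume_preserving_toLp (Fin (n + 1))).comp he
    have h2 : (L : (ℝ × (Fin n → ℝ)) → Space (n + 1)) = WithLp.toLp 2 ∘ e.symm := by
      funext p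
      change WithLp.toLp 2 (Fin.cons p.1 p.2 : Fin (n + 1) → ℝ) = WithLp.toLp 2 (e.symm p)
      rw [hec]
    rw [h2]
    exact h1
  refine ⟨L.trans b.repr.symm.toLinearEquiv, ?_, fun p => ?_, fun p => ?_⟩
  · exact (b.repr.symm.measurePreserving).comp hL
  · rw [← hb0, ← b.repr_apply_apply]
    simp [L]
  · have : ‖(L.trans b.repr.symm.toLinearEquiv) p‖ = ‖L p‖ := b.repr.symm.norm_map _
    rw [this, EuclideanSpace.norm_sq_eq, Fin.sum_univ_succ]
    simp [L]

/-- The Payne–Weinberger inequality on a convex body for functions of one linear coordinate. -/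
theorem Convex.variance_ridge_le {n : ℕ} {θ : Space (n + 1)} (hθ : ‖θ‖ = 1)
    {K : Set (Space (n + 1))} (hK : IsCompact K) (hKc : Convex ℝ K) {h : ℝ}
    (hdiam : Metric.diam K ≤ h) {g g' : ℝ → ℝ}
    (hg : ∀ x, HasDerivAt g (g' x) x) (hg'c : Continuous g') :
    Real.pi ^ 2 * ((∫ x in K, g (inner ℝ θ x) ^ 2) * volume.real K
        - (∫ x in K, g (inner ℝ θ x)) ^ 2)
      ≤ h ^ 2 * ((∫ x in K, g' (inner ℝ θ x) ^ 2) * volume.real K) := by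
  rcases K.eq_empty_or_nonempty with rfl | hne
  · simp
  have hgc : Continuous g := continuous_iff_continuousAt.2 fun x => (hg x).continuousAt
  obtain ⟨S, hSm, hSθ, hSn⟩ := exists_measurePreserving_coordinates hθ
  have hSme : Measurable S := hSm.measurable
  set Q : Set (ℝ × (Fin n → ℝ)) := S ⁻¹' K
  have hQm : MeasurableSet Q := hSme hK.measurableSet
  have hQc : Convex ℝ Q := hKc.is_linear_preimage S.toLinearMap.isLinear
  have hQv : volume Q = volume K := hSm.measure_preimage hK.measurableSet.nullMeasurableSet
  have hQfin : volume Q ≠ ⊤ := by rw [hQv]; exact hK.measure_lt_top.ne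
  -- `P t` is the volume of the section of `K` orthogonal to `θ` at height `t`. By Fubini, integrals
  -- over `K` of functions of `⟪θ, x⟫` are one-dimensional integrals with this weight.
  set P : ℝ → ENNReal := fun t => volume (Prod.mk t ⁻¹' Q)
  have hPm : Measurable P := measurable_measure_prodMk_left hQm
  obtain ⟨R, hR⟩ := hK.isBounded.exists_norm_le
  have hPfin : ∀ t, P t ≠ ⊤ := by
    intro t
    have : Prod.mk t ⁻¹' Q ⊆ Set.Icc (fun _ => -R) (fun _ => R) := by
      intro y hy
      have h1 := hR _ hy
      have h2 := hSn (t, y)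
      have h3 : ∀ i, |y i| ≤ R := by
        intro i
        have h4 : y i ^ 2 ≤ ∑ i, y i ^ 2 :=
          Finset.single_le_sum (f := fun i => y i ^ 2) (fun _ _ => sq_nonneg _) (Finset.mem_univ i)
        have h5 : ‖S (t, y)‖ ^ 2 ≤ R ^ 2 := pow_le_pow_left₀ (norm_nonneg _) h1 2
        have h6 : 0 ≤ t ^ 2 := sq_nonneg t
        exact abs_le_of_sq_le_sq (by simp only at h2; linarith) ((norm_nonneg _).trans h1)
      exact ⟨fun i => (abs_le.1 (h3 i)).1, fun i => (abs_le.1 (h3 i)).2⟩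
    exact ((measure_mono this).trans_lt (isCompact_Icc.measure_lt_top)).ne
  have hPlc : LogConcave P := by
    have h1 := hQc.logConcave_indicator.lintegral_pi (measurable_one.indicator hQm)
    convert h1 using 2 with t
    have h2 : (fun y => Q.indicator (1 : ℝ × (Fin n → ℝ) → ENNReal) (t, y))
        = (Prod.mk t ⁻¹' Q).indicator 1 := by
      ext y; rfl
    rw [h2, lintegral_indicator_one (measurable_prodMk_left hQm)]
  have hPi : ∫⁻ t, P t = volume Q := by
    rw [Measure.volume_eq_prod, Measure.prod_apply hQm]
  set p : ℝ → ℝ := fun t => (P t).toReal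
  have hpi : Integrable p := integrable_toReal_of_lintegral_ne_top hPm.aemeasurable (hPi ▸ hQfin)
  have hint : ∀ φ : ℝ → ℝ, Continuous φ →
      ∫ x in K, φ (inner ℝ θ x) = ∫ t, φ t * p t := by
    intro φ hφ
    have e1 : ∫ x in K, φ (inner ℝ θ x) = ∫ q in Q, φ q.1 := by
      have h1 : Measure.map S (volume.restrict Q) = volume.restrict K :=
        (hSm.restrict_preimage hK.measurableSet).map_eq
      rw [← h1, integral_map hSme.aemeasurable]
      · simp only [hSθ]
      · exact (hφ.comp (by fun_prop)).aestronglyMeasurable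
    have i1 : IntegrableOn (fun q : ℝ × (Fin n → ℝ) => φ q.1) Q := by
      obtain ⟨C, hC⟩ := (isCompact_Icc (a := -R) (b := R)).exists_bound_of_continuousOn
        hφ.continuousOn
      refine Measure.integrableOn_of_bounded (M := C) hQfin
        (hφ.comp continuous_fst).aestronglyMeasurable ?_
      refine (ae_restrict_iff' hQm).2 (Eventually.of_forall fun q hq => hC _ ?_)
      have h1 := abs_real_inner_le_norm θ (S q)
      rw [hSθ, hθ, one_mul] at h1
      exact abs_le.1 (h1.trans (hR _ hq))
    rw [e1, ← integral_indicator hQm, Measure.volume_eq_prod,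
      integral_prod _ ((integrable_indicator_iff hQm).2 i1)]
    congr 1; ext t
    have h2 : (fun y => Q.indicator (fun q : ℝ × (Fin n → ℝ) => φ q.1) (t, y))
        = (Prod.mk t ⁻¹' Q).indicator (fun _ => φ t) := by
      ext y; rfl
    rw [h2, integral_indicator (measurable_prodMk_left hQm), setIntegral_const, smul_eq_mul,
      mul_comm]
    rfl
  -- The weight lives on the projection of `K` to the direction `θ`, whose length is at most the
  -- diameter because `θ` is a unit vector.
  set J : Set ℝ := (fun x => inner ℝ θ x) '' K
  have hJc : IsCompact J := hK.image (by fun_prop)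
  have hJne : J.Nonempty := hne.image _
  have key := variance_logConcave_weight (A := sInf J) (B := sSup J) (p := p)
    (fun t => ENNReal.toReal_nonneg) hpi (by
      intro t ht
      have : Prod.mk t ⁻¹' Q = ∅ := by
        rw [Set.eq_empty_iff_forall_notMem]
        intro y hy
        have : t ∈ J := ⟨S (t, y), hy, hSθ _⟩
        exact ht ⟨csInf_le hJc.bddBelow this, le_csSup hJc.bddAbove this⟩
      simp [p, P, this]) (by
      intro x y s t hs ht hst
      have h1 := hPlc x y s t hs ht hst
      have h2 := ENNReal.toReal_mono (hPfin _) h1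
      rwa [ENNReal.toReal_mul, ← ENNReal.toReal_rpow, ← ENNReal.toReal_rpow] at h2) hg hg'c
  have h0 := hint (fun _ => 1) continuous_const
  simp only [one_mul, integral_const, smul_eq_mul, mul_one, measureReal_restrict_apply_univ] at h0
  rw [hint g hgc, hint (fun x => g x ^ 2) (hgc.pow 2), hint (fun x => g' x ^ 2) (hg'c.pow 2), h0]
  refine key.trans ?_
  apply mul_le_mul_of_nonneg_right
  · obtain ⟨x, hx, hx'⟩ := hJc.sInf_mem hJne
    obtain ⟨y, hy, hy'⟩ := hJc.sSup_mem hJne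
    apply pow_le_pow_left₀ (sub_nonneg.2 (Real.sInf_le_sSup J hJc.bddBelow hJc.bddAbove))
    refine le_trans ?_ hdiam
    refine le_trans ?_ (Metric.dist_le_diam_of_mem hK.isBounded hy hx)
    rw [← hx', ← hy', ← inner_sub_right, dist_eq_norm]
    have := real_inner_le_norm θ (y - x)
    rwa [hθ, one_mul] at this
  · apply mul_nonneg <;> apply integral_nonneg <;> intro t
    · exact mul_nonneg (sq_nonneg _) ENNReal.toReal_nonneg
    · exact ENNReal.toReal_nonneg

/-! ### Needle decomposition and the Payne–Weinberger inequality. -/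

/-- In orthonormal coordinates adapted to `a` the hyperplane is the product of a single point with
the full space. Hence cutting by hyperplanes loses no volume. -/
theorem volume_inner_eq_const {n : ℕ} {a : Space (n + 1)} (ha : a ≠ 0) (c : ℝ) :
    volume {x : Space (n + 1) | inner ℝ a x = c} = 0 := by
  have hn : ‖a‖ ≠ 0 := norm_ne_zero_iff.2 ha
  obtain ⟨S, hSm, hSθ, -⟩ := exists_measurePreserving_coordinates (θ := ‖a‖⁻¹ • a)
    (by rw [norm_smul, norm_inv, norm_norm, inv_mul_cancel₀ hn])
  have hm : MeasurableSet {x : Space (n + 1) | inner ℝ a x = c} :=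
    (isClosed_eq (by fun_prop) continuous_const).measurableSet
  rw [← hSm.measure_preimage hm.nullMeasurableSet]
  have : S ⁻¹' {x : Space (n + 1) | inner ℝ a x = c} = {‖a‖⁻¹ * c} ×ˢ Set.univ := by
    ext p
    have h := hSθ p
    rw [real_inner_smul_left] at h
    simp only [Set.mem_preimage, Set.mem_ofPred_eq, Set.mem_prod, Set.mem_singleton_iff,
      Set.mem_univ, and_true]
    rw [← h]
    constructor
    · intro h'; rw [h']
    · intro h'; exact mul_left_cancel₀ (inv_ne_zero hn) h'
  rw [this, Measure.volume_eq_prod, Measure.prod_prod]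
  simp

theorem setIntegral_halfSpace_add {n : ℕ} {a : Space (n + 1)} (ha : a ≠ 0) (c : ℝ)
    {K : Set (Space (n + 1))} (hK : IsCompact K) {v : Space (n + 1) → ℝ} (hv : Continuous v) :
    (∫ x in K ∩ {x | c ≤ inner ℝ a x}, v x) + (∫ x in K ∩ {x | inner ℝ a x ≤ c}, v x)
      = ∫ x in K, v x := by
  have m2 : MeasurableSet {x : Space (n + 1) | inner ℝ a x ≤ c} :=
    (isClosed_le (by fun_prop) continuous_const).measurableSet
  have hi := hv.continuousOn.integrableOn_compact (μ := volume) hK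
  rw [← setIntegral_union₀]
  · congr 2
    rw [← Set.inter_union_distrib_left, Set.inter_eq_left]
    intro x _
    exact le_total c _
  · refine measure_mono_null ?_ (volume_inner_eq_const ha c)
    rintro x ⟨⟨-, h1⟩, ⟨-, h2⟩⟩
    exact le_antisymm h2 h1
  · exact (hK.measurableSet.inter m2).nullMeasurableSet
  · exact hi.mono_set Set.inter_subset_left
  · exact hi.mono_set Set.inter_subset_left

/-- A convex body can be bisected by a hyperplane through a prescribed coordinate flat of
codimension two, keeping `∫ v = 0` and `∫ F < 0` in one of the pieces. -/
theorem exists_bisection {n : ℕ} {K : Set (Space (n + 1))} (hK : IsCompact K) (hKc : Convex ℝ K)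
    {v F : Space (n + 1) → ℝ} (hv : Continuous v) (hF : Continuous F)
    (hv0 : ∫ x in K, v x = 0) (hF0 : ∫ x in K, F x < 0) {i j : Fin (n + 1)} (hij : i ≠ j)
    (p q : ℝ) :
    ∃ K' ⊆ K, IsCompact K' ∧ Convex ℝ K' ∧ ∫ x in K', v x = 0 ∧ ∫ x in K', F x < 0 ∧
      ∃ c s : ℝ, (c ≠ 0 ∨ s ≠ 0) ∧ ∀ x ∈ K', 0 ≤ c * (x i - p) + s * (x j - q) := by
  -- The half-spaces bounded by hyperplanes through the flat `x i = p`, `x j = q`, parametrised by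
  -- the angle `α` of their inner normal.
  set a : ℝ → Space (n + 1) := fun α =>
    EuclideanSpace.single i (Real.cos α) + EuclideanSpace.single j (Real.sin α)
  set b : ℝ → ℝ := fun α => Real.cos α * p + Real.sin α * q
  have hax : ∀ α x, inner ℝ (a α) x = Real.cos α * x i + Real.sin α * x j := by
    intro α x
    simp [a, inner_add_left, EuclideanSpace.inner_single_left]
  have ha0 : ∀ α, a α ≠ 0 := by
    intro α h
    have h1 : a α i = 0 := by rw [h]; rfl
    have h2 : a α j = 0 := by rw [h]; rfl
    simp [a, hij, hij.symm] at h1 h2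
    have := Real.sin_sq_add_cos_sq α
    rw [h1, h2] at this
    norm_num at this
  have hmeas : ∀ α, MeasurableSet {x : Space (n + 1) | b α ≤ inner ℝ (a α) x} := fun α =>
    (isClosed_le continuous_const (by fun_prop)).measurableSet
  set f : ℝ → ℝ := fun α => ∫ x in K, {x | b α ≤ inner ℝ (a α) x}.indicator v x
  have hfe : ∀ α, f α = ∫ x in K ∩ {x | b α ≤ inner ℝ (a α) x}, v x := fun α => by
    simp only [f]
    rw [setIntegral_indicator (hmeas α)]
  have hi := hv.continuousOn.integrableOn_compact (μ := volume) hK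
  have hfc : Continuous f := by
    rw [continuous_iff_continuousAt]
    intro α
    apply continuousAt_of_dominated (bound := fun x => |v x|)
    · exact Eventually.of_forall fun β => hv.aestronglyMeasurable.indicator (hmeas β)
    · exact Eventually.of_forall fun β => Eventually.of_forall fun x => norm_indicator_le_norm_self _ _
    · exact hi.abs
    -- Away from the bounding hyperplane at angle `α`, a null set, membership in the half-space is
    -- locally constant in the angle.
    · have hnull := volume_inner_eq_const (ha0 α) (b α)
      filter_upwards [ae_restrict_of_ae (measure_eq_zero_iff_ae_notMem.1 hnull)] with x hx
      have hc1 : Continuous fun β => inner ℝ (a β) x := by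
        simp only [hax]; fun_prop
      have hc2 : Continuous b := by fun_prop
      rcases lt_or_gt_of_ne hx with h | h
      · have h1 : ∀ᶠ β in 𝓝 α, inner ℝ (a β) x < b β := hc1.continuousAt.eventually_lt hc2.continuousAt h
        have h2 : (fun β => {x | b β ≤ inner ℝ (a β) x}.indicator v x) =ᶠ[𝓝 α] fun _ => 0 := by
          filter_upwards [h1] with β hβ
          exact Set.indicator_of_notMem (by simpa using hβ) _
        exact continuousAt_const.congr h2.symm
      · have h1 : ∀ᶠ β in 𝓝 α, b β < inner ℝ (a β) x := hc2.continuousAt.eventually_lt hc1.continuousAt h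
        have h2 : (fun β => {x | b β ≤ inner ℝ (a β) x}.indicator v x) =ᶠ[𝓝 α] fun _ => v x := by
          filter_upwards [h1] with β hβ
          exact Set.indicator_of_mem (by simpa using hβ.le) _
        exact continuousAt_const.congr h2.symm
  have hpi : ∀ α, {x : Space (n + 1) | b (α + Real.pi) ≤ inner ℝ (a (α + Real.pi)) x}
      = {x | inner ℝ (a α) x ≤ b α} := by
    intro α
    ext x
    simp only [Set.mem_ofPred_eq, hax, b, Real.cos_add_pi, Real.sin_add_pi]
    constructor <;> intro h <;> linarith
  -- A rotation by `π` exchanges the two halves, so `f` changes sign and has a zero. At a zero both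
  -- halves have `∫ v = 0`, and at least one of them has `∫ F < 0`.
  have hsum : ∀ α, f α + f (α + Real.pi) = 0 := by
    intro α
    rw [hfe, hfe, hpi, setIntegral_halfSpace_add (ha0 α) _ hK hv, hv0]
  obtain ⟨α, hα⟩ : ∃ α, f α = 0 := by
    have h0 := hsum 0
    rcases le_total (f 0) 0 with h | h
    · exact mem_range_of_exists_le_of_exists_ge hfc ⟨0, h⟩ ⟨0 + Real.pi, by linarith⟩
    · exact mem_range_of_exists_le_of_exists_ge hfc ⟨0 + Real.pi, by linarith⟩ ⟨0, h⟩
  have key : ∀ β, f β = 0 → ∫ x in K ∩ {x | b β ≤ inner ℝ (a β) x}, F x < 0 →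
      ∃ K' ⊆ K, IsCompact K' ∧ Convex ℝ K' ∧ ∫ x in K', v x = 0 ∧ ∫ x in K', F x < 0 ∧
      ∃ c s : ℝ, (c ≠ 0 ∨ s ≠ 0) ∧ ∀ x ∈ K', 0 ≤ c * (x i - p) + s * (x j - q) := by
    intro β h1 h2
    refine ⟨K ∩ {x | b β ≤ inner ℝ (a β) x}, Set.inter_subset_left, hK.inter_right
      (isClosed_le continuous_const (by fun_prop)), hKc.inter ?_, by rw [← hfe, h1], h2,
      Real.cos β, Real.sin β, ?_, fun x hx => ?_⟩
    · exact convex_halfSpace_ge (innerₗ _ (a β)).isLinear _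
    · by_contra h
      push Not at h
      have := Real.sin_sq_add_cos_sq β
      rw [h.1, h.2] at this
      norm_num at this
    · have := hx.2
      simp only [Set.mem_ofPred_eq, hax, b] at this
      linarith
  have hFsum := setIntegral_halfSpace_add (ha0 α) (b α) hK hF
  rcases lt_or_ge (∫ x in K ∩ {x | b α ≤ inner ℝ (a α) x}, F x) 0 with h | h
  · exact key α hα h
  · refine key (α + Real.pi) (by linarith [hsum α]) ?_
    rw [hpi]
    linarith

/-- Repeated bisection: a decreasing sequence of convex bodies with `∫ v = 0` and `∫ F < 0`, whose
intersection lies on a line. -/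
theorem exists_needle_sequence {n : ℕ} {K : Set (Space (n + 1))} (hK : IsCompact K)
    (hKc : Convex ℝ K) {v F : Space (n + 1) → ℝ} (hv : Continuous v) (hF : Continuous F)
    (hv0 : ∫ x in K, v x = 0) (hF0 : ∫ x in K, F x < 0) :
    ∃ A : ℕ → Set (Space (n + 1)), (∀ k, A k ⊆ K) ∧ Antitone A ∧ (∀ k, IsCompact (A k)) ∧
      (∀ k, Convex ℝ (A k)) ∧ (∀ k, ∫ x in A k, v x = 0) ∧ (∀ k, ∫ x in A k, F x < 0) ∧
      ∃ x₀ θ : Space (n + 1), ‖θ‖ = 1 ∧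
        ∀ x ∈ ⋂ k, A k, x₀ + (inner ℝ θ x - inner ℝ θ x₀) • θ = x := by
  let T := {L : Set (Space (n + 1)) // L ⊆ K ∧ IsCompact L ∧ Convex ℝ L ∧ ∫ x in L, v x = 0 ∧
    ∫ x in L, F x < 0}
  -- An enumeration of all pairs of axes and all rational points of the corresponding coordinate
  -- planes; stage `k` performs the cut numbered `k`.
  obtain ⟨e, he⟩ := exists_surjective_nat (Fin (n + 1) × Fin (n + 1) × ℚ × ℚ)
  have step : ∀ (L : T) (r : Fin (n + 1) × Fin (n + 1) × ℚ × ℚ), ∃ L' : T, L'.1 ⊆ L.1 ∧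
      (r.1 ≠ r.2.1 → ∃ c s : ℝ, (c ≠ 0 ∨ s ≠ 0) ∧ ∀ x ∈ L'.1,
        0 ≤ c * (x r.1 - r.2.2.1) + s * (x r.2.1 - r.2.2.2)) := by
    rintro ⟨L, hLK, hLc, hLcv, hLv, hLF⟩ ⟨i, j, p, q⟩
    by_cases hij : i = j
    · exact ⟨⟨L, hLK, hLc, hLcv, hLv, hLF⟩, subset_rfl, fun h => absurd hij h⟩
    · obtain ⟨L', h1, h2, h3, h4, h5, h6⟩ := exists_bisection hLc hLcv hv hF hLv hLF hij (p : ℝ) q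
      exact ⟨⟨L', h1.trans hLK, h2, h3, h4, h5⟩, h1, fun _ => h6⟩
  choose next hnext1 hnext2 using step
  let A : ℕ → T := fun k => Nat.rec ⟨K, subset_rfl, hK, hKc, hv0, hF0⟩ (fun k L => next L (e k)) k
  have hA : ∀ k, A (k + 1) = next (A k) (e k) := fun k => rfl
  have hanti : Antitone fun k => (A k).1 := antitone_nat_of_succ_le fun k => hnext1 _ _
  refine ⟨fun k => (A k).1, fun k => (A k).2.1, hanti, fun k => (A k).2.2.1, fun k => (A k).2.2.2.1,
    fun k => (A k).2.2.2.2.1, fun k => (A k).2.2.2.2.2, ?_⟩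
  have hne : ∀ k, (A k).1.Nonempty := fun k => by
    rw [Set.nonempty_iff_ne_empty]
    intro h
    have := (A k).2.2.2.2.2
    rw [h] at this
    simp at this
  obtain ⟨x₀, hx₀⟩ := IsCompact.nonempty_iInter_of_sequence_nonempty_isCompact_isClosed
    (fun k => (A k).1) (fun k => hanti (Nat.le_succ k)) hne (A 0).2.2.1
    (fun k => (A k).2.2.1.isClosed)
  -- If three limit points had a non-degenerate projection to the plane of axes `i`, `j`, a rational
  -- point `(p, q)` would lie strictly inside the projected triangle. After the cut through it all
  -- three vertices lie on one closed side of a line through an interior point, so all lie on that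
  -- line, a contradiction. `σ`, `τ` are barycentric coordinates.
  have hcol : ∀ x ∈ ⋂ k, (A k).1, ∀ y ∈ ⋂ k, (A k).1, ∀ z ∈ ⋂ k, (A k).1, ∀ i j,
      (y i - x i) * (z j - x j) = (z i - x i) * (y j - x j) := by
    intro x hx y hy z hz i j
    rcases eq_or_ne i j with rfl | hij
    · ring
    by_contra hne
    set D := (y i - x i) * (z j - x j) - (z i - x i) * (y j - x j)
    have hD : D ≠ 0 := sub_ne_zero.2 hne
    let σ : ℝ × ℝ → ℝ := fun P => ((P.1 - x i) * (z j - x j) - (P.2 - x j) * (z i - x i)) / D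
    let τ : ℝ × ℝ → ℝ := fun P => ((y i - x i) * (P.2 - x j) - (y j - x j) * (P.1 - x i)) / D
    have hσ : Continuous σ := by fun_prop
    have hτ : Continuous τ := by fun_prop
    have hopen : IsOpen {P | 0 < σ P ∧ 0 < τ P ∧ σ P + τ P < 1} :=
      (isOpen_lt continuous_const hσ).inter
        ((isOpen_lt continuous_const hτ).inter (isOpen_lt (hσ.add hτ) continuous_const))
    have hnon : ({P | 0 < σ P ∧ 0 < τ P ∧ σ P + τ P < 1} : Set (ℝ × ℝ)).Nonempty := by
      refine ⟨((x i + y i + z i) / 3, (x j + y j + z j) / 3), ?_⟩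
      have h1 : σ ((x i + y i + z i) / 3, (x j + y j + z j) / 3) = 1 / 3 := by
        simp only [σ]; rw [div_eq_iff hD]; simp only [D]; ring
      have h2 : τ ((x i + y i + z i) / 3, (x j + y j + z j) / 3) = 1 / 3 := by
        simp only [τ]; rw [div_eq_iff hD]; simp only [D]; ring
      simp only [Set.mem_ofPred_eq, h1, h2]
      norm_num
    have hdense : DenseRange (Prod.map ((↑) : ℚ → ℝ) ((↑) : ℚ → ℝ)) :=
      Rat.denseRange_cast.prodMap Rat.denseRange_cast
    obtain ⟨⟨p, q⟩, hpq1, hpq2, hpq3⟩ := hdense.exists_mem_open hopen hnon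
    obtain ⟨k, hk⟩ := he (i, j, p, q)
    have hcut := hnext2 (A k) (e k)
    rw [hk] at hcut
    obtain ⟨c, s, hcs, hc⟩ := hcut hij
    have hAk := hA k
    rw [hk] at hAk
    rw [← hAk] at hc
    have hcx := hc x (Set.mem_iInter.1 hx (k + 1))
    have hcy := hc y (Set.mem_iInter.1 hy (k + 1))
    have hcz := hc z (Set.mem_iInter.1 hz (k + 1))
    simp only [Prod.map] at hpq1 hpq2 hpq3 hcx hcy hcz
    set S := σ ((p : ℝ), (q : ℝ))
    set R := τ ((p : ℝ), (q : ℝ))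
    have e1 : (p : ℝ) = x i + S * (y i - x i) + R * (z i - x i) := by
      simp only [S, R, σ, τ]; field_simp; simp only [D]; ring
    have e2 : (q : ℝ) = x j + S * (y j - x j) + R * (z j - x j) := by
      simp only [S, R, σ, τ]; field_simp; simp only [D]; ring
    have e3 : (1 - S - R) * (c * (x i - p) + s * (x j - q)) + S * (c * (y i - p) + s * (y j - q))
        + R * (c * (z i - p) + s * (z j - q)) = 0 := by
      linear_combination (-c) * e1 - s * e2
    have n1 := mul_nonneg (show 0 ≤ 1 - S - R by linarith) hcx
    have n2 := mul_nonneg hpq1.le hcy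
    have n3 := mul_nonneg hpq2.le hcz
    have z1 : c * (x i - p) + s * (x j - q) = 0 := by
      have h0 : (1 - S - R) * (c * (x i - p) + s * (x j - q)) = 0 := by linarith
      exact (mul_eq_zero.1 h0).resolve_left (by linarith)
    have z2 : c * (y i - p) + s * (y j - q) = 0 := by
      have h0 : S * (c * (y i - p) + s * (y j - q)) = 0 := by linarith
      exact (mul_eq_zero.1 h0).resolve_left hpq1.ne'
    have z3 : c * (z i - p) + s * (z j - q) = 0 := by
      have h0 : R * (c * (z i - p) + s * (z j - q)) = 0 := by linarith
      exact (mul_eq_zero.1 h0).resolve_left hpq2.ne'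
    have w1 : c * D = 0 := by
      simp only [D]
      linear_combination (z2 - z1) * (z j - x j) - (z3 - z1) * (y j - x j)
    have w2 : s * D = 0 := by
      simp only [D]
      linear_combination (z3 - z1) * (y i - x i) - (z2 - z1) * (z i - x i)
    rcases hcs with h | h
    · exact (mul_ne_zero h hD) w1
    · exact (mul_ne_zero h hD) w2
  -- When the limit set is a single point, any unit vector serves as direction.
  by_cases hall : ∀ x ∈ ⋂ k, (A k).1, x = x₀
  · refine ⟨x₀, EuclideanSpace.single 0 1, by simp, fun x hx => ?_⟩
    rw [hall x hx]; simp
  · push Not at hall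
    obtain ⟨y, hy, hyx⟩ := hall
    have hd : y - x₀ ≠ 0 := sub_ne_zero.2 hyx
    have hdn : ‖y - x₀‖ ≠ 0 := norm_ne_zero_iff.2 hd
    refine ⟨x₀, ‖y - x₀‖⁻¹ • (y - x₀), by rw [norm_smul, norm_inv, norm_norm, inv_mul_cancel₀ hdn],
      fun x hx => ?_⟩
    obtain ⟨i, hi⟩ : ∃ i, (y - x₀) i ≠ 0 := by
      by_contra h
      push Not at h
      exact hd (by ext i; simpa using h i)
    have hx' : x - x₀ = ((x - x₀) i / (y - x₀) i) • (y - x₀) := by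
      ext j
      have := hcol x₀ hx₀ y hy x hx i j
      simp only [PiLp.sub_apply, PiLp.smul_apply, smul_eq_mul] at hi ⊢
      field_simp
      linarith
    set r := (x - x₀) i / (y - x₀) i
    rw [← inner_sub_right, hx', real_inner_smul_right, real_inner_smul_left,
      real_inner_self_eq_norm_sq, smul_smul]
    have : r * (‖y - x₀‖⁻¹ * ‖y - x₀‖ ^ 2) * ‖y - x₀‖⁻¹ = r := by field_simp
    rw [this, ← hx']
    abel

theorem ContDiff.continuous_gradient {E : Type*} [NormedAddCommGroup E] [InnerProductSpace ℝ E]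
    [CompleteSpace E] {v : E → ℝ} (hv : ContDiff ℝ 1 v) : Continuous (gradient v) :=
  (InnerProductSpace.toDual ℝ E).symm.continuous.comp (hv.continuous_fderiv one_ne_zero)

set_option maxHeartbeats 400000 in
/-- The **Payne–Weinberger inequality** on a convex body of diameter at most `h`. -/
theorem Convex.payne_weinberger {n : ℕ} {K : Set (Space (n + 1))} (hK : IsCompact K)
    (hKc : Convex ℝ K) {h : ℝ} (hdiam : Metric.diam K ≤ h) {v : Space (n + 1) → ℝ}
    (hv : ContDiff ℝ 1 v) (hv0 : ∫ x in K, v x = 0) :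
    Real.pi ^ 2 * ∫ x in K, v x ^ 2 ≤ h ^ 2 * ∫ x in K, ‖gradient v x‖ ^ 2 := by
  have hvc : Continuous v := hv.continuous
  have hdc : Continuous (gradient v) := hv.continuous_gradient
  have hint : ∀ {f : Space (n + 1) → ℝ} {L : Set (Space (n + 1))}, Continuous f → IsCompact L →
      IntegrableOn f L := fun hf hL => hf.continuousOn.integrableOn_compact hL
  by_contra hcon
  push Not at hcon
  -- a uniform gap
  obtain ⟨ε, hε, hgap⟩ : ∃ ε > 0, h ^ 2 * (∫ x in K, ‖gradient v x‖ ^ 2)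
      - Real.pi ^ 2 * (∫ x in K, v x ^ 2) + ε * volume.real K < 0 := by
    have hpos : 0 < Real.pi ^ 2 * (∫ x in K, v x ^ 2)
      - h ^ 2 * (∫ x in K, ‖gradient v x‖ ^ 2) := sub_pos.2 hcon
    refine ⟨(Real.pi ^ 2 * (∫ x in K, v x ^ 2)
      - h ^ 2 * (∫ x in K, ‖gradient v x‖ ^ 2)) / (volume.real K + 1) , by positivity, ?_⟩
    have h1 : 0 ≤ volume.real K := measureReal_nonneg
    rw [div_mul_eq_mul_div, ← sub_pos]
    have : (Real.pi ^ 2 * (∫ x in K, v x ^ 2) - h ^ 2 * (∫ x in K, ‖gradient v x‖ ^ 2))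
        * volume.real K / (volume.real K + 1) < Real.pi ^ 2 * (∫ x in K, v x ^ 2)
      - h ^ 2 * (∫ x in K, ‖gradient v x‖ ^ 2) := by
      rw [div_lt_iff₀ (by positivity)]
      nlinarith
    linarith
  -- The bisections preserve `∫ v = 0` and `∫ F < 0`. The summand `ε` leaves, on each needle, a
  -- margin proportional to its volume, to be spent on replacing `v` by a ridge function.
  set F : Space (n + 1) → ℝ := fun x =>
    h ^ 2 * ‖gradient v x‖ ^ 2 - Real.pi ^ 2 * v x ^ 2 + ε
  have hFc : Continuous F := by fun_prop
  have hFint : ∀ L : Set (Space (n + 1)), IsCompact L → ∫ x in L, F x =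
      h ^ 2 * (∫ x in L, ‖gradient v x‖ ^ 2) - Real.pi ^ 2 * (∫ x in L, v x ^ 2)
        + ε * volume.real L := by
    intro L hL
    have i1 : IntegrableOn (fun x => h ^ 2 * ‖gradient v x‖ ^ 2) L := hint (by fun_prop) hL
    have i2 : IntegrableOn (fun x => Real.pi ^ 2 * v x ^ 2) L := hint (by fun_prop) hL
    have i3 : IntegrableOn (fun _ => ε) L := hint continuous_const hL
    have i4 : IntegrableOn (fun x => h ^ 2 * ‖gradient v x‖ ^ 2 - Real.pi ^ 2 * v x ^ 2) L :=
      i1.sub i2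
    simp only [F]
    rw [integral_add i4 i3, integral_sub i1 i2, integral_const_mul, integral_const_mul]
    simp [mul_comm]
  obtain ⟨A, hAK, hAanti, hAc, hAcv, hAv, hAF, x₀, θ, hθ, hline⟩ :=
    exists_needle_sequence hK hKc hvc hFc hv0 (by rw [hFint K hK]; exact hgap)
  obtain ⟨C₁, hC₁⟩ := hK.exists_bound_of_continuousOn hvc.continuousOn
  obtain ⟨C₂, hC₂⟩ := hK.exists_bound_of_continuousOn hdc.continuousOn
  set C := max (max C₁ C₂) 0
  have hC0 : 0 ≤ C := le_max_right _ _
  have hCv : ∀ x ∈ K, |v x| ≤ C := fun x hx =>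
    (hC₁ x hx).trans ((le_max_left _ _).trans (le_max_left _ _))
  have hCd : ∀ x ∈ K, ‖gradient v x‖ ≤ C := fun x hx =>
    (hC₂ x hx).trans ((le_max_right _ _).trans (le_max_left _ _))
  -- the tolerance
  set N := Real.pi ^ 2 * (2 * C + 2) + h ^ 2 * (2 * C + 1) + 1
  have hN : 0 < N := by positivity
  set η := min 1 (ε / N)
  have hη0 : 0 < η := lt_min one_pos (div_pos hε hN)
  have hη1 : η ≤ 1 := min_le_left _ _
  have hηε : η * N ≤ ε := by
    have := min_le_right 1 (ε / N)
    exact (le_div_iff₀ hN).1 this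
  -- the ridge function
  set P : Space (n + 1) → Space (n + 1) := fun x => x₀ + (inner ℝ θ x - inner ℝ θ x₀) • θ
  have hPc : Continuous P := by fun_prop
  set g : ℝ → ℝ := fun t => v (x₀ + (t - inner ℝ θ x₀) • θ)
  set g' : ℝ → ℝ := fun t => inner ℝ (gradient v (x₀ + (t - inner ℝ θ x₀) • θ)) θ
  have hg : ∀ t, HasDerivAt g (g' t) t := by
    intro t
    have h1 : HasDerivAt (fun t : ℝ => x₀ + (t - inner ℝ θ x₀) • θ) θ t := by
      have := (((hasDerivAt_id t).sub_const (inner ℝ θ x₀)).smul_const θ).const_add x₀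
      simpa using this
    have h2 := (hv.differentiable one_ne_zero (x₀ + (t - inner ℝ θ x₀) • θ)).hasFDerivAt
    have h3 := h2.comp_hasDerivAt t h1
    simp only [g', inner_gradient_left]
    exact h3
  have hg'c : Continuous g' := by
    have : Continuous fun t : ℝ => x₀ + (t - inner ℝ θ x₀) • θ := by fun_prop
    exact (hdc.comp this).inner continuous_const
  have hgc : Continuous g := continuous_iff_continuousAt.2 fun x => (hg x).continuousAt
  set D : Space (n + 1) → ℝ := fun x => inner ℝ (gradient v x) θ
  have hDc : Continuous D := by fun_prop
  -- `P` is the identity on the limit segment, so by compactness some needle lies in the open set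
  -- where `v` and its derivative along `θ` differ from their values at `P x` by less than `η`.
  obtain ⟨k, hk⟩ : ∃ k, A k ⊆ {x | |v x - v (P x)| < η ∧ |D x - D (P x)| < η} := by
    apply exists_subset_nhds_of_isCompact hAanti.directed_ge hAc
    intro x hx
    have hPx : P x = x := hline x hx
    apply IsOpen.mem_nhds
    · exact (isOpen_lt (hvc.sub (hvc.comp hPc)).abs continuous_const).inter
        (isOpen_lt (hDc.sub (hDc.comp hPc)).abs continuous_const)
    · simp [hPx, hη0]
  set L := A k
  have hL : IsCompact L := hAc k
  have hLK : L ⊆ K := hAK k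
  set m := volume.real L
  have hm : 0 < m := by
    rcases (measureReal_nonneg : 0 ≤ volume.real L).eq_or_lt with h0 | h0
    · exfalso
      have h1 : volume L = 0 := by
        rw [← measureReal_eq_zero_iff hL.measure_lt_top.ne]; exact h0.symm
      have h2 := hAF k
      rw [Measure.restrict_eq_zero.2 h1] at h2
      simp at h2
    · exact h0
  have hmono : ∀ {f₁ f₂ : Space (n + 1) → ℝ}, Continuous f₁ → Continuous f₂ →
      (∀ x ∈ L, f₁ x ≤ f₂ x) → ∫ x in L, f₁ x ≤ ∫ x in L, f₂ x := fun h1 h2 h3 =>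
    setIntegral_mono_on (hint h1 hL) (hint h2 hL) hL.measurableSet h3
  have hridge := (hAcv k).variance_ridge_le hθ hL
    ((Metric.diam_mono hLK hK.isBounded).trans hdiam) hg hg'c
  have hgP : ∀ x, g (inner ℝ θ x) = v (P x) := fun x => rfl
  have hg'P : ∀ x, g' (inner ℝ θ x) = D (P x) := fun x => rfl
  simp only [hgP, hg'P] at hridge
  set c₀ := η * (2 * C + η)
  have iconst : ∀ (f : Space (n + 1) → ℝ) (c : ℝ), Continuous f →
      ∫ x in L, (f x + c) = (∫ x in L, f x) + c * m := by
    intro f c hf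
    rw [integral_add (hint hf hL) (hint continuous_const hL)]
    simp [m, mul_comm]
  have hvP : Continuous fun x => v (P x) := hvc.comp hPc
  have hDP : Continuous fun x => D (P x) := hDc.comp hPc
  have e1 : ∫ x in L, v x ^ 2 ≤ (∫ x in L, v (P x) ^ 2) + c₀ * m := by
    rw [← iconst _ _ (by fun_prop)]
    refine hmono (by fun_prop) (by fun_prop) fun x hx => ?_
    have h1 := abs_le.1 (hk hx).1.le
    have h2 := abs_le.1 (hCv x (hLK hx))
    simp only [c₀]
    nlinarith
  have e2 : ∫ x in L, D (P x) ^ 2 ≤ (∫ x in L, ‖gradient v x‖ ^ 2) + c₀ * m := by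
    rw [← iconst _ _ (by fun_prop)]
    refine hmono (by fun_prop) (by fun_prop) fun x hx => ?_
    have h1 := abs_le.1 (hk hx).2.le
    have h3 : |D x| ≤ ‖gradient v x‖ := by
      have := abs_real_inner_le_norm (gradient v x) θ
      rwa [hθ, mul_one] at this
    have h2 := abs_le.1 (h3.trans (hCd x (hLK hx)))
    have h4 : D x ^ 2 ≤ ‖gradient v x‖ ^ 2 := by
      rw [← sq_abs]; exact pow_le_pow_left₀ (abs_nonneg _) h3 2
    simp only [c₀]
    nlinarith
  have e3 : |∫ x in L, v (P x)| ≤ η * m := by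
    have hz : ∫ x in L, v x = 0 := hAv k
    rw [abs_le]
    constructor
    · have h1 : ∫ x in L, v x ≤ (∫ x in L, v (P x)) + η * m := by
        rw [← iconst _ _ hvP]
        refine hmono hvc (by fun_prop) fun x hx => ?_
        linarith [(abs_le.1 (hk hx).1.le).2]
      linarith
    · have h1 : ∫ x in L, v (P x) ≤ (∫ x in L, v x) + η * m := by
        rw [← iconst _ _ hvc]
        refine hmono hvP (by fun_prop) fun x hx => ?_
        linarith [(abs_le.1 (hk hx).1.le).1]
      linarith
  have e4 : (∫ x in L, v (P x)) ^ 2 ≤ (η * m) ^ 2 := sq_le_sq' (abs_le.1 e3).1 (abs_le.1 e3).2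
  have hF := hAF k
  rw [hFint _ hL] at hF
  set X := ∫ x in L, v x ^ 2
  set X' := ∫ x in L, v (P x) ^ 2
  set Y := ∫ x in L, ‖gradient v x‖ ^ 2
  set Y' := ∫ x in L, D (P x) ^ 2
  have hpi : 0 < Real.pi ^ 2 := by positivity
  have f1 : Real.pi ^ 2 * (X' - η ^ 2 * m) ≤ h ^ 2 * Y' := by
    have : Real.pi ^ 2 * (X' - η ^ 2 * m) * m ≤ h ^ 2 * Y' * m := by nlinarith
    exact le_of_mul_le_mul_right this hm
  have f2 := mul_le_mul_of_nonneg_left e1 hpi.le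
  have f3 := mul_le_mul_of_nonneg_left e2 (sq_nonneg h)
  -- Per unit of volume, passing from `v` to `v ∘ P` costs `c₀` in each quadratic integral and `η²`
  -- through the mean, which is no longer exactly zero. The choice of `η` makes the total at most
  -- `ε`.
  have f4 : Real.pi ^ 2 * (c₀ + η ^ 2) + h ^ 2 * c₀ ≤ ε := by
    refine le_trans ?_ hηε
    have g1 : c₀ ≤ η * (2 * C + 1) := by
      simp only [c₀]; gcongr
    have g2 : c₀ + η ^ 2 ≤ η * (2 * C + 2) := by nlinarith
    have g3 := mul_le_mul_of_nonneg_left g2 hpi.le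
    have g4 := mul_le_mul_of_nonneg_left g1 (sq_nonneg h)
    simp only [N]
    nlinarith
  have f5 := mul_le_mul_of_nonneg_right f4 hm.le
  nlinarith

/-! ### Gauss' formula on a cone. -/

/-- Integration over a piece of a hyperplane in coordinates. -/
theorem setIntegral_hausdorff_eq {n : ℕ} {a : Space (n + 1)} {δ : ℝ}
    (S : (ℝ × (Fin n → ℝ)) ≃ₗ[ℝ] Space (n + 1))
    (hSn : ∀ p, ‖S p‖ ^ 2 = p.1 ^ 2 + ∑ i, p.2 i ^ 2) {s : Set (Space (n + 1))}
    (hs : MeasurableSet s) (hsS : ∀ y ∈ s, (S.symm (y - a)).1 = δ)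
    (φ : Space (n + 1) → ℝ) :
    ∫ y in s, φ y ∂(μHE[n]) = ∫ z in {z | a + S (δ, z) ∈ s}, φ (a + S (δ, z)) := by
  -- With the first coordinate frozen at `δ`, this chart of the hyperplane is an isometry, so the
  -- surface measure is the image of Lebesgue measure.
  set ψ : EuclideanSpace ℝ (Fin n) → Space (n + 1) := fun z => a + S (δ, WithLp.ofLp z)
  have hψ : Isometry ψ := by
    refine Isometry.of_dist_eq fun z z' => ?_
    simp only [ψ, dist_add_left]
    rw [dist_eq_norm, dist_eq_norm, ← map_sub, ← sq_eq_sq₀ (norm_nonneg _) (norm_nonneg _), hSn,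
      EuclideanSpace.norm_sq_eq]
    simp
  have hemb : MeasurableEmbedding ψ := hψ.isClosedEmbedding.measurableEmbedding
  have hrange : s ⊆ Set.range ψ := by
    intro y hy
    refine ⟨WithLp.toLp 2 (S.symm (y - a)).2, ?_⟩
    simp only [ψ]
    rw [← hsS y hy]
    change a + S (S.symm (y - a)) = y
    rw [S.apply_symm_apply, add_sub_cancel]
  have h1 : (μHE[n] : Measure (Space (n + 1))).restrict s
      = Measure.map ψ ((volume : Measure (EuclideanSpace ℝ (Fin n))).restrict (ψ ⁻¹' s)) := by
    rw [← hemb.restrict_map, ← EuclideanSpace.euclideanHausdorffMeasure_eq_volume,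
      hψ.map_euclideanHausdorffMeasure, Measure.restrict_restrict hs, Set.inter_eq_left.2 hrange]
  rw [h1, hemb.integral_map]
  have h2 := (PiLp.volume_preserving_toLp (Fin n)).setIntegral_preimage_emb
    (MeasurableEquiv.toLp 2 (Fin n → ℝ)).measurableEmbedding
    (fun z => φ (ψ z)) (ψ ⁻¹' s)
  rw [← h2]
  rfl

/-- Gauss' formula on the cone with apex `a` over a piece `s` of the hyperplane
`⟪w, x - a⟫ = 1`, for the vector field `φ x • (x - a)`. -/
theorem setIntegral_cone_eq {n : ℕ} {a w : Space (n + 1)} (hw : w ≠ 0) {s : Set (Space (n + 1))}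
    (hs : IsCompact s) (hsw : ∀ y ∈ s, inner ℝ w (y - a) = 1) {φ : Space (n + 1) → ℝ}
    (hφ : ContDiff ℝ 1 φ) :
    ∫ x in (fun q : ℝ × Space (n + 1) => a + q.1 • (q.2 - a)) '' (Set.Icc 0 1 ×ˢ s),
        ((n + 1) * φ x + inner ℝ (gradient φ x) (x - a))
      = ‖w‖⁻¹ * ∫ y in s, φ y ∂(μHE[n]) := by
  have hwn : 0 < ‖w‖ := norm_pos_iff.2 hw
  set δ := ‖w‖⁻¹
  have hδ : 0 < δ := inv_pos.2 hwn
  obtain ⟨S, hSm, hSθ, hSn⟩ := exists_measurePreserving_coordinates (θ := δ • w)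
    (by rw [norm_smul, norm_inv, norm_norm, inv_mul_cancel₀ hwn.ne'])
  have hSw : ∀ p, inner ℝ w (S p) = ‖w‖ * p.1 := fun p => by
    rw [← hSθ p, real_inner_smul_left, ← mul_assoc, mul_inv_cancel₀ hwn.ne', one_mul]
  have hSc : Continuous S := S.toLinearMap.continuous_of_finiteDimensional
  set C := (fun q : ℝ × Space (n + 1) => a + q.1 • (q.2 - a)) '' (Set.Icc 0 1 ×ˢ s)
  have hC : IsCompact C := (isCompact_Icc.prod hs).image (by fun_prop)
  set F : Space (n + 1) → ℝ := fun x => (n + 1) * φ x + inner ℝ (gradient φ x) (x - a)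
  have hφc := hφ.continuous
  have hgc := hφ.continuous_gradient
  have hF : Continuous F := by fun_prop
  set B : Set (Fin n → ℝ) := {z | a + S (δ, z) ∈ s}
  have hBcl : IsClosed B := hs.isClosed.preimage (by fun_prop)
  have hB : IsCompact B := by
    refine Metric.isCompact_of_isClosed_isBounded hBcl ?_
    have h1 : B = (fun y => (S.symm (y - a)).2) '' {y | y ∈ s ∧ (S.symm (y - a)).1 = δ} := by
      ext z
      constructor
      · intro hz
        exact ⟨a + S (δ, z), ⟨hz, by simp⟩, by simp⟩
      · rintro ⟨y, ⟨hy, hy1⟩, rfl⟩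
        change a + S (δ, (S.symm (y - a)).2) ∈ s
        rw [← hy1]
        change a + S (S.symm (y - a)) ∈ s
        rwa [S.apply_symm_apply, add_sub_cancel]
    have hSsc : Continuous S.symm := S.symm.toLinearMap.continuous_of_finiteDimensional
    rw [h1]
    refine (hs.image (f := fun y => (S.symm (y - a)).2) (by fun_prop)).isBounded.subset ?_
    exact Set.image_mono fun y hy => hy.1
  -- pass to coordinates
  have hT : MeasurePreserving (fun p => a + S p) volume volume :=
    (measurePreserving_add_left volume a).comp hSm
  set Q : Set (ℝ × (Fin n → ℝ)) := {p | a + S p ∈ C}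
  have hQm : MeasurableSet Q := hT.measurable hC.measurableSet
  have e1 : ∫ x in C, F x = ∫ p in Q, F (a + S p) := by
    rw [← (hT.restrict_preimage hC.measurableSet).map_eq, integral_map hT.measurable.aemeasurable
      hF.aestronglyMeasurable]
    rfl
  have hQfin : volume Q ≠ ⊤ := by
    rw [show volume Q = volume C from hT.measure_preimage hC.measurableSet.nullMeasurableSet]
    exact hC.measure_lt_top.ne
  have i1 : IntegrableOn (fun p => F (a + S p)) Q := by
    obtain ⟨M, hM⟩ := hC.exists_bound_of_continuousOn hF.continuousOn
    refine Measure.integrableOn_of_bounded (M := M) hQfin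
      (hF.comp (by fun_prop : Continuous fun p => a + S p)).aestronglyMeasurable ?_
    exact (ae_restrict_iff' hQm).2 (Eventually.of_forall fun q hq => hM _ hq)
  -- The section of the cone at height `t` is the base scaled by `t / δ`, where `δ` is the distance
  -- from the apex to the hyperplane.
  have hQiff : ∀ t z, t ≠ 0 → ((t, z) ∈ Q ↔ t ∈ Set.Ioc 0 δ ∧ (δ / t) • z ∈ B) := by
    intro t z ht
    constructor
    · rintro ⟨⟨r, y⟩, ⟨hr, hy⟩, hry⟩
      simp only at hr hy hry
      have h1 : r • (y - a) = S (t, z) := by simpa using hry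
      have h2 : r = ‖w‖ * t := by
        have := congrArg (fun x => inner ℝ w x) h1
        simpa [real_inner_smul_right, hsw y hy, hSw] using this
      have h3 : t = δ * r := by rw [h2]; simp only [δ]; field_simp
      have hr0 : r ≠ 0 := by rintro rfl; simp at h3; exact ht h3
      refine ⟨⟨?_, ?_⟩, ?_⟩
      · rw [h3]; exact mul_pos hδ (lt_of_le_of_ne hr.1 hr0.symm)
      · rw [h3]; nlinarith [hr.2]
      · have h4 : S (δ, (δ / t) • z) = (δ / t) • S (t, z) := by
          rw [← map_smul]; congr 1
          ext <;> simp [div_mul_cancel₀ _ ht]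
        change a + S (δ, (δ / t) • z) ∈ s
        rw [h4, ← h1, h3, smul_smul]
        have : δ / (δ * r) * r = 1 := by field_simp
        rw [this, one_smul]
        simpa using hy
    · rintro ⟨⟨ht0, htδ⟩, hz⟩
      refine ⟨(t / δ, a + S (δ, (δ / t) • z)), ⟨⟨by positivity, (div_le_one hδ).2 htδ⟩, hz⟩, ?_⟩
      simp only [add_sub_cancel_left]
      rw [← map_smul]
      congr 2
      ext
      · simp [div_mul_cancel₀ _ hδ.ne']
      · simp; field_simp
  have e2 : ∀ t ≠ 0, ∫ z, Q.indicator (fun p => F (a + S p)) (t, z) =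
      (Set.Ioc 0 δ).indicator
        (fun t => (t / δ) ^ n * ∫ z in B, F (a + (t / δ) • S (δ, z))) t := by
    intro t ht
    by_cases htI : t ∈ Set.Ioc 0 δ
    · rw [Set.indicator_of_mem htI]
      have hR : 0 < t / δ := div_pos htI.1 hδ
      have h1 := Measure.integral_comp_smul (volume : Measure (Fin n → ℝ))
        (fun z => Q.indicator (fun p => F (a + S p)) (t, z)) (t / δ)
      rw [Module.finrank_fin_fun, abs_of_pos (by positivity), smul_eq_mul] at h1
      have h2 : ∫ z, Q.indicator (fun p => F (a + S p)) (t, z) = (t / δ) ^ n *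
          ∫ z, Q.indicator (fun p => F (a + S p)) (t, (t / δ) • z) := by
        rw [h1, ← mul_assoc, mul_inv_cancel₀ (by positivity), one_mul]
      rw [h2, ← integral_indicator hBcl.measurableSet]
      congr 2
      ext z
      have h3 : (t, (t / δ) • z) ∈ Q ↔ z ∈ B := by
        rw [hQiff _ _ ht, smul_smul]
        have : δ / t * (t / δ) = 1 := by field_simp
        rw [this, one_smul]
        exact ⟨fun h => h.2, fun h => ⟨htI, h⟩⟩
      by_cases hz : z ∈ B
      · rw [Set.indicator_of_mem hz, Set.indicator_of_mem (h3.2 hz)]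
        congr 2
        rw [← map_smul]
        congr 1
        ext <;> simp [div_mul_cancel₀ _ hδ.ne']
      · rw [Set.indicator_of_notMem hz, Set.indicator_of_notMem (fun h => hz (h3.1 h))]
    · rw [Set.indicator_of_notMem htI]
      apply integral_eq_zero_of_ae
      refine Eventually.of_forall fun z => ?_
      exact Set.indicator_of_notMem (fun h => htI ((hQiff t z ht).1 h).1) _
  have e3 : ∫ p in Q, F (a + S p)
      = ∫ t in Set.Ioc 0 δ, (t / δ) ^ n * ∫ z in B, F (a + (t / δ) • S (δ, z)) := by
    rw [← integral_indicator hQm, Measure.volume_eq_prod,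
      integral_prod _ ((integrable_indicator_iff hQm).2 i1), ← integral_indicator measurableSet_Ioc]
    apply integral_congr_ae
    have : ∀ᵐ t : ℝ, t ≠ 0 := by simp [ae_iff]
    filter_upwards [this] with t ht
    exact e2 t ht
  have e4 : ∫ t in Set.Ioc 0 δ, (t / δ) ^ n * ∫ z in B, F (a + (t / δ) • S (δ, z))
      = δ * ∫ r in Set.Ioc (0 : ℝ) 1, ∫ z in B, r ^ n * F (a + r • S (δ, z)) := by
    rw [← intervalIntegral.integral_of_le hδ.le, ← intervalIntegral.integral_of_le zero_le_one]
    have := intervalIntegral.integral_comp_div (a := 0) (b := δ)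
      (fun r => r ^ n * ∫ z in B, F (a + r • S (δ, z))) hδ.ne'
    rw [this, zero_div, div_self hδ.ne', smul_eq_mul]
    simp only [integral_const_mul]
  have e5 : ∫ r in Set.Ioc (0 : ℝ) 1, ∫ z in B, r ^ n * F (a + r • S (δ, z))
      = ∫ z in B, ∫ r in Set.Ioc (0 : ℝ) 1, r ^ n * F (a + r • S (δ, z)) := by
    apply integral_integral_swap
    have hc : Continuous fun q : ℝ × (Fin n → ℝ) => q.1 ^ n * F (a + q.1 • S (δ, q.2)) := by
      fun_prop
    have h1 := hc.continuousOn.integrableOn_compact (μ := volume)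
      ((isCompact_Icc (a := (0 : ℝ)) (b := 1)).prod hB)
    have h2 := h1.mono_set (Set.prod_mono_left (t := B) (Set.Ioc_subset_Icc_self (a := (0 : ℝ)) (b := 1)))
    rw [IntegrableOn, Measure.volume_eq_prod, ← Measure.prod_restrict] at h2
    exact h2
  -- Along each ray the integrand is the derivative of `r ^ (n + 1) * φ (a + r • η)`, so radial
  -- integration leaves only the value on the base.
  have e6 : ∀ η : Space (n + 1), ∫ r in Set.Ioc (0 : ℝ) 1, r ^ n * F (a + r • η) = φ (a + η) := by
    intro η
    rw [← intervalIntegral.integral_of_le zero_le_one]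
    have hd : ∀ r : ℝ, HasDerivAt (fun r : ℝ => r ^ (n + 1) * φ (a + r • η))
        (r ^ n * F (a + r • η)) r := by
      intro r
      have h1 : HasDerivAt (fun r : ℝ => a + r • η) η r := by
        simpa using ((hasDerivAt_id r).smul_const η).const_add a
      have h2 := (hφ.differentiable one_ne_zero (a + r • η)).hasFDerivAt.comp_hasDerivAt r h1
      have h3 := (hasDerivAt_pow (n + 1) r).mul h2
      refine h3.congr_deriv ?_
      simp only [F, add_sub_cancel_left, inner_gradient_left, map_smul, smul_eq_mul,
        Function.comp, Nat.cast_add, Nat.cast_one, Nat.add_sub_cancel]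
      ring
    rw [intervalIntegral.integral_eq_sub_of_hasDerivAt (fun r _ => hd r)]
    · simp
    · exact Continuous.intervalIntegrable (by fun_prop) _ _
  rw [e1, e3, e4, e5]
  simp only [e6]
  rw [setIntegral_hausdorff_eq S hSn hs.measurableSet (δ := δ) (fun y hy => ?_) φ]
  have h1 := hSw (S.symm (y - a))
  rw [S.apply_symm_apply, hsw y hy] at h1
  simp only [δ]
  field_simp
  linarith

/-! ### Cauchy–Schwarz in square-root form. -/

section CauchySchwarz

variable {α : Type*} [MeasurableSpace α] {μ : Measure α}

theorem abs_integral_mul_le_sqrt {f g : α → ℝ} (hf : MemLp f 2 μ) (hg : MemLp g 2 μ) :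
    |∫ x, f x * g x ∂μ| ≤ √(∫ x, f x ^ 2 ∂μ) * √(∫ x, g x ^ 2 ∂μ) := by
  have h2 : ENNReal.ofReal 2 = 2 := by norm_num
  have h := integral_mul_norm_le_Lp_mul_Lq (μ := μ) (f := f) (g := g) Real.HolderConjugate.two_two
    (by rwa [h2]) (by rwa [h2])
  rw [← Real.norm_eq_abs]
  refine (norm_integral_le_integral_norm _).trans ?_
  simp only [norm_mul]
  refine h.trans (le_of_eq ?_)
  rw [Real.sqrt_eq_rpow, Real.sqrt_eq_rpow]
  simp

theorem abs_integral_inner_le_sqrt {E : Type*} [NormedAddCommGroup E] [InnerProductSpace ℝ E]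
    {f g : α → E} (hf : MemLp f 2 μ) (hg : MemLp g 2 μ) :
    |∫ x, inner ℝ (f x) (g x) ∂μ| ≤ √(∫ x, ‖f x‖ ^ 2 ∂μ) * √(∫ x, ‖g x‖ ^ 2 ∂μ) := by
  have h := abs_integral_mul_le_sqrt hf.norm hg.norm
  refine le_trans ?_ ((le_abs_self _).trans h)
  rw [← Real.norm_eq_abs]
  refine norm_integral_le_of_norm_le (hf.norm.integrable_mul hg.norm) ?_
  exact Eventually.of_forall fun x => norm_inner_le_norm (𝕜 := ℝ) (f x) (g x)

end CauchySchwarz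

/-! ### Geometry of a simplex; Poincaré and trace inequalities for smooth functions. -/

section Simplex

variable {n : ℕ} {K : Finset (Space (n + 1))}

theorem isCompact_cell {d : ℕ} (K : Finset (Space d)) : IsCompact (cell K) :=
  K.finite_toSet.isCompact_convexHull (𝕜 := ℝ)

theorem Continuous.integrableOn_cell {d : ℕ} {F : Type*} [NormedAddCommGroup F] {f : Space d → F}
    (hf : Continuous f) (K : Finset (Space d)) : IntegrableOn f (cell K) :=
  hf.continuousOn.integrableOn_compact (isCompact_cell K)

theorem convex_cell {d : ℕ} (K : Finset (Space d)) : Convex ℝ (cell K) := convex_convexHull ℝ _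

theorem interior_cell_nonempty (hcard : K.card = n + 1 + 1)
    (hai : AffineIndependent ℝ ((↑) : K → Space (n + 1))) : (interior (cell K)).Nonempty := by
  rw [cell, interior_convexHull_nonempty_iff_affineSpan_eq_top]
  have h := (hai.affineSpan_eq_top_iff_card_eq_finrank_add_one (k := ℝ)).2 (by simp [hcard])
  simpa using h

theorem volume_real_cell_pos (hcard : K.card = n + 1 + 1)
    (hai : AffineIndependent ℝ ((↑) : K → Space (n + 1))) : 0 < volume.real (cell K) := by
  rw [measureReal_def, ENNReal.toReal_pos_iff]
  exact ⟨Measure.measure_pos_of_nonempty_interior _ (interior_cell_nonempty hcard hai),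
    (isCompact_cell K).measure_lt_top⟩

/-- The hyperplane containing the facet of a simplex opposite to the vertex `a`. -/
theorem exists_facet_normal (hai : AffineIndependent ℝ ((↑) : K → Space (n + 1)))
    (hcard : 1 < K.card) {a : Space (n + 1)} (ha : a ∈ K) :
    ∃ w : Space (n + 1), w ≠ 0 ∧ ∀ y ∈ cell (K.erase a), inner ℝ w (y - a) = 1 := by
  -- The edges issuing from `a` are linearly independent, so some linear functional equals one on
  -- all of them; `w` is its Riesz representative.
  have hli := (affineIndependent_iff_linearIndependent_vsub ℝ _ (⟨a, ha⟩ : K)).1 hai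
  set b := Module.Basis.span hli
  obtain ⟨f, hf⟩ := (b.constr ℕ (fun _ => (1 : ℝ)) :
    Submodule.span ℝ (Set.range fun i : {x : K // x ≠ ⟨a, ha⟩} => ((i : K) : Space (n + 1)) -ᵥ a)
      →ₗ[ℝ] ℝ).exists_extend
  set w := (InnerProductSpace.toDual ℝ (Space (n + 1))).symm (LinearMap.toContinuousLinearMap f)
  have hw : ∀ x, inner ℝ w x = f x := fun x => by
    simp [w]
  have hv : ∀ y ∈ K.erase a, inner ℝ w (y - a) = 1 := by
    intro y hy
    rw [Finset.mem_erase] at hy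
    let i : {x : K // x ≠ ⟨a, ha⟩} := ⟨⟨y, hy.2⟩, fun h => hy.1 (by simpa using h)⟩
    have h1 : (b i : Space (n + 1)) = y - a := by
      rw [Module.Basis.span_apply]; rfl
    rw [hw, ← h1]
    have h2 := congrArg (fun g => g (b i)) hf
    simpa using h2
  have hv' : ∀ y ∈ cell (K.erase a), inner ℝ w (y - a) = 1 := by
    have hconv : Convex ℝ {y : Space (n + 1) | inner ℝ w y = 1 + inner ℝ w a} :=
      convex_hyperplane (innerₗ _ w).isLinear _
    have hsub : cell (K.erase a) ⊆ {y : Space (n + 1) | inner ℝ w y = 1 + inner ℝ w a} := by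
      refine convexHull_min (fun y hy => ?_) hconv
      have := hv y (Finset.mem_coe.1 hy)
      rw [inner_sub_right] at this
      simp only [Set.mem_ofPred_eq]; linarith
    intro y hy
    have := hsub hy
    simp only [Set.mem_ofPred_eq] at this
    rw [inner_sub_right]; linarith
  refine ⟨w, ?_, hv'⟩
  rintro h0
  have : 0 < (K.erase a).card := by rw [Finset.card_erase_of_mem ha]; omega
  obtain ⟨y, hy⟩ := Finset.card_pos.1 this
  have := hv y hy
  rw [h0] at this
  simp at this

theorem cell_eq_cone (hcard : 1 < K.card) {a : Space (n + 1)} (ha : a ∈ K) :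
    cell K = (fun q : ℝ × Space (n + 1) => a + q.1 • (q.2 - a)) ''
      (Set.Icc 0 1 ×ˢ cell (K.erase a)) := by
  have h1 : (K : Set (Space (n + 1))) = insert a ((K.erase a : Finset _) : Set (Space (n + 1))) := by
    rw [← Finset.coe_insert, Finset.insert_erase ha]
  have hne : ((K.erase a : Finset _) : Set (Space (n + 1))).Nonempty := by
    have : 0 < (K.erase a).card := by rw [Finset.card_erase_of_mem ha]; omega
    exact_mod_cast Finset.card_pos.1 this
  rw [cell, h1, convexHull_insert hne, convexJoin_singleton_left]
  ext x
  simp only [Set.mem_iUnion, exists_prop, Set.mem_image, Prod.exists, Set.mem_prod]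
  constructor
  · rintro ⟨y, hy, hx⟩
    rw [segment_eq_image'] at hx
    obtain ⟨r, hr, rfl⟩ := hx
    exact ⟨r, y, ⟨hr, hy⟩, rfl⟩
  · rintro ⟨r, y, ⟨hr, hy⟩, rfl⟩
    refine ⟨y, hy, ?_⟩
    rw [segment_eq_image']
    exact ⟨r, hr, rfl⟩

/-- The facet of a simplex has positive and finite surface measure, and Gauss' formula holds for
the field `φ x • (x - a)`, with `a` the opposite vertex. -/
theorem facet_measure_and_gauss (hcard : K.card = n + 1 + 1)
    (hai : AffineIndependent ℝ ((↑) : K → Space (n + 1))) {a : Space (n + 1)} (ha : a ∈ K) :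
    0 < (facetMeasure (K.erase a)).real Set.univ ∧
    ∀ φ : Space (n + 1) → ℝ, ContDiff ℝ 1 φ →
      ∫ y, φ y ∂(facetMeasure (K.erase a)) =
        (facetMeasure (K.erase a)).real Set.univ / ((n + 1) * volume.real (cell K)) *
          ∫ x in cell K, ((n + 1) * φ x + inner ℝ (gradient φ x) (x - a)) := by
  have hc1 : 1 < K.card := by omega
  obtain ⟨w, hw, hwe⟩ := exists_facet_normal hai hc1 ha
  have hwn : 0 < ‖w‖ := norm_pos_iff.2 hw
  have hV := volume_real_cell_pos hcard hai
  have key : ∀ φ : Space (n + 1) → ℝ, ContDiff ℝ 1 φ →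
      ∫ x in cell K, ((n + 1) * φ x + inner ℝ (gradient φ x) (x - a))
        = ‖w‖⁻¹ * ∫ y, φ y ∂(facetMeasure (K.erase a)) := by
    intro φ hφ
    have := setIntegral_cone_eq hw (isCompact_cell (K.erase a)) hwe hφ
    rw [← cell_eq_cone hc1 ha] at this
    exact this
  -- Testing with the constant one identifies `‖w‖` with `|e| / (d |K|)`, the factor occurring in
  -- `C₂`.
  have h1 := key (fun _ => 1) contDiff_const
  simp only [gradient_fun_const, inner_zero_left, add_zero, mul_one, integral_const, smul_eq_mul,
    measureReal_restrict_apply_univ] at h1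
  have hpos : 0 < (facetMeasure (K.erase a)).real Set.univ := by
    have h2 : (facetMeasure (K.erase a)).real Set.univ = ‖w‖ * (volume.real (cell K) * (n + 1)) := by
      rw [h1]; field_simp
    rw [h2]; positivity
  refine ⟨hpos, fun φ hφ => ?_⟩
  rw [key φ hφ]
  have h3 : (facetMeasure (K.erase a)).real Set.univ / ((n + 1) * volume.real (cell K)) = ‖w‖ := by
    rw [div_eq_iff (by positivity)]
    field_simp at h1
    linarith
  rw [h3, ← mul_assoc, mul_inv_cancel₀ hwn.ne', one_mul]

/-- The real-valued mass of an infinite measure is zero by convention, so its positivity already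
implies finiteness. -/
theorem isFiniteMeasure_facetMeasure (hcard : K.card = n + 1 + 1)
    (hai : AffineIndependent ℝ ((↑) : K → Space (n + 1))) {a : Space (n + 1)} (ha : a ∈ K) :
    IsFiniteMeasure (facetMeasure (K.erase a)) := by
  have h := (facet_measure_and_gauss hcard hai ha).1
  rw [measureReal_def, ENNReal.toReal_pos_iff] at h
  exact ⟨h.2⟩

theorem gradient_sq {E : Type*} [NormedAddCommGroup E] [InnerProductSpace ℝ E]
    [CompleteSpace E] {φ : E → ℝ} {x : E} (hφ : DifferentiableAt ℝ φ x) :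
    gradient (fun x => φ x ^ 2) x = (2 * φ x) • gradient φ x := by
  apply HasGradientAt.gradient
  rw [hasGradientAt_iff_hasFDerivAt]
  refine (hφ.hasFDerivAt.pow 2).congr_fderiv ?_
  ext y
  simp

theorem gradient_sub_const {E : Type*} [NormedAddCommGroup E] [InnerProductSpace ℝ E]
    [CompleteSpace E] (φ : E → ℝ) (m : ℝ) : gradient (fun x => φ x - m) = gradient φ := by
  ext1 x
  simp only [gradient, fderiv_sub_const]

/-- Each point of the simplex lies on a segment from `a` to the opposite facet. Hence the maximal
distance over the facet, as used in `constC2`, controls `|x - a|` on the whole element. -/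
theorem norm_sub_vertex_le (hcard : 1 < K.card) {a x : Space (n + 1)} (ha : a ∈ K)
    (hx : x ∈ cell K) : ‖x - a‖ ≤ sSup ((fun x => dist x a) '' cell (K.erase a)) := by
  rw [cell_eq_cone hcard ha] at hx
  obtain ⟨⟨r, y⟩, ⟨hr, hy⟩, rfl⟩ := hx
  simp only [add_sub_cancel_left, norm_smul] at hr hy ⊢
  have h1 : ‖y - a‖ ≤ sSup ((fun x => dist x a) '' cell (K.erase a)) := by
    rw [← dist_eq_norm]
    refine le_csSup ?_ ⟨y, hy, rfl⟩
    exact ((isCompact_cell _).image (by fun_prop)).bddAbove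
  rw [Real.norm_of_nonneg hr.1]
  nlinarith [hr.2, norm_nonneg (y - a)]

/-- The mean value of a function over a simplex. -/
theorem exists_mean (hcard : K.card = n + 1 + 1)
    (hai : AffineIndependent ℝ ((↑) : K → Space (n + 1))) {φ : Space (n + 1) → ℝ}
    (hφ : Continuous φ) : ∃ m : ℝ, ∫ x in cell K, (φ x - m) = 0 := by
  have hV := volume_real_cell_pos hcard hai
  refine ⟨(∫ x in cell K, φ x) / volume.real (cell K), ?_⟩
  rw [integral_sub (hφ.continuousOn.integrableOn_compact (isCompact_cell K))
    (continuous_const.continuousOn.integrableOn_compact (isCompact_cell K)), integral_const,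
    smul_eq_mul, measureReal_restrict_apply_univ]
  field_simp
  ring

theorem sqrt_le_div_pi_mul_sqrt {A B h : ℝ} (hφm : Real.pi ^ 2 * A ≤ h ^ 2 * B) (hh : 0 ≤ h) :
    √A ≤ h / Real.pi * √B := by
  have hpi := Real.pi_pos
  rw [← Real.sqrt_sq (show 0 ≤ h / Real.pi by positivity), ← Real.sqrt_mul (by positivity)]
  apply Real.sqrt_le_sqrt
  rw [div_pow, div_mul_eq_mul_div, le_div_iff₀ (by positivity)]
  linarith

theorem memLp_cell {F : Type*} [NormedAddCommGroup F] {φ : Space (n + 1) → F} (hφ : Continuous φ)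
    {K : Finset (Space (n + 1))} {p : ENNReal} : MemLp φ p (volume.restrict (cell K)) := by
  obtain ⟨C, hC⟩ := (isCompact_cell K).exists_bound_of_continuousOn hφ.continuousOn
  have : IsFiniteMeasure (volume.restrict (cell K)) :=
    ⟨by simpa using (isCompact_cell K).measure_lt_top⟩
  refine MemLp.of_bound ?_ C ?_
  · exact hφ.continuousOn.aestronglyMeasurable_of_isCompact (isCompact_cell K)
      (isCompact_cell K).measurableSet
  · exact (ae_restrict_iff' (isCompact_cell K).measurableSet).2 (Eventually.of_forall hC)

/-- The Poincaré and trace inequalities with the constants `C₁`, `C₂` for smooth functions of mean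
value zero. -/
theorem trace_le_constC2 (hcard : K.card = n + 1 + 1)
    (hai : AffineIndependent ℝ ((↑) : K → Space (n + 1))) {φ : Space (n + 1) → ℝ}
    (hφ : ContDiff ℝ 1 φ) (hm : ∫ x in cell K, φ x = 0) :
    normL2 (elementMeasure K) φ ≤ constC1 K * √(∫ x in cell K, ‖gradient φ x‖ ^ 2) ∧
    ∀ a ∈ K, normL2 (facetMeasure (K.erase a)) φ
      ≤ constC2 K (K.erase a) a * √(∫ x in cell K, ‖gradient φ x‖ ^ 2) := by
  have hc1 : 1 < K.card := by omega
  have hpw := (convex_cell K).payne_weinberger (isCompact_cell K) le_rfl hφ hm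
  set h := Metric.diam (cell K)
  have hh : 0 ≤ h := Metric.diam_nonneg
  set A := ∫ x in cell K, φ x ^ 2
  set B := ∫ x in cell K, ‖gradient φ x‖ ^ 2
  have hA : 0 ≤ A := integral_nonneg fun x => sq_nonneg _
  have hB : 0 ≤ B := integral_nonneg fun x => sq_nonneg _
  have h1 : √A ≤ h / Real.pi * √B := sqrt_le_div_pi_mul_sqrt hpw hh
  refine ⟨h1, fun a ha => ?_⟩
  obtain ⟨hpos, hgauss⟩ := facet_measure_and_gauss hcard hai ha
  set ρ := sSup ((fun x => dist x a) '' cell (K.erase a))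
  have hρ0 : 0 ≤ ρ := Real.sSup_nonneg (by rintro _ ⟨y, -, rfl⟩; exact dist_nonneg)
  set k := (facetMeasure (K.erase a)).real Set.univ / ((n + 1) * volume.real (cell K))
  have hV := volume_real_cell_pos hcard hai
  have hk : 0 < k := by positivity
  have hφc := hφ.continuous
  have hgc := hφ.continuous_gradient
  -- Gauss' formula for `φ² (x - a)`, whose divergence is `d φ² + 2 φ ∇φ · (x - a)`, followed by
  -- Cauchy–Schwarz.
  have e1 : ∫ y, φ y ^ 2 ∂(facetMeasure (K.erase a)) ≤ k * ((n + 1) * A + 2 * (ρ * (√A * √B))) := by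
    rw [hgauss _ (hφ.pow 2)]
    apply mul_le_mul_of_nonneg_left _ hk.le
    have h2 : ∀ x, ((n + 1) * φ x ^ 2 + inner ℝ (gradient (fun x => φ x ^ 2) x) (x - a))
        = (n + 1) * φ x ^ 2 + 2 * (φ x * inner ℝ (gradient φ x) (x - a)) := fun x => by
      rw [gradient_sq (hφ.differentiable one_ne_zero x), real_inner_smul_left]; ring
    simp only [h2]
    have i1 : IntegrableOn (fun x => ((n : ℝ) + 1) * φ x ^ 2) (cell K) :=
      Continuous.integrableOn_cell (by fun_prop) K
    have i2 : IntegrableOn (fun x => 2 * (φ x * inner ℝ (gradient φ x) (x - a))) (cell K) :=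
      Continuous.integrableOn_cell (by fun_prop) K
    rw [integral_add i1 i2, integral_const_mul, integral_const_mul]
    gcongr
    have i3 : IntegrableOn (fun x => ρ * (|φ x| * ‖gradient φ x‖)) (cell K) :=
      Continuous.integrableOn_cell (by fun_prop) K
    have i4 : IntegrableOn (fun x => φ x * inner ℝ (gradient φ x) (x - a)) (cell K) :=
      Continuous.integrableOn_cell (by fun_prop) K
    have h3 : ∫ x in cell K, φ x * inner ℝ (gradient φ x) (x - a) ≤
        ∫ x in cell K, ρ * (|φ x| * ‖gradient φ x‖) := by
      refine setIntegral_mono_on i4 i3 (isCompact_cell K).measurableSet fun x hx => ?_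
      have h4 := norm_sub_vertex_le hc1 ha hx
      calc φ x * inner ℝ (gradient φ x) (x - a)
          ≤ |φ x| * |inner ℝ (gradient φ x) (x - a)| := by
            rw [← abs_mul]; exact le_abs_self _
        _ ≤ |φ x| * (‖gradient φ x‖ * ‖x - a‖) := by
            gcongr; exact abs_real_inner_le_norm _ _
        _ ≤ |φ x| * (‖gradient φ x‖ * ρ) := by gcongr
        _ = ρ * (|φ x| * ‖gradient φ x‖) := by ring
    refine h3.trans ?_
    rw [integral_const_mul]
    apply mul_le_mul_of_nonneg_left _ hρ0
    have := abs_integral_mul_le_sqrt (memLp_cell (K := K) (p := 2) hφc.abs)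
      (memLp_cell (K := K) (p := 2) hgc.norm)
    simpa only [sq_abs] using (le_abs_self _).trans this
  have hAs : A = √A ^ 2 := (Real.sq_sqrt hA).symm
  have hBs : B = √B ^ 2 := (Real.sq_sqrt hB).symm
  have hpi := Real.pi_pos
  rw [normL2, constC2, ← Real.sqrt_mul (by positivity)]
  apply Real.sqrt_le_sqrt
  refine e1.trans ?_
  rw [elementMeasure, measureReal_restrict_apply_univ, Nat.cast_add, Nat.cast_one]
  change _ ≤ k * (h / Real.pi) * (2 * ρ + (n + 1) * h / Real.pi) * B
  -- Inserting `√A ≤ (h / π) √B` in both terms produces the remaining factor of `C₂²`.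
  have e2 : (n + 1) * A + 2 * (ρ * (√A * √B))
      ≤ (h / Real.pi) * (2 * ρ + (n + 1) * (h / Real.pi)) * B := by
    have e3 : A ≤ (h / Real.pi) ^ 2 * B := by
      rw [hAs, hBs, ← mul_pow]; exact pow_le_pow_left₀ (Real.sqrt_nonneg _) h1 2
    have e4 : √A * √B ≤ h / Real.pi * B := by
      calc √A * √B ≤ h / Real.pi * √B * √B := by gcongr
        _ = h / Real.pi * B := by rw [mul_assoc, Real.mul_self_sqrt hB]
    have e5 := mul_le_mul_of_nonneg_left e4 hρ0
    have e6 := mul_le_mul_of_nonneg_left e3 (show (0 : ℝ) ≤ n + 1 by positivity)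
    nlinarith
  have e7 := mul_le_mul_of_nonneg_left e2 hk.le
  refine e7.trans (le_of_eq ?_)
  ring

/-- A trace inequality without mean value condition. -/
theorem exists_trace_bound (hcard : K.card = n + 1 + 1)
    (hai : AffineIndependent ℝ ((↑) : K → Space (n + 1))) {a : Space (n + 1)} (ha : a ∈ K) :
    ∃ C : ℝ, 0 ≤ C ∧ ∀ φ : Space (n + 1) → ℝ, ContDiff ℝ 1 φ →
      ∫ y, φ y ^ 2 ∂(facetMeasure (K.erase a)) ≤
        C * ((∫ x in cell K, φ x ^ 2) + ∫ x in cell K, ‖gradient φ x‖ ^ 2) := by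
  have hc1 : 1 < K.card := by omega
  obtain ⟨hpos, hgauss⟩ := facet_measure_and_gauss hcard hai ha
  set ρ := sSup ((fun x => dist x a) '' cell (K.erase a))
  have hρ0 : 0 ≤ ρ := Real.sSup_nonneg (by rintro _ ⟨y, -, rfl⟩; exact dist_nonneg)
  set k := (facetMeasure (K.erase a)).real Set.univ / ((n + 1) * volume.real (cell K))
  have hV := volume_real_cell_pos hcard hai
  have hk : 0 < k := by positivity
  -- The same Gauss identity, now with `2 |φ| ‖∇φ‖ ≤ φ² + ‖∇φ‖²`. The constant is not sharp; it only
  -- serves existence and uniqueness of traces.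
  refine ⟨k * (n + 1 + ρ), by positivity, fun φ hφ => ?_⟩
  have hφc := hφ.continuous
  have hgc := hφ.continuous_gradient
  rw [hgauss _ (hφ.pow 2), mul_assoc]
  apply mul_le_mul_of_nonneg_left _ hk.le
  have hi : ∀ f : Space (n + 1) → ℝ, Continuous f → IntegrableOn f (cell K) := fun f hf =>
    hf.integrableOn_cell K
  rw [← integral_add (hi _ (by fun_prop)) (hi _ (by fun_prop)), ← integral_const_mul]
  have h2 : ∀ x, ((n + 1) * φ x ^ 2 + inner ℝ (gradient (fun x => φ x ^ 2) x) (x - a))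
      = (n + 1) * φ x ^ 2 + 2 * (φ x * inner ℝ (gradient φ x) (x - a)) := fun x => by
    rw [gradient_sq (hφ.differentiable one_ne_zero x), real_inner_smul_left]; ring
  simp only [h2]
  refine setIntegral_mono_on (hi _ (by fun_prop)) (hi _ (by fun_prop))
    (isCompact_cell K).measurableSet fun x hx => ?_
  have h4 := norm_sub_vertex_le hc1 ha hx
  have h5 : φ x * inner ℝ (gradient φ x) (x - a) ≤ |φ x| * (‖gradient φ x‖ * ρ) :=
    calc φ x * inner ℝ (gradient φ x) (x - a)
        ≤ |φ x| * |inner ℝ (gradient φ x) (x - a)| := by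
          rw [← abs_mul]; exact le_abs_self _
      _ ≤ |φ x| * (‖gradient φ x‖ * ‖x - a‖) := by
          gcongr; exact abs_real_inner_le_norm _ _
      _ ≤ |φ x| * (‖gradient φ x‖ * ρ) := by gcongr
  have h6 : 2 * (|φ x| * ‖gradient φ x‖) ≤ φ x ^ 2 + ‖gradient φ x‖ ^ 2 := by
    have := two_mul_le_add_sq (|φ x|) ‖gradient φ x‖
    rw [sq_abs] at this; linarith
  have h7 := mul_le_mul_of_nonneg_left h6 hρ0
  have h8 : 0 ≤ ((n : ℝ) + 1) * ‖gradient φ x‖ ^ 2 := by positivity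
  nlinarith

end Simplex

/-! ### Mollification and dilation in `L²`. -/

section Mollify

theorem eLpNorm_two_sq {α F : Type*} [MeasurableSpace α] [NormedAddCommGroup F] (f : α → F)
    (μ : Measure α) : eLpNorm f 2 μ ^ 2 = ∫⁻ x, ‖f x‖ₑ ^ 2 ∂μ := by
  have h := eLpNorm_nnreal_pow_eq_lintegral (μ := μ) (f := f) (p := 2) two_ne_zero
  have h2 : ((2 : NNReal) : ℝ) = ((2 : ℕ) : ℝ) := by simp
  simp only [h2, ENNReal.rpow_natCast] at h
  exact_mod_cast h

variable {d : ℕ} {F : Type*} [NormedAddCommGroup F] [NormedSpace ℝ F]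

/-- Mollification by a normalised bump function. -/
def mollify (ρ : ContDiffBump (0 : Space d)) (f : Space d → F) : Space d → F :=
  convolution (ρ.normed volume) f (ContinuousLinearMap.lsmul ℝ ℝ) volume

theorem mollify_apply (ρ : ContDiffBump (0 : Space d)) (f : Space d → F) (x : Space d) :
    mollify ρ f x = ∫ s, ρ.normed volume s • f (x - s) := rfl

theorem mollify_congr_ae (ρ : ContDiffBump (0 : Space d)) {f g : Space d → F}
    (h : f =ᵐ[volume] g) : mollify ρ f = mollify ρ g := by
  ext1 x
  rw [mollify_apply, mollify_apply]
  apply integral_congr_ae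
  filter_upwards [(quasiMeasurePreserving_sub_left_of_right_invariant volume x).ae_eq_comp h]
    with s hs
  simp only [Function.comp] at hs
  rw [hs]

theorem mollify_sub (ρ : ContDiffBump (0 : Space d)) {f g : Space d → F}
    (hf : LocallyIntegrable f) (hg : LocallyIntegrable g) :
    mollify ρ (f - g) = mollify ρ f - mollify ρ g := by
  have hi : ∀ {f : Space d → F}, LocallyIntegrable f → ∀ x,
      Integrable fun s => ρ.normed volume s • f (x - s) := fun hf x =>
    ρ.hasCompactSupport_normed.convolutionExists_left (ContinuousLinearMap.lsmul ℝ ℝ)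
      ρ.continuous_normed hf x
  ext1 x
  rw [Pi.sub_apply, mollify_apply, mollify_apply, mollify_apply, ← integral_sub (hi hf x) (hi hg x)]
  simp only [Pi.sub_apply, smul_sub]

theorem continuous_mollify (ρ : ContDiffBump (0 : Space d)) {f : Space d → F}
    (hf : LocallyIntegrable f) : Continuous (mollify ρ f) :=
  ρ.hasCompactSupport_normed.continuous_convolution_left _ ρ.continuous_normed hf

/-- Mollification does not increase the `L²` norm. -/
theorem eLpNorm_mollify_le (ρ : ContDiffBump (0 : Space d)) {f : Space d → F}
    (hf : AEStronglyMeasurable f volume) :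
    eLpNorm (mollify ρ f) 2 volume ≤ eLpNorm f 2 volume := by
  obtain ⟨g, hg, hfg⟩ := hf
  rw [mollify_congr_ae ρ hfg, eLpNorm_congr_ae hfg]
  refine (ENNReal.pow_le_pow_left_iff two_ne_zero).1 ?_
  rw [eLpNorm_two_sq, eLpNorm_two_sq]
  have hρm : Measurable fun s => ENNReal.ofReal (ρ.normed volume s) :=
    ρ.continuous_normed.measurable.ennreal_ofReal
  have hρ1 : ∫⁻ s, ENNReal.ofReal (ρ.normed volume s) = 1 := by
    rw [← ofReal_integral_eq_lintegral_ofReal ρ.integrable_normed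
      (Eventually.of_forall fun s => ρ.nonneg_normed s), ρ.integral_normed, ENNReal.ofReal_one]
  have hge : Measurable fun x => ‖g x‖ₑ := hg.enorm
  have hpt : ∀ x, ‖mollify ρ g x‖ₑ ^ 2 ≤
      ∫⁻ s, ENNReal.ofReal (ρ.normed volume s) * ‖g (x - s)‖ₑ ^ 2 := by
    intro x
    have h1 : ‖mollify ρ g x‖ₑ ≤ ∫⁻ s, ENNReal.ofReal (ρ.normed volume s) * ‖g (x - s)‖ₑ := by
      rw [mollify_apply]
      refine (enorm_integral_le_lintegral_enorm _).trans (le_of_eq ?_)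
      congr 1; ext s
      rw [enorm_smul, Real.enorm_of_nonneg (ρ.nonneg_normed s)]
    set ν := volume.withDensity fun s => ENNReal.ofReal (ρ.normed volume s)
    have hν : IsProbabilityMeasure ν := ⟨by
      rw [withDensity_apply _ MeasurableSet.univ, Measure.restrict_univ, hρ1]⟩
    have hm : Measurable fun s => ‖g (x - s)‖ₑ := hge.comp (measurable_const.sub measurable_id)
    have hgm : StronglyMeasurable fun s => g (x - s) :=
      hg.comp_measurable (measurable_const.sub measurable_id)
    -- Jensen's inequality, as monotonicity of the exponent for the probability measure with density
    -- the bump function. Tonelli and translation invariance then finish.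
    have h2 := eLpNorm_le_eLpNorm_of_exponent_le (μ := ν) (p := 1) (q := 2) (by norm_num)
      hgm.aestronglyMeasurable
    have h3 : eLpNorm (fun s => g (x - s)) 1 ν
        = ∫⁻ s, ENNReal.ofReal (ρ.normed volume s) * ‖g (x - s)‖ₑ := by
      rw [eLpNorm_one_eq_lintegral_enorm, lintegral_withDensity_eq_lintegral_mul _ hρm hm]
      rfl
    have h4 : eLpNorm (fun s => g (x - s)) 2 ν ^ 2
        = ∫⁻ s, ENNReal.ofReal (ρ.normed volume s) * ‖g (x - s)‖ₑ ^ 2 := by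
      rw [eLpNorm_two_sq, lintegral_withDensity_eq_lintegral_mul _ hρm (hm.pow_const 2)]
      rfl
    rw [← h4]
    gcongr
    exact h1.trans (h3 ▸ h2)
  calc ∫⁻ x, ‖mollify ρ g x‖ₑ ^ 2
      ≤ ∫⁻ x, ∫⁻ s, ENNReal.ofReal (ρ.normed volume s) * ‖g (x - s)‖ₑ ^ 2 := lintegral_mono hpt
    _ = ∫⁻ s, ∫⁻ x, ENNReal.ofReal (ρ.normed volume s) * ‖g (x - s)‖ₑ ^ 2 := by
        apply lintegral_lintegral_swap
        apply Measurable.aemeasurable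
        exact (hρm.comp measurable_snd).mul ((hge.comp (measurable_fst.sub measurable_snd)).pow_const 2)
    _ = ∫⁻ s, ENNReal.ofReal (ρ.normed volume s) * ∫⁻ x, ‖g x‖ₑ ^ 2 := by
        congr 1; ext s
        have hm : Measurable fun x => ‖g (x - s)‖ₑ ^ 2 :=
          (hge.comp (measurable_id.sub_const s)).pow_const 2
        rw [lintegral_const_mul _ hm,
          lintegral_sub_right_eq_self (fun x => ‖g x‖ₑ ^ 2) s]
    _ = ∫⁻ x, ‖g x‖ₑ ^ 2 := by rw [lintegral_mul_const _ hρm, hρ1, one_mul]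

/-- The `L²` norm of a function composed with a dilation. -/
theorem eLpNorm_comp_dilation_le {E : Type*} [NormedAddCommGroup E] {f : Space d → E} (hf : Continuous f) {r : ℝ} (hr : 1 / 2 ≤ r)
    (b : Space d) :
    eLpNorm (fun x => f (r • x + b)) 2 volume ≤ (2 : ENNReal) ^ d * eLpNorm f 2 volume := by
  have hr0 : 0 < r := by linarith
  have hmap : Measure.map (fun x : Space d => r • x + b) volume
      = ENNReal.ofReal |(r ^ d)⁻¹| • volume := by
    have h1 := Measure.map_addHaar_smul (volume : Measure (Space d)) hr0.ne'
    rw [finrank_euclideanSpace_fin] at h1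
    have h2 : (fun x : Space d => r • x + b) = (fun x => x + b) ∘ fun x => r • x := rfl
    rw [h2, ← Measure.map_map (by fun_prop) (by fun_prop), h1, Measure.map_smul,
      (measurePreserving_add_right volume b).map_eq]
  refine (ENNReal.pow_le_pow_left_iff two_ne_zero).1 ?_
  rw [mul_pow, eLpNorm_two_sq, eLpNorm_two_sq]
  have hm : Measurable fun x => ‖f x‖ₑ ^ 2 := by
    have : Continuous fun x => ‖f x‖ₑ := hf.enorm
    exact this.measurable.pow_const 2
  rw [← lintegral_map (f := fun x => ‖f x‖ₑ ^ 2) (g := fun x => r • x + b) hm (by fun_prop), hmap,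
    lintegral_smul_measure, smul_eq_mul]
  gcongr
  -- The Jacobian of the inverse dilation, bounded because `r ≥ 1/2`. Its square root would suffice
  -- for the norm; the cruder `2 ^ d` avoids roots.
  have h3 : |(r ^ d)⁻¹| ≤ 2 ^ d := by
    rw [abs_of_pos (by positivity), inv_le_comm₀ (by positivity) (by positivity), ← inv_pow]
    apply pow_le_pow_left₀ (by norm_num)
    linarith
  calc ENNReal.ofReal |(r ^ d)⁻¹| ≤ ENNReal.ofReal (2 ^ d) := ENNReal.ofReal_le_ofReal h3
    _ = 2 ^ d := by rw [ENNReal.ofReal_pow (by norm_num)]; norm_num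
    _ ≤ (2 ^ d) ^ 2 := by
        have h5 : (1 : ENNReal) ≤ 2 ^ d := one_le_pow₀ (by norm_num)
        calc (2 : ENNReal) ^ d = 2 ^ d * 1 := (mul_one _).symm
          _ ≤ 2 ^ d * 2 ^ d := by gcongr
          _ = _ := by rw [sq]

/-- Convergence of dilated mollifications in `L²` of a compact set. -/
theorem tendsto_mollify_dilation [CompleteSpace F] {K : Set (Space d)} (hK : IsCompact K) {f : Space d → F}
    (hf : MemLp f 2 volume) {ρ : ℕ → ContDiffBump (0 : Space d)} {r : ℕ → ℝ} {c : Space d}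
    (hρ : Tendsto (fun k => (ρ k).rOut) atTop (𝓝 0)) (hr : Tendsto r atTop (𝓝 1))
    (hr2 : ∀ k, 1 / 2 ≤ r k) :
    Tendsto (fun k => eLpNorm (fun x => mollify (ρ k) f (r k • x + (1 - r k) • c) - f x) 2
      (volume.restrict K)) atTop (𝓝 0) := by
  rw [ENNReal.tendsto_nhds_zero]
  intro ε hε
  rcases eq_or_ne ε ⊤ with rfl | hεt
  · simp
  -- a continuous approximation
  set M : ENNReal := 2 ^ d + 1
  have hM0 : M ≠ 0 := by simp [M]
  have hMt : M ≠ ⊤ := by simp [M]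
  have hε' : ε / 2 / M ≠ 0 := by
    simp [ENNReal.div_eq_zero_iff, hε.ne', hMt]
  obtain ⟨g, hgs, hfg, hgc, hgL⟩ := hf.exists_hasCompactSupport_eLpNorm_sub_le (by simp) hε'
  have hgu := hgs.uniformContinuous_of_continuous hgc
  have hfl : LocallyIntegrable f := hf.locallyIntegrable (by norm_num)
  have hgl : LocallyIntegrable g := hgL.locallyIntegrable (by norm_num)
  set A : (Space d → F) → ℕ → Space d → F := fun f k x =>
    mollify (ρ k) f (r k • x + (1 - r k) • c)
  have hAc : ∀ (f : Space d → F) k, LocallyIntegrable f → Continuous (A f k) := fun f k hf =>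
    (continuous_mollify (ρ k) hf).comp (by fun_prop)
  -- the smooth part
  have hg0 : Tendsto (fun k => eLpNorm (fun x => A g k x - g x) 2 (volume.restrict K)) atTop
      (𝓝 0) := by
    rw [ENNReal.tendsto_nhds_zero]
    intro η hη
    rcases eq_or_ne η ⊤ with rfl | hηt
    · simp
    set V : ENNReal := (volume.restrict K) Set.univ ^ (2 : ENNReal).toReal⁻¹
    have hVt : V ≠ ⊤ := by
      apply ENNReal.rpow_ne_top_of_nonneg (by positivity)
      simpa using hK.measure_lt_top.ne
    obtain ⟨τ, hτ, hτη⟩ : ∃ τ : ℝ, 0 < τ ∧ V * ENNReal.ofReal τ ≤ η := by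
      refine ⟨(η / (V + 1)).toReal, ?_, ?_⟩
      · apply ENNReal.toReal_pos
        · simp [ENNReal.div_eq_zero_iff, hη.ne', hVt]
        · apply (ENNReal.div_lt_top hηt (by simp)).ne
      · rw [ENNReal.ofReal_toReal (ENNReal.div_lt_top hηt (by simp)).ne]
        calc V * (η / (V + 1)) ≤ (V + 1) * (η / (V + 1)) := by gcongr; exact le_self_add
          _ = η := ENNReal.mul_div_cancel (by simp) (by simp [hVt])
    obtain ⟨δ, hδ, hgδ⟩ := Metric.uniformContinuous_iff.1 hgu (τ / 2) (half_pos hτ)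
    obtain ⟨R, hR⟩ := (hK.image (f := fun x => x - c) (by fun_prop)).isBounded.exists_norm_le
    have e1 : ∀ᶠ k in atTop, (ρ k).rOut < δ := hρ.eventually (gt_mem_nhds hδ)
    have e2 : ∀ᶠ k in atTop, |r k - 1| * R < δ := by
      have : Tendsto (fun k => |r k - 1| * R) atTop (𝓝 (|1 - 1| * R)) :=
        ((hr.sub_const 1).abs).mul_const R
      rw [sub_self, abs_zero, zero_mul] at this
      exact this.eventually (gt_mem_nhds hδ)
    filter_upwards [e1, e2] with k h1 h2
    refine le_trans (eLpNorm_le_of_ae_bound (C := τ) ?_) hτη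
    refine (ae_restrict_iff' hK.measurableSet).2 (Eventually.of_forall fun x hx => ?_)
    have hd : dist (r k • x + (1 - r k) • c) x < δ := by
      rw [dist_eq_norm]
      have : r k • x + (1 - r k) • c - x = (r k - 1) • (x - c) := by module
      rw [this, norm_smul, Real.norm_eq_abs]
      refine lt_of_le_of_lt ?_ h2
      gcongr
      exact hR _ ⟨x, hx, rfl⟩
    have h3 : dist (A g k x) (g (r k • x + (1 - r k) • c)) ≤ τ / 2 := by
      apply ContDiffBump.dist_normed_convolution_le hgc.aestronglyMeasurable
      intro y hy
      exact (hgδ (lt_trans hy h1)).le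
    have h4 := hgδ hd
    rw [← dist_eq_norm]
    linarith [dist_triangle (A g k x) (g (r k • x + (1 - r k) • c)) (g x)]
  have hε2 : 0 < ε / 2 := ENNReal.half_pos hε.ne'
  filter_upwards [ENNReal.tendsto_nhds_zero.1 hg0 _ hε2] with k hk
  have hsplit : (fun x => A f k x - f x) =
      (fun x => A (f - g) k x) + ((fun x => A g k x - g x) + (g - f)) := by
    ext x
    simp only [A, mollify_sub (ρ k) hfl hgl, Pi.sub_apply, Pi.add_apply]
    abel
  have hgf : AEStronglyMeasurable (g - f) (volume.restrict K) :=
    (hgL.1.sub hf.1).restrict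
  change eLpNorm (fun x => A f k x - f x) 2 (volume.restrict K) ≤ ε
  rw [hsplit]
  have b1 : eLpNorm (fun x => A (f - g) k x) 2 (volume.restrict K) ≤ 2 ^ d * (ε / 2 / M) := by
    refine (eLpNorm_mono_measure _ Measure.restrict_le_self).trans ?_
    refine (eLpNorm_comp_dilation_le (continuous_mollify (ρ k) (hfl.sub hgl)) (hr2 k) _).trans ?_
    gcongr
    exact (eLpNorm_mollify_le (ρ k) (hf.1.sub hgL.1)).trans hfg
  have b2 : eLpNorm (g - f) 2 (volume.restrict K) ≤ ε / 2 / M := by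
    refine (eLpNorm_mono_measure _ Measure.restrict_le_self).trans ?_
    rwa [eLpNorm_sub_comm]
  have m1 : AEStronglyMeasurable (fun x => A (f - g) k x) (volume.restrict K) :=
    (hAc _ k (hfl.sub hgl)).aestronglyMeasurable
  have m2 : AEStronglyMeasurable (fun x => A g k x - g x) (volume.restrict K) :=
    ((hAc g k hgl).sub hgc).aestronglyMeasurable
  -- The error `f - g` enters twice, through the operator with factor `2 ^ d` and directly with
  -- factor one; hence `M = 2 ^ d + 1`.
  calc _ ≤ eLpNorm (fun x => A (f - g) k x) 2 (volume.restrict K)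
        + (eLpNorm (fun x => A g k x - g x) 2 (volume.restrict K)
          + eLpNorm (g - f) 2 (volume.restrict K)) :=
        (eLpNorm_add_le m1 (m2.add hgf) (by norm_num)).trans
          (add_le_add le_rfl (eLpNorm_add_le m2 hgf (by norm_num)))
    _ ≤ 2 ^ d * (ε / 2 / M) + (ε / 2 + ε / 2 / M) := by gcongr
    _ = M * (ε / 2 / M) + ε / 2 := by simp only [M]; ring
    _ = ε := by rw [ENNReal.mul_div_cancel hM0 hMt, ENNReal.add_halves]

end Mollify

/-! ### Density of smooth functions in `H¹` of a convex body. -/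

section Density

variable {d : ℕ}

/-- The gradient of the mollification of a weakly differentiable function. -/
theorem hasGradientAt_mollify {U : Set (Space d)} (hU : IsOpen U)
    {w : Space d → ℝ} {Dw : Space d → Space d} (hw : MemLp w 2 (volume.restrict U))
    (hg : IsWeakGradient U w Dw) (ρ : ContDiffBump (0 : Space d)) {z : Space d}
    (hz : Metric.closedBall z ρ.rOut ⊆ U) :
    HasGradientAt (mollify ρ (U.indicator w)) (mollify ρ (U.indicator Dw) z) z := by
  have hwI : MemLp (U.indicator w) 2 volume := (memLp_indicator_iff_restrict hU.measurableSet).2 hw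
  have hwl : LocallyIntegrable (U.indicator w) volume := hwI.locallyIntegrable (by norm_num)
  have hρ1 : ContDiff ℝ 1 (ρ.normed volume) := ρ.contDiff_normed
  have h1 := ρ.hasCompactSupport_normed.hasFDerivAt_convolution_left (μ := volume)
    (ContinuousLinearMap.lsmul ℝ ℝ) hρ1 hwl z
  rw [hasGradientAt_iff_hasFDerivAt]
  refine h1.congr_fderiv ?_
  -- The derivative of the convolution falls on the kernel. The reflected kernel centred at `z` is
  -- supported in a ball inside `U`, hence is an admissible test function for the weak gradient.
  set ψ : Space d → ℝ := fun y => ρ.normed volume (z - y) with hψ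
  have hψc : ContDiff ℝ ∞ ψ := ρ.contDiff_normed.comp (contDiff_const.sub contDiff_id)
  have hts : tsupport ψ ⊆ Metric.closedBall z ρ.rOut := by
    apply closure_minimal _ Metric.isClosed_closedBall
    intro y hy
    have : z - y ∈ Function.support (ρ.normed volume) := hy
    rw [ρ.support_normed_eq, mem_ball_zero_iff] at this
    rw [Metric.mem_closedBall, dist_comm, dist_eq_norm]
    exact this.le
  have hcs : HasCompactSupport ψ :=
    (isCompact_closedBall z ρ.rOut).of_isClosed_subset (isClosed_tsupport _) hts
  have hweak := hg ψ hψc hcs (hts.trans hz)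
  have hgψ : ∀ y, HasGradientAt ψ (-gradient (ρ.normed volume) (z - y)) y := by
    intro y
    rw [hasGradientAt_iff_hasFDerivAt]
    have h2 : HasFDerivAt (ρ.normed volume) (fderiv ℝ (ρ.normed volume) (z - y)) (z - y) :=
      (hρ1.differentiable one_ne_zero).differentiableAt.hasFDerivAt
    have h3 := h2.comp y ((hasFDerivAt_id y).const_sub z)
    refine h3.congr_fderiv ?_
    ext v
    simp [gradient]
  have hcont : Continuous (gradient ψ) := (hψc.of_le (by simp)).continuous_gradient
  have hgs : HasCompactSupport (gradient ψ) := by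
    have := hcs.fderiv (𝕜 := ℝ)
    exact this.comp_left (g := (InnerProductSpace.toDual ℝ (Space d)).symm) (map_zero _)
  have hint : Integrable (fun y => U.indicator w y • gradient ψ y) volume :=
    hwl.integrable_smul_right_of_hasCompactSupport hcont hgs
  ext v
  have hρf : Continuous (fderiv ℝ (ρ.normed (volume : Measure (Space d)))) :=
    hρ1.continuous_fderiv one_ne_zero
  have hex : ConvolutionExistsAt (fderiv ℝ (ρ.normed volume)) (U.indicator w) z
      ((ContinuousLinearMap.lsmul ℝ ℝ).precompL (Space d)) volume :=
    (ρ.hasCompactSupport_normed.fderiv (𝕜 := ℝ)).convolutionExists_left _ hρf hwl z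
  have h4 : (convolution (fderiv ℝ (ρ.normed volume)) (U.indicator w)
      ((ContinuousLinearMap.lsmul ℝ ℝ).precompL (Space d)) volume z) v
      = ∫ s, fderiv ℝ (ρ.normed volume) s v * U.indicator w (z - s) := by
    rw [convolution, ContinuousLinearMap.integral_apply hex]
    rfl
  rw [h4, ← integral_sub_left_eq_self _ volume z]
  have h5 : ∀ y, fderiv ℝ (ρ.normed volume) (z - y) v * U.indicator w (z - (z - y))
      = - inner ℝ v (U.indicator w y • gradient ψ y) := by
    intro y
    rw [sub_sub_cancel, (hgψ y).gradient, inner_smul_right, inner_neg_right, real_inner_comm]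
    have : inner ℝ (gradient (ρ.normed volume) (z - y)) v = fderiv ℝ (ρ.normed volume) (z - y) v := by
      simp [gradient]
    rw [this]; ring
  simp_rw [h5]
  rw [integral_neg, integral_inner hint]
  have h6 : ∫ y, U.indicator w y • gradient ψ y = ∫ y in U, w y • gradient ψ y := by
    rw [← integral_indicator hU.measurableSet]
    congr 1; ext1 y
    by_cases hy : y ∈ U <;> simp [hy]
  have h7 : mollify ρ (U.indicator Dw) z = ∫ y in U, ψ y • Dw y := by
    rw [mollify_apply, ← integral_sub_left_eq_self _ volume z, ← integral_indicator hU.measurableSet]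
    congr 1; ext1 y
    rw [sub_sub_cancel]
    by_cases hy : y ∈ U <;> simp [hy, hψ]
  rw [h6, hweak, h7, inner_neg_right, neg_neg, real_inner_comm]
  rfl

theorem contDiff_mollify (ρ : ContDiffBump (0 : Space d)) {f : Space d → ℝ}
    (hf : LocallyIntegrable f) : ContDiff ℝ ∞ (mollify ρ f) :=
  ρ.hasCompactSupport_normed.contDiff_convolution_left _ ρ.contDiff_normed hf

theorem eLpNorm_smul_sub_smul_le {α E : Type*} [MeasurableSpace α] {μ : Measure α}
    [NormedAddCommGroup E] [NormedSpace ℝ E] {f g : α → E} (hf : AEStronglyMeasurable f μ)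
    (hg : AEStronglyMeasurable g μ) {t : ℝ} (h0 : 0 ≤ t) (h1 : t ≤ 1) :
    eLpNorm (t • f - (1 - t) • g) 2 μ
      ≤ eLpNorm f 2 μ + ENNReal.ofReal (1 - t) * eLpNorm g 2 μ := by
  refine (eLpNorm_sub_le (hf.const_smul t) (hg.const_smul _) (by norm_num)).trans ?_
  refine add_le_add ?_ ?_
  · refine eLpNorm_const_smul_le.trans (mul_le_of_le_one_left' ?_)
    rw [Real.enorm_of_nonneg h0]
    exact ENNReal.ofReal_le_one.2 h1
  · refine eLpNorm_const_smul_le.trans ?_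
    rw [Real.enorm_of_nonneg (by linarith)]

/-- Density of smooth functions in `H¹` of a convex body. -/
theorem Convex.exists_smooth_approx {K : Set (Space d)} (hK : IsCompact K) (hKc : Convex ℝ K)
    (hne : (interior K).Nonempty) {w : Space d → ℝ} {Dw : Space d → Space d}
    (hw : MemLp w 2 (volume.restrict K)) (hDw : MemLp Dw 2 (volume.restrict K))
    (hg : IsWeakGradient (interior K) w Dw) :
    ∃ φ : ℕ → Space d → ℝ, (∀ n, ContDiff ℝ ∞ (φ n)) ∧
      Tendsto (fun n => eLpNorm (fun x => φ n x - w x) 2 (volume.restrict K)) atTop (𝓝 0) ∧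
      Tendsto (fun n => eLpNorm (fun x => gradient (φ n) x - Dw x) 2 (volume.restrict K))
        atTop (𝓝 0) := by
  obtain ⟨c, hc⟩ := hne
  set U := interior K
  have hU : IsOpen U := isOpen_interior
  obtain ⟨r, hr, hrU⟩ := Metric.nhds_basis_closedBall.mem_iff.1 (hU.mem_nhds hc)
  have hle : volume.restrict U ≤ volume.restrict K := Measure.restrict_mono interior_subset le_rfl
  have hwU := hw.mono_measure hle
  have hDwU := hDw.mono_measure hle
  have hwI : MemLp (U.indicator w) 2 volume := (memLp_indicator_iff_restrict hU.measurableSet).2 hwU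
  have hDwI : MemLp (U.indicator Dw) 2 volume :=
    (memLp_indicator_iff_restrict hU.measurableSet).2 hDwU
  have hwl : LocallyIntegrable (U.indicator w) volume := hwI.locallyIntegrable (by norm_num)
  set t : ℕ → ℝ := fun k => 1 - 1 / ((k : ℝ) + 1 + 1)
  have ht1 : ∀ k, 0 < 1 - t k := fun k => by simp only [t]; rw [sub_sub_cancel]; positivity
  have ht2 : ∀ k, 1 / 2 ≤ t k := fun k => by
    simp only [t]
    have : 1 / ((k : ℝ) + 1 + 1) ≤ 1 / 2 := by
      apply one_div_le_one_div_of_le (by norm_num)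
      have : (0 : ℝ) ≤ k := by positivity
      linarith
    linarith
  have htt : Tendsto t atTop (𝓝 1) := by
    have h := (tendsto_one_div_add_atTop_nhds_zero_nat (𝕜 := ℝ)).comp (tendsto_add_atTop_nat 1)
    have h2 := h.const_sub 1
    rw [sub_zero] at h2
    refine h2.congr fun k => ?_
    simp [t]
  let ρ : ℕ → ContDiffBump (0 : Space d) := fun k =>
    { rIn := (1 - t k) * r / 2, rOut := (1 - t k) * r
      rIn_pos := by have := ht1 k; positivity
      rIn_lt_rOut := by have := mul_pos (ht1 k) hr; linarith }
  have hρ : Tendsto (fun k => (ρ k).rOut) atTop (𝓝 0) := by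
    have := (htt.const_sub 1).mul_const r
    simpa [ρ] using this
  set T : ℕ → Space d → Space d := fun k x => t k • x + (1 - t k) • c
  -- By convexity, contraction towards `c` with ratio `t k` moves `x` so far inside that the ball of
  -- radius `(1 - t k) r` around the image lies in the interior. So the mollified extension by zero
  -- sees only the values of `w` in `U`.
  have hball : ∀ k, ∀ x ∈ K, Metric.closedBall (T k x) (ρ k).rOut ⊆ U := by
    intro k x hx y hy
    rw [Metric.mem_closedBall, dist_eq_norm] at hy
    have h0 := ht1 k
    have hy2 : c + (1 - t k)⁻¹ • (y - T k x) ∈ U := by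
      apply hrU
      rw [Metric.mem_closedBall, dist_eq_norm, add_sub_cancel_left, norm_smul, norm_inv,
        Real.norm_of_nonneg h0.le, inv_mul_le_iff₀ h0]
      exact hy
    have h3 := hKc.combo_self_interior_mem_interior hx hy2 (a := t k) (b := 1 - t k)
      (by linarith [ht2 k]) h0 (by ring)
    convert h3 using 1
    rw [smul_add, smul_inv_smul₀ h0.ne']
    simp only [T]; abel
  have hgrad : ∀ k, ∀ x ∈ K, gradient (fun x => mollify (ρ k) (U.indicator w) (T k x)) x
      = t k • mollify (ρ k) (U.indicator Dw) (T k x) := by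
    intro k x hx
    have h1 := hasGradientAt_mollify hU hwU hg (ρ k) (hball k x hx)
    rw [hasGradientAt_iff_hasFDerivAt] at h1
    have h2 : HasFDerivAt (T k) (t k • ContinuousLinearMap.id ℝ (Space d)) x :=
      ((hasFDerivAt_id x).const_smul (t k)).add_const _
    refine HasGradientAt.gradient ?_
    rw [hasGradientAt_iff_hasFDerivAt]
    refine (h1.comp x h2).congr_fderiv ?_
    ext v
    simp
  have hres : ∀ {F : Type} [NormedAddCommGroup F] (f : Space d → F),
      U.indicator f =ᵐ[volume.restrict K] f := by
    intro F _ f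
    have hfr : volume (frontier K) = 0 := hKc.addHaar_frontier volume
    have h1 : ∀ᵐ x ∂(volume.restrict K), x ∉ frontier K :=
      ae_restrict_of_ae (measure_eq_zero_iff_ae_notMem.1 hfr)
    filter_upwards [h1, ae_restrict_mem hK.measurableSet] with x h2 h3
    have : x ∈ U := by
      by_contra h
      exact h2 ⟨subset_closure h3, h⟩
    simp [this]
  refine ⟨fun k x => mollify (ρ k) (U.indicator w) (T k x), fun k => ?_, ?_, ?_⟩
  · exact (contDiff_mollify (ρ k) hwl).comp ((contDiff_id.const_smul (t k)).add contDiff_const)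
  · have h := tendsto_mollify_dilation (c := c) hK hwI hρ htt ht2
    refine h.congr fun k => eLpNorm_congr_ae ?_
    filter_upwards [hres w] with x hx
    simp only [hx, T]
  · have h := tendsto_mollify_dilation (c := c) hK hDwI hρ htt ht2
    have hDl : LocallyIntegrable (U.indicator Dw) volume := hDwI.locallyIntegrable (by norm_num)
    have hb : ∀ k, eLpNorm (fun x => gradient (fun x => mollify (ρ k) (U.indicator w) (T k x)) x
        - Dw x) 2 (volume.restrict K) ≤
        eLpNorm (fun x => mollify (ρ k) (U.indicator Dw) (T k x) - U.indicator Dw x) 2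
          (volume.restrict K) + ENNReal.ofReal (1 - t k) * eLpNorm Dw 2 (volume.restrict K) := by
      intro k
      -- The chain rule contributes a factor `t k`; it is split off as `(1 - t k) • Dw`, which tends
      -- to zero.
      have e1 : (fun x => gradient (fun x => mollify (ρ k) (U.indicator w) (T k x)) x - Dw x)
          =ᵐ[volume.restrict K]
          t k • (fun x => mollify (ρ k) (U.indicator Dw) (T k x) - U.indicator Dw x)
            - (1 - t k) • Dw := by
        filter_upwards [hres Dw, ae_restrict_mem hK.measurableSet] with x h1 h2
        rw [hgrad k x h2, Pi.sub_apply, Pi.smul_apply, h1, Pi.smul_apply]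
        module
      have hm : AEStronglyMeasurable (fun x => mollify (ρ k) (U.indicator Dw) (T k x)
          - U.indicator Dw x) (volume.restrict K) := by
        refine AEStronglyMeasurable.sub ?_ hDwI.1.restrict
        exact ((continuous_mollify (ρ k) hDl).comp (by simp only [T]; fun_prop)).aestronglyMeasurable
      rw [eLpNorm_congr_ae e1]
      exact eLpNorm_smul_sub_smul_le hm hDw.1 (by linarith [ht2 k]) (by linarith [ht1 k])
    refine tendsto_of_tendsto_of_tendsto_of_le_of_le tendsto_const_nhds ?_ (fun _ => zero_le) hb
    have h8 : Tendsto (fun k => ENNReal.ofReal (1 - t k) * eLpNorm Dw 2 (volume.restrict K)) atTop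
        (𝓝 0) := by
      have h9 : Tendsto (fun k => ENNReal.ofReal (1 - t k)) atTop (𝓝 0) := by
        have := ENNReal.tendsto_ofReal (htt.const_sub 1)
        simpa using this
      simpa using ENNReal.Tendsto.mul_const h9 (Or.inr hDw.2.ne)
    simpa using h.add h8

end Density

/-! ### Limits of `L²` norms and pairings. -/

section LpTwo

variable {α E : Type*} [MeasurableSpace α] {μ : Measure α} [NormedAddCommGroup E]

theorem MeasureTheory.MemLp.integrable_fun_mul {f g : α → ℝ} (hf : MemLp f 2 μ) (hg : MemLp g 2 μ) :
    Integrable (fun x => f x * g x) μ := hf.integrable_mul hg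

theorem MeasureTheory.MemLp.norm_toLp_two {f : α → E} (hf : MemLp f 2 μ) :
    ‖hf.toLp f‖ = √(∫ x, ‖f x‖ ^ 2 ∂μ) := by
  rw [Lp.norm_toLp, eq_comm, Real.sqrt_eq_iff_mul_self_eq
    (integral_nonneg fun x => sq_nonneg _) ENNReal.toReal_nonneg, ← sq, ← ENNReal.toReal_pow,
    eLpNorm_two_sq, integral_eq_lintegral_of_nonneg_ae (Eventually.of_forall fun x => sq_nonneg _)
      (hf.1.norm.pow 2)]
  congr 2
  ext x
  rw [ENNReal.ofReal_pow (norm_nonneg _), ofReal_norm]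

theorem tendsto_sqrt_integral_norm_sq {f : ℕ → α → E} {g : α → E} (hf : ∀ n, MemLp (f n) 2 μ)
    (hg : MemLp g 2 μ) (h : Tendsto (fun n => eLpNorm (fun x => f n x - g x) 2 μ) atTop (𝓝 0)) :
    Tendsto (fun n => √(∫ x, ‖f n x‖ ^ 2 ∂μ)) atTop (𝓝 √(∫ x, ‖g x‖ ^ 2 ∂μ)) := by
  have := ((Lp.tendsto_Lp_iff_tendsto_eLpNorm'' f hf g hg).2 h).norm
  simpa only [MemLp.norm_toLp_two] using this

theorem MeasureTheory.MemLp.ae_eq_zero_of_sqrt_integral_le {f : α → E} (hf : MemLp f 2 μ)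
    (h : √(∫ x, ‖f x‖ ^ 2 ∂μ) ≤ 0) : f =ᵐ[μ] 0 := by
  rw [← MemLp.norm_toLp_two hf, norm_le_zero_iff, Lp.eq_zero_iff_ae_eq_zero] at h
  exact hf.coeFn_toLp.symm.trans h

theorem tendsto_sqrt_integral_norm_sq_zero {f : ℕ → α → E} {g : α → E}
    (hf : ∀ n, MemLp (f n) 2 μ) (hg : g =ᵐ[μ] 0)
    (h : Tendsto (fun n => eLpNorm (fun x => f n x - g x) 2 μ) atTop (𝓝 0)) :
    Tendsto (fun n => √(∫ x, ‖f n x‖ ^ 2 ∂μ)) atTop (𝓝 0) := by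
  have hg0 : MemLp g 2 μ := MemLp.zero.ae_eq hg.symm
  have h1 := tendsto_sqrt_integral_norm_sq hf hg0 h
  have h2 : ∫ x, ‖g x‖ ^ 2 ∂μ = 0 := by
    rw [integral_eq_zero_of_ae]
    filter_upwards [hg] with x hx
    simp [hx]
  rwa [h2, Real.sqrt_zero] at h1

theorem tendsto_integral_mul {f : ℕ → α → ℝ} {g r : α → ℝ} (hr : MemLp r 2 μ)
    (hf : ∀ n, MemLp (f n) 2 μ) (hg : MemLp g 2 μ)
    (h : Tendsto (fun n => eLpNorm (fun x => f n x - g x) 2 μ) atTop (𝓝 0)) :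
    Tendsto (fun n => ∫ x, r x * f n x ∂μ) atTop (𝓝 (∫ x, r x * g x ∂μ)) := by
  rw [tendsto_iff_dist_tendsto_zero]
  have h1 := (Lp.tendsto_Lp_iff_tendsto_eLpNorm'' f hf g hg).2 h
  rw [tendsto_iff_norm_sub_tendsto_zero] at h1
  have h2 := h1.const_mul √(∫ x, r x ^ 2 ∂μ)
  rw [mul_zero] at h2
  refine squeeze_zero (fun _ => dist_nonneg) (fun n => ?_) h2
  rw [← MemLp.toLp_sub (hf n) hg, MemLp.norm_toLp_two, Real.dist_eq,
    ← integral_sub (hr.integrable_fun_mul (hf n)) (hr.integrable_fun_mul hg)]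
  have := abs_integral_mul_le_sqrt hr ((hf n).sub hg)
  simpa only [Pi.sub_apply, mul_sub, Real.norm_eq_abs, sq_abs] using this

theorem tendsto_eLpNorm_sub_sub {f f' : ℕ → α → E} {g g' : α → E} (hf : ∀ n, MemLp (f n) 2 μ)
    (hf' : ∀ n, MemLp (f' n) 2 μ) (hg : MemLp g 2 μ) (hg' : MemLp g' 2 μ)
    (h : Tendsto (fun n => eLpNorm (fun x => f n x - g x) 2 μ) atTop (𝓝 0))
    (h' : Tendsto (fun n => eLpNorm (fun x => f' n x - g' x) 2 μ) atTop (𝓝 0)) :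
    Tendsto (fun n => eLpNorm (fun x => (f n x - f' n x) - (g x - g' x)) 2 μ) atTop (𝓝 0) := by
  have h1 := (Lp.tendsto_Lp_iff_tendsto_eLpNorm'' f hf g hg).2 h
  have h2 := (Lp.tendsto_Lp_iff_tendsto_eLpNorm'' f' hf' g' hg').2 h'
  have h3 := h1.sub h2
  simp only [← MemLp.toLp_sub] at h3
  exact (Lp.tendsto_Lp_iff_tendsto_eLpNorm'' (fun n => f n - f' n) (fun n => (hf n).sub (hf' n))
    (g - g') (hg.sub hg')).1 h3

end LpTwo

/-! ### Traces on one simplex. -/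

section LocalTrace

variable {n : ℕ} {K : Finset (Space (n + 1))}

theorem memLp_facetMeasure (hcard : K.card = n + 1 + 1)
    (hai : AffineIndependent ℝ ((↑) : K → Space (n + 1))) {a : Space (n + 1)} (ha : a ∈ K)
    {φ : Space (n + 1) → ℝ} (hφ : Continuous φ) : MemLp φ 2 (facetMeasure (K.erase a)) := by
  have := isFiniteMeasure_facetMeasure hcard hai ha
  obtain ⟨C, hC⟩ := (isCompact_cell (K.erase a)).exists_bound_of_continuousOn hφ.continuousOn
  refine MemLp.of_bound hφ.aestronglyMeasurable C ?_
  exact (ae_restrict_iff' (isCompact_cell _).measurableSet).2 (Eventually.of_forall hC)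

theorem gradient_sub_of_contDiff {φ ψ : Space n → ℝ} (hφ : ContDiff ℝ ∞ φ) (hψ : ContDiff ℝ ∞ ψ) :
    gradient (fun x => φ x - ψ x) = fun x => gradient φ x - gradient ψ x := by
  ext1 x
  have h1 := (hφ.differentiable (by simp)).differentiableAt (x := x)
  have h2 := (hψ.differentiable (by simp)).differentiableAt (x := x)
  simp only [gradient]
  rw [fderiv_fun_sub h1 h2, map_sub]

theorem continuous_gradient_of_contDiff {φ : Space n → ℝ} (hφ : ContDiff ℝ ∞ φ) :
    Continuous (gradient φ) := (hφ.of_le (by simp)).continuous_gradient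

/-- Approximating sequences may be subtracted; this reduces uniqueness of traces to the zero
function. -/
theorem IsTraceFrom.sub (hcard : K.card = n + 1 + 1)
    (hai : AffineIndependent ℝ ((↑) : K → Space (n + 1))) {a : Space (n + 1)} (ha : a ∈ K)
    {w w' : Space (n + 1) → ℝ} {Dw Dw' : Space (n + 1) → Space (n + 1)} {T T' : Space (n + 1) → ℝ}
    (hw : MemLp w 2 (elementMeasure K)) (hDw : MemLp Dw 2 (elementMeasure K))
    (hw' : MemLp w' 2 (elementMeasure K)) (hDw' : MemLp Dw' 2 (elementMeasure K))
    (h : IsTraceFrom K (K.erase a) w Dw T) (h' : IsTraceFrom K (K.erase a) w' Dw' T') :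
    IsTraceFrom K (K.erase a) (fun x => w x - w' x) (fun x => Dw x - Dw' x)
      (fun x => T x - T' x) := by
  obtain ⟨hT, φ, hφ, h1, h2, h3⟩ := h
  obtain ⟨hT', ψ, hψ, h1', h2', h3'⟩ := h'
  refine ⟨hT.sub hT', fun n x => φ n x - ψ n x, fun n => (hφ n).sub (hψ n), ?_, ?_, ?_⟩
  · exact tendsto_eLpNorm_sub_sub (fun n => memLp_cell (hφ n).continuous)
      (fun n => memLp_cell (hψ n).continuous) hw hw' h1 h1'
  · simp only [gradient_sub_of_contDiff (hφ _) (hψ _)]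
    exact tendsto_eLpNorm_sub_sub (fun n => memLp_cell (continuous_gradient_of_contDiff (hφ n)))
      (fun n => memLp_cell (continuous_gradient_of_contDiff (hψ n))) hDw hDw' h2 h2'
  · exact tendsto_eLpNorm_sub_sub (fun n => memLp_facetMeasure hcard hai ha (hφ n).continuous)
      (fun n => memLp_facetMeasure hcard hai ha (hψ n).continuous) hT hT' h3 h3'

/-- The trace inequality, as an inequality of norms. -/
theorem exists_trace_bound_sqrt (hcard : K.card = n + 1 + 1)
    (hai : AffineIndependent ℝ ((↑) : K → Space (n + 1))) {a : Space (n + 1)} (ha : a ∈ K) :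
    ∃ C : ℝ, 0 ≤ C ∧ ∀ φ : Space (n + 1) → ℝ, ContDiff ℝ 1 φ →
      √(∫ y, ‖φ y‖ ^ 2 ∂(facetMeasure (K.erase a))) ≤
        C * (√(∫ x, ‖φ x‖ ^ 2 ∂(elementMeasure K))
          + √(∫ x, ‖gradient φ x‖ ^ 2 ∂(elementMeasure K))) := by
  obtain ⟨C, hC, h⟩ := exists_trace_bound hcard hai ha
  refine ⟨√C, Real.sqrt_nonneg _, fun φ hφ => ?_⟩
  simp only [Real.norm_eq_abs, sq_abs]
  have h1 : 0 ≤ ∫ x, φ x ^ 2 ∂(elementMeasure K) := integral_nonneg fun x => sq_nonneg _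
  have h2 : 0 ≤ ∫ x, ‖gradient φ x‖ ^ 2 ∂(elementMeasure K) := integral_nonneg fun x => sq_nonneg _
  calc √(∫ y, φ y ^ 2 ∂(facetMeasure (K.erase a)))
      ≤ √(C * ((∫ x, φ x ^ 2 ∂(elementMeasure K))
        + ∫ x, ‖gradient φ x‖ ^ 2 ∂(elementMeasure K))) := Real.sqrt_le_sqrt (h φ hφ)
    _ = √C * √((∫ x, φ x ^ 2 ∂(elementMeasure K))
        + ∫ x, ‖gradient φ x‖ ^ 2 ∂(elementMeasure K)) := Real.sqrt_mul hC _
    _ ≤ _ := by 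
        refine mul_le_mul_of_nonneg_left (Real.sqrt_le_iff.2 ⟨by positivity, ?_⟩) (Real.sqrt_nonneg _)
        rw [add_sq, Real.sq_sqrt h1, Real.sq_sqrt h2]
        have := mul_nonneg (Real.sqrt_nonneg (∫ x, φ x ^ 2 ∂(elementMeasure K)))
          (Real.sqrt_nonneg (∫ x, ‖gradient φ x‖ ^ 2 ∂(elementMeasure K)))
        linarith

/-- The trace of a function which vanishes vanishes. -/
theorem IsTraceFrom.ae_eq_zero (hcard : K.card = n + 1 + 1)
    (hai : AffineIndependent ℝ ((↑) : K → Space (n + 1))) {a : Space (n + 1)} (ha : a ∈ K)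
    {w : Space (n + 1) → ℝ} {Dw : Space (n + 1) → Space (n + 1)} {T : Space (n + 1) → ℝ}
    (hw : w =ᵐ[elementMeasure K] 0) (hDw : Dw =ᵐ[elementMeasure K] 0)
    (h : IsTraceFrom K (K.erase a) w Dw T) : T =ᵐ[facetMeasure (K.erase a)] 0 := by
  obtain ⟨hT, φ, hφ, h1, h2, h3⟩ := h
  have t1 := tendsto_sqrt_integral_norm_sq_zero (fun n => memLp_cell (hφ n).continuous) hw h1
  have t2 := tendsto_sqrt_integral_norm_sq_zero
    (fun n => memLp_cell (continuous_gradient_of_contDiff (hφ n))) hDw h2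
  have t3 := tendsto_sqrt_integral_norm_sq
    (fun n => memLp_facetMeasure hcard hai ha (hφ n).continuous) hT h3
  obtain ⟨C, -, hC⟩ := exists_trace_bound_sqrt hcard hai ha
  -- The trace inequality, passed to the limit along the approximating sequence, bounds the norm of
  -- `T` by zero.
  have h4 := le_of_tendsto_of_tendsto' t3 ((t1.add t2).const_mul C)
    fun n => hC _ ((hφ n).of_le (by simp))
  rw [add_zero, mul_zero] at h4
  exact hT.ae_eq_zero_of_sqrt_integral_le h4

/-- Allowing the functions and gradients to agree only almost everywhere makes it possible to
compare a Sobolev function with a polynomial representative. -/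
theorem IsTraceFrom.ae_eq (hcard : K.card = n + 1 + 1)
    (hai : AffineIndependent ℝ ((↑) : K → Space (n + 1))) {a : Space (n + 1)} (ha : a ∈ K)
    {w w' : Space (n + 1) → ℝ} {Dw Dw' : Space (n + 1) → Space (n + 1)} {T T' : Space (n + 1) → ℝ}
    (hw : MemLp w 2 (elementMeasure K)) (hDw : MemLp Dw 2 (elementMeasure K))
    (hw' : w' =ᵐ[elementMeasure K] w) (hDw' : Dw' =ᵐ[elementMeasure K] Dw)
    (h : IsTraceFrom K (K.erase a) w Dw T) (h' : IsTraceFrom K (K.erase a) w' Dw' T') :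
    T =ᵐ[facetMeasure (K.erase a)] T' := by
  have h1 := h.sub hcard hai ha hw hDw (hw.ae_eq hw'.symm) (hDw.ae_eq hDw'.symm) h'
  have h2 := h1.ae_eq_zero hcard hai ha (by filter_upwards [hw'] with x hx; simp [hx])
    (by filter_upwards [hDw'] with x hx; simp [hx])
  filter_upwards [h2] with x hx
  simpa [sub_eq_zero] using hx

theorem isTraceFrom_of_contDiff (hcard : K.card = n + 1 + 1)
    (hai : AffineIndependent ℝ ((↑) : K → Space (n + 1))) {a : Space (n + 1)} (ha : a ∈ K)
    {φ : Space (n + 1) → ℝ} (hφ : ContDiff ℝ ∞ φ) :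
    IsTraceFrom K (K.erase a) φ (gradient φ) φ :=
  ⟨memLp_facetMeasure hcard hai ha hφ.continuous, fun _ => φ, fun _ => hφ, by simp, by simp,
    by simp⟩

/-- Existence of traces. -/
theorem exists_isTraceFrom (hcard : K.card = n + 1 + 1)
    (hai : AffineIndependent ℝ ((↑) : K → Space (n + 1))) {a : Space (n + 1)} (ha : a ∈ K)
    {w : Space (n + 1) → ℝ} {Dw : Space (n + 1) → Space (n + 1)}
    (hw : MemLp w 2 (elementMeasure K)) (hDw : MemLp Dw 2 (elementMeasure K))
    (hg : IsWeakGradient (interior (cell K)) w Dw) :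
    ∃ T, IsTraceFrom K (K.erase a) w Dw T := by
  obtain ⟨φ, hφ, h1, h2⟩ := (convex_cell K).exists_smooth_approx (isCompact_cell K)
    (interior_cell_nonempty hcard hai) hw hDw hg
  have m1 : ∀ k, MemLp (φ k) 2 (elementMeasure K) := fun k => memLp_cell (hφ k).continuous
  have m2 : ∀ k, MemLp (gradient (φ k)) 2 (elementMeasure K) := fun k =>
    memLp_cell (continuous_gradient_of_contDiff (hφ k))
  have m3 : ∀ k, MemLp (φ k) 2 (facetMeasure (K.erase a)) := fun k =>
    memLp_facetMeasure hcard hai ha (hφ k).continuous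
  have c1 := ((Lp.tendsto_Lp_iff_tendsto_eLpNorm'' φ m1 w hw).2 h1).cauchySeq
  have c2 := ((Lp.tendsto_Lp_iff_tendsto_eLpNorm'' _ m2 Dw hDw).2 h2).cauchySeq
  rw [cauchySeq_iff_tendsto_dist_atTop_0] at c1 c2
  obtain ⟨C, -, hC⟩ := exists_trace_bound_sqrt hcard hai ha
  -- The trace inequality for differences turns a Cauchy sequence in `H¹(K)` into one in `L²` of the
  -- facet.
  have c3 : CauchySeq fun k => (m3 k).toLp (φ k) := by
    rw [cauchySeq_iff_tendsto_dist_atTop_0]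
    have h4 := (c1.add c2).const_mul C
    rw [add_zero, mul_zero] at h4
    refine squeeze_zero (fun _ => dist_nonneg) (fun p => ?_) h4
    rw [dist_eq_norm, dist_eq_norm, dist_eq_norm, ← MemLp.toLp_sub, ← MemLp.toLp_sub,
      ← MemLp.toLp_sub, MemLp.norm_toLp_two, MemLp.norm_toLp_two, MemLp.norm_toLp_two]
    have h5 := hC (fun x => φ p.1 x - φ p.2 x) (((hφ _).sub (hφ _)).of_le (by simp))
    rw [gradient_sub_of_contDiff (hφ _) (hφ _)] at h5
    exact h5
  obtain ⟨T, hT⟩ := cauchySeq_tendsto_of_complete c3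
  refine ⟨T, Lp.memLp T, φ, hφ, h1, h2, ?_⟩
  rw [← Lp.toLp_coeFn T (Lp.memLp T)] at hT
  exact (Lp.tendsto_Lp_iff_tendsto_eLpNorm'' φ m3 T (Lp.memLp T)).1 hT

/-- The Poincaré and trace inequalities in weak form. -/
theorem abs_integral_mul_le_constC1 (hcard : K.card = n + 1 + 1)
    (hai : AffineIndependent ℝ ((↑) : K → Space (n + 1)))
    {w : Space (n + 1) → ℝ} {Dw : Space (n + 1) → Space (n + 1)}
    (hw : MemLp w 2 (elementMeasure K)) (hDw : MemLp Dw 2 (elementMeasure K))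
    (hg : IsWeakGradient (interior (cell K)) w Dw) {r : Space (n + 1) → ℝ}
    (hr : MemLp r 2 (elementMeasure K)) (hr0 : ∫ x, r x ∂(elementMeasure K) = 0) :
    |∫ x, r x * w x ∂(elementMeasure K)| ≤
      normL2 (elementMeasure K) r * (constC1 K * √(∫ x, ‖Dw x‖ ^ 2 ∂(elementMeasure K))) := by
  obtain ⟨φ, hφ, h1, h2⟩ := (convex_cell K).exists_smooth_approx (isCompact_cell K)
    (interior_cell_nonempty hcard hai) hw hDw hg
  have m1 : ∀ k, MemLp (φ k) 2 (elementMeasure K) := fun k => memLp_cell (hφ k).continuous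
  have m2 : ∀ k, MemLp (gradient (φ k)) 2 (elementMeasure K) := fun k =>
    memLp_cell (continuous_gradient_of_contDiff (hφ k))
  have t1 := (tendsto_integral_mul hr m1 hw h1).abs
  have t2 := tendsto_sqrt_integral_norm_sq m2 hDw h2
  refine le_of_tendsto_of_tendsto' t1 ((t2.const_mul (constC1 K)).const_mul _) fun k => ?_
  -- As `r` has mean zero, `φ k` may be replaced by `φ k - m`, to which the mean-zero inequality
  -- applies.
  obtain ⟨m, hm⟩ := exists_mean hcard hai (hφ k).continuous
  have h3 := (trace_le_constC2 hcard hai (((hφ k).sub contDiff_const).of_le (by simp)) hm).1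
  simp only [gradient_sub_const] at h3
  have hμ : IsFiniteMeasure (elementMeasure K) :=
    ⟨by simpa [elementMeasure] using (isCompact_cell K).measure_lt_top⟩
  have h4 : ∫ x, r x * φ k x ∂(elementMeasure K) = ∫ x, r x * (φ k x - m) ∂(elementMeasure K) := by
    simp only [mul_sub]
    rw [integral_sub (hr.integrable_fun_mul (m1 k)) ((hr.integrable (by norm_num)).mul_const m),
      integral_mul_const, hr0, zero_mul, sub_zero]
  rw [h4]
  refine (abs_integral_mul_le_sqrt hr ((m1 k).sub (memLp_const m))).trans ?_
  exact mul_le_mul_of_nonneg_left h3 (Real.sqrt_nonneg _)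

theorem abs_integral_mul_le_constC2 (hcard : K.card = n + 1 + 1)
    (hai : AffineIndependent ℝ ((↑) : K → Space (n + 1))) {a : Space (n + 1)} (ha : a ∈ K)
    {w : Space (n + 1) → ℝ} {Dw : Space (n + 1) → Space (n + 1)} {T : Space (n + 1) → ℝ}
    (hDw : MemLp Dw 2 (elementMeasure K)) (hT : IsTraceFrom K (K.erase a) w Dw T)
    {r : Space (n + 1) → ℝ} (hr : MemLp r 2 (facetMeasure (K.erase a)))
    (hr0 : ∫ x, r x ∂(facetMeasure (K.erase a)) = 0) :
    |∫ x, r x * T x ∂(facetMeasure (K.erase a))| ≤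
      normL2 (facetMeasure (K.erase a)) r *
        (constC2 K (K.erase a) a * √(∫ x, ‖Dw x‖ ^ 2 ∂(elementMeasure K))) := by
  obtain ⟨hT, φ, hφ, h1, h2, h3⟩ := hT
  have m1 : ∀ k, MemLp (φ k) 2 (facetMeasure (K.erase a)) := fun k =>
    memLp_facetMeasure hcard hai ha (hφ k).continuous
  have m2 : ∀ k, MemLp (gradient (φ k)) 2 (elementMeasure K) := fun k =>
    memLp_cell (continuous_gradient_of_contDiff (hφ k))
  have t1 := (tendsto_integral_mul hr m1 hT h3).abs
  have t2 := tendsto_sqrt_integral_norm_sq m2 hDw h2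
  refine le_of_tendsto_of_tendsto' t1 ((t2.const_mul (constC2 K (K.erase a) a)).const_mul _)
    fun k => ?_
  -- The constant is the mean over the element, as the inequality with `C₂` requires, whereas it may
  -- be subtracted because `r` has mean zero over the facet.
  obtain ⟨m, hm⟩ := exists_mean hcard hai (hφ k).continuous
  have h3 := (trace_le_constC2 hcard hai (((hφ k).sub contDiff_const).of_le (by simp)) hm).2 a ha
  simp only [gradient_sub_const] at h3
  have hμ := isFiniteMeasure_facetMeasure hcard hai ha
  have h4 : ∫ x, r x * φ k x ∂(facetMeasure (K.erase a))
      = ∫ x, r x * (φ k x - m) ∂(facetMeasure (K.erase a)) := by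
    simp only [mul_sub]
    rw [integral_sub (hr.integrable_fun_mul (m1 k)) ((hr.integrable (by norm_num)).mul_const m),
      integral_mul_const, hr0, zero_mul, sub_zero]
  rw [h4]
  refine (abs_integral_mul_le_sqrt hr ((m1 k).sub (memLp_const m))).trans ?_
  exact mul_le_mul_of_nonneg_left h3 (Real.sqrt_nonneg _)

end LocalTrace

/-! ### Decomposition over the mesh and its boundary facets. -/

section Mesh

variable {n : ℕ} {Ω : Set (Space (n + 1))} (M : SimplicialMesh Ω)

namespace SimplicialMesh

theorem isOpen (M : SimplicialMesh Ω) : IsOpen Ω := M.interior_eq ▸ isOpen_interior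

variable {M}

theorem interior_cell_subset {K : Finset (Space (n + 1))} (hK : K ∈ M.elements) :
    interior (cell K) ⊆ Ω := by
  rw [← M.interior_eq]
  exact interior_mono (Set.subset_biUnion_of_mem hK)

/-- Two distinct elements have equally many vertices, so some vertex of `K` is not in `L`. By
conformity the intersection then lies in the opposite facet of `K`, inside a hyperplane. -/
theorem volume_cell_inter {K L : Finset (Space (n + 1))} (hK : K ∈ M.elements)
    (hL : L ∈ M.elements) (hKL : K ≠ L) : volume (cell K ∩ cell L) = 0 := by
  classical
  obtain ⟨a, ha, haL⟩ : ∃ a ∈ K, a ∉ L := by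
    by_contra! h
    exact hKL (Finset.eq_of_subset_of_card_le h (by rw [M.card_eq K hK, M.card_eq L hL]))
  obtain ⟨w, hw, hwe⟩ := exists_facet_normal (M.affineIndependent K hK)
    (by rw [M.card_eq K hK]; omega) ha
  refine measure_mono_null ?_ (volume_inner_eq_const hw (1 + inner ℝ w a))
  rw [M.inter_eq K hK L hL]
  intro x hx
  have hx2 : x ∈ cell (K.erase a) := by
    refine convexHull_mono ?_ hx
    rintro y ⟨hy1, hy2⟩
    exact Finset.mem_coe.2 (Finset.mem_erase.2 ⟨fun h => haL (h ▸ hy2), hy1⟩)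
  have := hwe x hx2
  rw [inner_sub_right] at this
  change inner ℝ w x = 1 + inner ℝ w a
  linarith

theorem interior_ae_eq_cell (K : Finset (Space (n + 1))) :
    interior (cell K) =ᵐ[volume] cell K :=
  interior_ae_eq_of_null_frontier ((convex_cell K).addHaar_frontier volume)

-- A point of `Ω` outside all the open simplices lies on the frontier of one of finitely many convex
-- sets, and such frontiers are null.
variable (M) in
theorem ae_eq_biUnion : Ω =ᵐ[volume] ⋃ K ∈ M.elements, interior (cell K) := by
  refine (ae_le_set.2 ?_).antisymm (Eventually.of_forall fun x hx => ?_)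
  · refine measure_mono_null (t := ⋃ K ∈ M.elements, frontier (cell K)) ?_ ?_
    · rintro x ⟨hx, hx2⟩
      rw [← M.interior_eq] at hx
      have hx3 := interior_subset hx
      simp only [Set.mem_iUnion, not_exists] at hx2 hx3 ⊢
      obtain ⟨K, hK, hxK⟩ := hx3
      exact ⟨K, hK, subset_closure hxK, hx2 K hK⟩
    · exact (measure_biUnion_null_iff M.elements.countable_toSet).2
        fun K _ => (convex_cell K).addHaar_frontier volume
  · obtain ⟨K, hK, hxK⟩ := Set.mem_iUnion₂.1 hx
    exact interior_cell_subset hK hxK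

theorem elementMeasure_eq (K : Finset (Space (n + 1))) :
    elementMeasure K = volume.restrict (interior (cell K)) :=
  (Measure.restrict_congr_set (interior_ae_eq_cell K)).symm

theorem elementMeasure_le {K : Finset (Space (n + 1))} (hK : K ∈ M.elements) :
    elementMeasure K ≤ volume.restrict Ω := by
  rw [elementMeasure_eq]
  exact Measure.restrict_mono (interior_cell_subset hK) le_rfl

variable (M) in
theorem setIntegral_eq_sum {F : Type*} [NormedAddCommGroup F] [NormedSpace ℝ F]
    {f : Space (n + 1) → F} (hf : IntegrableOn f Ω) :
    ∫ x in Ω, f x = ∑ K ∈ M.elements, ∫ x, f x ∂(elementMeasure K) := by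
  rw [Measure.restrict_congr_set M.ae_eq_biUnion, integral_biUnion_finset]
  · simp only [elementMeasure_eq]
  · exact fun K _ => isOpen_interior.measurableSet
  · intro K hK L hL hKL
    -- An open null set is empty, so the interiors are disjoint and not merely almost disjoint.
    have h0 : volume (interior (cell K) ∩ interior (cell L)) = 0 :=
      measure_mono_null (Set.inter_subset_inter interior_subset interior_subset)
        (volume_cell_inter hK hL hKL)
    exact Set.disjoint_iff_inter_eq_empty.2
      ((isOpen_interior.inter isOpen_interior).measure_eq_zero_iff volume |>.1 h0)
  · exact fun K hK => hf.mono_set (interior_cell_subset hK)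

/-- Supplies the vertex opposite to a boundary facet, which indexes the facet in the indicators, and
the uniqueness of the adjacent element, which makes traces and facet sums unambiguous. -/
theorem exists_eq_erase {e : Finset (Space (n + 1))} (he : e ∈ M.boundaryFacets) :
    ∃ K ∈ M.elements, (∃ a ∈ K, e = K.erase a) ∧ ∀ L ∈ M.elements, e ⊆ L → L = K := by
  classical
  simp only [boundaryFacets, Finset.mem_filter, Finset.mem_biUnion, Finset.mem_powersetCard] at he
  obtain ⟨⟨K, hK, heK, hec⟩, L, ⟨hL, heL⟩, huniq⟩ := he
  have hKL := huniq K ⟨hK, heK⟩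
  subst hKL
  refine ⟨K, hK, ?_, fun L' hL' h => huniq L' ⟨hL', h⟩⟩
  have hc := M.card_eq K hK
  obtain ⟨a, ha⟩ : ∃ a, K \ e = {a} := by
    rw [← Finset.card_eq_one, Finset.card_sdiff_of_subset heK, hc, hec]; omega
  have haK : a ∈ K := (Finset.mem_sdiff.1 (ha ▸ Finset.mem_singleton_self a)).1
  refine ⟨a, haK, ?_⟩
  rw [Finset.erase_eq, ← ha, Finset.sdiff_sdiff_eq_self heK]

end SimplicialMesh

theorem BoundaryPartition.mem_boundaryFacets_of_neumann {M : SimplicialMesh Ω}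
    (B : BoundaryPartition M) {e : Finset (Space (n + 1))} (he : e ∈ B.neumann) :
    e ∈ M.boundaryFacets := by
  rw [← B.union_eq]; exact Finset.mem_union_right _ he

theorem BoundaryPartition.mem_boundaryFacets_of_dirichlet {M : SimplicialMesh Ω}
    (B : BoundaryPartition M) {e : Finset (Space (n + 1))} (he : e ∈ B.dirichlet) :
    e ∈ M.boundaryFacets := by
  rw [← B.union_eq]; exact Finset.mem_union_left _ he

open scoped Classical in
/-- A sum over the Neumann facets is a sum over the elements and their Neumann facets. -/
theorem BoundaryPartition.sum_neumann {M : SimplicialMesh Ω} (B : BoundaryPartition M)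
    (F : Finset (Space (n + 1)) → ℝ) :
    ∑ e ∈ B.neumann, F e = ∑ K ∈ M.elements,
      ∑ a ∈ K.filter (fun a => K.erase a ∈ B.neumann), F (K.erase a) := by
  rw [Finset.sum_sigma']
  symm
  refine Finset.sum_bij (fun p _ => p.1.erase p.2) ?_ ?_ ?_ ?_
  · rintro ⟨K, a⟩ h
    simp only [Finset.mem_sigma, Finset.mem_filter] at h
    convert h.2.2
  · rintro ⟨K, a⟩ h ⟨L, b⟩ h' heq
    simp only [Finset.mem_sigma, Finset.mem_filter] at h h' heq
    have hb : K.erase a ∈ M.boundaryFacets := B.mem_boundaryFacets_of_neumann (by convert h.2.2)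
    obtain ⟨K', -, -, huniq⟩ := SimplicialMesh.exists_eq_erase hb
    -- Injectivity: a boundary facet determines its only adjacent element, and hence the vertex
    -- removed.
    have h1 := huniq K h.1 (by convert Finset.erase_subset a K)
    have h2 := huniq L h'.1 (by rw [heq]; convert Finset.erase_subset b L)
    obtain rfl : K = L := h1.trans h2.symm
    have hab : a = b := by
      by_contra hne
      have h3 : a ∈ K.erase b := Finset.mem_erase.2 ⟨hne, h.2.1⟩
      have h4 : a ∉ K.erase a := Finset.notMem_erase a K
      exact h4 (by convert h3 using 1)
    subst hab
    rfl
  · intro e he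
    obtain ⟨K, hK, ⟨a, ha, hea⟩, -⟩ :=
      SimplicialMesh.exists_eq_erase (B.mem_boundaryFacets_of_neumann he)
    have hea' : K.erase a = e := by rw [hea]
    refine ⟨⟨K, a⟩, ?_, hea'⟩
    simp only [Finset.mem_sigma, Finset.mem_filter]
    exact ⟨hK, ha, by rw [hea']; exact he⟩
  · rintro ⟨K, a⟩ h
    rfl

end Mesh

/-! ### Sobolev functions on the mesh: traces, pairings and Green's formula. -/

section Sobolev

variable {n : ℕ} {Ω : Set (Space (n + 1))}

theorem tsupport_gradient_subset {φ : Space n → ℝ} {x : Space n} (hx : x ∉ tsupport φ) :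
    gradient φ x = 0 := by
  have : fderiv ℝ φ x = 0 := by
    by_contra h
    exact hx (support_fderiv_subset ℝ h)
  rw [gradient, this, map_zero]

/-- A test function supported in the smaller set is admissible on the larger one, and it and its
gradient vanish on the difference. Used to restrict from `Ω` to the open simplices. -/
theorem IsWeakGradient.mono {U : Set (Space n)} {V : Set (Space n)} (hV : IsOpen V)
    (hUV : U ⊆ V) {w : Space n → ℝ} {Dw : Space n → Space n} (h : IsWeakGradient V w Dw) :
    IsWeakGradient U w Dw := by
  intro φ hφ hc hs
  have h1 := h φ hφ hc (hs.trans hUV)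
  rw [setIntegral_eq_of_subset_of_forall_sdiff_eq_zero hV.measurableSet hUV,
    setIntegral_eq_of_subset_of_forall_sdiff_eq_zero hV.measurableSet hUV] at h1
  · exact h1
  · intro x hx
    rw [image_eq_zero_of_notMem_tsupport fun h => hx.2 (hs h), zero_smul]
  · intro x hx
    rw [tsupport_gradient_subset fun h => hx.2 (hs h), smul_zero]

/-- The difference of two functions in `H¹(Ω)`. -/
def SobolevH1.sub (w w' : SobolevH1 Ω) : SobolevH1 Ω where
  toFun x := w.toFun x - w'.toFun x
  grad x := w.grad x - w'.grad x
  memLp_toFun := w.memLp_toFun.sub w'.memLp_toFun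
  memLp_grad := w.memLp_grad.sub w'.memLp_grad
  isWeakGradient := by
    intro φ hφ hc hs
    have hg : Continuous (gradient φ) := continuous_gradient_of_contDiff hφ
    have hgc : HasCompactSupport (gradient φ) :=
      (hc.fderiv (𝕜 := ℝ)).comp_left (g := (InnerProductSpace.toDual ℝ (Space (n + 1))).symm)
        (map_zero _)
    have hl : ∀ {F : Type} [NormedAddCommGroup F] {f : Space (n + 1) → F},
        MemLp f 2 (volume.restrict Ω) → LocallyIntegrable f (volume.restrict Ω) := fun hf =>
      hf.locallyIntegrable (by norm_num)
    have i1 : ∀ w : SobolevH1 Ω, Integrable (fun x => w.toFun x • gradient φ x)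
        (volume.restrict Ω) := fun w =>
      (hl w.memLp_toFun).integrable_smul_right_of_hasCompactSupport hg hgc
    have i2 : ∀ w : SobolevH1 Ω, Integrable (fun x => φ x • w.grad x)
        (volume.restrict Ω) := fun w =>
      (hl w.memLp_grad).integrable_smul_left_of_hasCompactSupport hφ.continuous hc
    simp only [sub_smul, smul_sub]
    rw [integral_sub (i1 w) (i1 w'), integral_sub (i2 w) (i2 w'), w.isWeakGradient φ hφ hc hs,
      w'.isWeakGradient φ hφ hc hs]
    abel

variable {M : SimplicialMesh Ω}

theorem MeasureTheory.MemLp.element {F : Type*} [NormedAddCommGroup F] {f : Space (n + 1) → F}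
    (hf : MemLp f 2 (volume.restrict Ω)) {K : Finset (Space (n + 1))} (hK : K ∈ M.elements) :
    MemLp f 2 (elementMeasure K) := hf.mono_measure (M.elementMeasure_le hK)

theorem SobolevH1.isWeakGradient_element (w : SobolevH1 Ω) {K : Finset (Space (n + 1))}
    (hK : K ∈ M.elements) : IsWeakGradient (interior (cell K)) w.toFun w.grad :=
  w.isWeakGradient.mono M.isOpen (M.interior_cell_subset hK)

/-- The choice of an element in `IsTrace` is no choice on a boundary facet. -/
theorem isTrace_erase_iff {K : Finset (Space (n + 1))} (hK : K ∈ M.elements)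
    {a : Space (n + 1)} (he : K.erase a ∈ M.boundaryFacets) {w : SobolevH1 Ω}
    {T : Space (n + 1) → ℝ} :
    IsTrace M w (K.erase a) T ↔ IsTraceFrom K (K.erase a) w.toFun w.grad T := by
  obtain ⟨K', -, -, huniq⟩ := M.exists_eq_erase he
  constructor
  · rintro ⟨L, hL, heL, h⟩
    have h1 : L = K := (huniq L hL heL).trans (huniq K hK (Finset.erase_subset a K)).symm
    rwa [h1] at h
  · exact fun h => ⟨K, hK, Finset.erase_subset a K, h⟩

theorem exists_isTrace {e : Finset (Space (n + 1))} (he : e ∈ M.boundaryFacets)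
    (w : SobolevH1 Ω) : ∃ T, IsTrace M w e T := by
  obtain ⟨K, hK, ⟨a, ha, rfl⟩, -⟩ := M.exists_eq_erase he
  simp only [isTrace_erase_iff hK he]
  exact exists_isTraceFrom (M.card_eq K hK) (M.affineIndependent K hK) ha (w.memLp_toFun.element hK)
    (w.memLp_grad.element hK) (w.isWeakGradient_element hK)

theorem isTrace_traceOn {e : Finset (Space (n + 1))} (he : e ∈ M.boundaryFacets)
    (w : SobolevH1 Ω) : IsTrace M w e (traceOn M w e) := by
  rw [traceOn, dif_pos (exists_isTrace he w)]
  exact (exists_isTrace he w).choose_spec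

theorem IsTrace.ae_eq {e : Finset (Space (n + 1))} (he : e ∈ M.boundaryFacets)
    {w : SobolevH1 Ω} {T T' : Space (n + 1) → ℝ} (h : IsTrace M w e T) (h' : IsTrace M w e T') :
    T =ᵐ[facetMeasure e] T' := by
  obtain ⟨K, hK, ⟨a, ha, rfl⟩, -⟩ := M.exists_eq_erase he
  rw [isTrace_erase_iff hK he] at h h'
  exact h.ae_eq (M.card_eq K hK) (M.affineIndependent K hK) ha (w.memLp_toFun.element hK)
    (w.memLp_grad.element hK) EventuallyEq.rfl EventuallyEq.rfl h'

theorem IsTrace.sub {e : Finset (Space (n + 1))} (he : e ∈ M.boundaryFacets)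
    {w w' : SobolevH1 Ω} {T T' : Space (n + 1) → ℝ} (h : IsTrace M w e T)
    (h' : IsTrace M w' e T') : IsTrace M (w.sub w') e (fun x => T x - T' x) := by
  obtain ⟨K, hK, ⟨a, ha, rfl⟩, -⟩ := M.exists_eq_erase he
  rw [isTrace_erase_iff hK he] at h h' ⊢
  exact h.sub (M.card_eq K hK) (M.affineIndependent K hK) ha (w.memLp_toFun.element hK)
    (w.memLp_grad.element hK) (w'.memLp_toFun.element hK) (w'.memLp_grad.element hK) h'

theorem IsTrace.memLp {e : Finset (Space (n + 1))} {w : SobolevH1 Ω} {T : Space (n + 1) → ℝ}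
    (h : IsTrace M w e T) : MemLp T 2 (facetMeasure e) := by
  obtain ⟨K, -, -, h, -⟩ := h
  exact h

theorem traceOn_sub {e : Finset (Space (n + 1))} (he : e ∈ M.boundaryFacets)
    (w w' : SobolevH1 Ω) : traceOn M (w.sub w') e
      =ᵐ[facetMeasure e] fun x => traceOn M w e x - traceOn M w' e x :=
  (isTrace_traceOn he _).ae_eq he ((isTrace_traceOn he w).sub he (isTrace_traceOn he w'))

variable {B : BoundaryPartition M}

theorem EqOnDirichlet.sub {w w' : SobolevH1 Ω} {g : Space (n + 1) → ℝ}
    (h : EqOnDirichlet B w g) (h' : EqOnDirichlet B w' g) : EqOnDirichlet B (w.sub w') 0 := by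
  intro e he
  have := (h e he).sub (B.mem_boundaryFacets_of_dirichlet he) (h' e he)
  have h0 : (fun x => g x - g x) = 0 := by ext x; exact sub_self (g x)
  rwa [h0] at this

theorem neumannPairing_sub {g : Space (n + 1) → ℝ}
    (hg : ∀ e ∈ B.neumann, MemLp g 2 (facetMeasure e)) (w w' : SobolevH1 Ω) :
    neumannPairing B g (w.sub w') = neumannPairing B g w - neumannPairing B g w' := by
  simp only [neumannPairing]
  rw [← Finset.sum_sub_distrib]
  refine Finset.sum_congr rfl fun e he => ?_
  have hb := B.mem_boundaryFacets_of_neumann he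
  rw [← integral_sub ((hg e he).integrable_fun_mul (isTrace_traceOn hb w).memLp)
    ((hg e he).integrable_fun_mul (isTrace_traceOn hb w').memLp)]
  refine integral_congr_ae ?_
  filter_upwards [traceOn_sub hb w w'] with x hx
  rw [hx, mul_sub]

theorem MeasureTheory.MemLp.integrable_inner {α E : Type*} [MeasurableSpace α] {μ : Measure α}
    [NormedAddCommGroup E] [InnerProductSpace ℝ E] {f g : α → E} (hf : MemLp f 2 μ)
    (hg : MemLp g 2 μ) : Integrable (fun x => inner ℝ (f x) (g x)) μ := by
  refine (hf.norm.integrable_fun_mul hg.norm).mono' (hf.1.inner hg.1) ?_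
  exact Eventually.of_forall fun x => norm_inner_le_norm (𝕜 := ℝ) (f x) (g x)

theorem greenForm_sub (q : SobolevHDiv Ω) (w w' : SobolevH1 Ω) :
    greenForm q (w.sub w') = greenForm q w - greenForm q w' := by
  simp only [greenForm, SobolevH1.sub, inner_sub_right, mul_sub]
  rw [integral_sub (q.memLp_toFun.integrable_inner w.memLp_grad)
    (q.memLp_toFun.integrable_inner w'.memLp_grad),
    integral_sub (q.memLp_div.integrable_fun_mul w.memLp_toFun)
    (q.memLp_div.integrable_fun_mul w'.memLp_toFun)]
  ring

/-- The value of the duality pairing on the Dirichlet boundary does not depend on the choice of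
the extension. -/
theorem dirichletPairing_eq {g : Space (n + 1) → ℝ} {G : SobolevH1 Ω} (hG : EqOnDirichlet B G g)
    {q : SobolevHDiv Ω} {qn : Space (n + 1) → ℝ} (hq : IsNormalTrace B q qn) :
    dirichletPairing B g q qn = greenForm q G - neumannPairing B qn G := by
  have hex : ∃ G : SobolevH1 Ω, EqOnDirichlet B G g := ⟨G, hG⟩
  rw [dirichletPairing, dif_pos hex]
  -- Two extensions of the same Dirichlet datum differ by a function vanishing on the Dirichlet
  -- boundary, which is a legitimate test function in Green's formula.
  have h1 := hq.2 _ (hex.choose_spec.sub hG)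
  rw [greenForm_sub, neumannPairing_sub hq.1] at h1
  linarith

end Sobolev

/-! ### Orthogonal projection onto polynomials. -/

section Polynomials

variable {d : ℕ}

theorem contDiff_polyFun (p : MvPolynomial (Fin d) ℝ) : ContDiff ℝ ∞ (polyFun p) := by
  induction p using MvPolynomial.induction_on with
  | C c =>
    have : polyFun (MvPolynomial.C c) = fun _ : Space d => c := by ext x; simp [polyFun]
    rw [this]; exact contDiff_const
  | add p q hp hq =>
    have : polyFun (p + q) = fun x => polyFun p x + polyFun q x := by ext x; simp [polyFun]
    rw [this]; exact hp.add hq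
  | mul_X p i hp =>
    have : polyFun (p * MvPolynomial.X i) = fun x => polyFun p x * x i := by ext x; simp [polyFun]
    rw [this]; exact hp.mul (by fun_prop)

/-- Existence of the `L²` orthogonal projection onto polynomials. -/
theorem exists_polyProj {μ : Measure (Space d)}
    (hμ : ∀ φ : Space d → ℝ, Continuous φ → MemLp φ 2 μ) (k : ℕ) {g : Space d → ℝ}
    (hg : MemLp g 2 μ) :
    ∃ p : MvPolynomial (Fin d) ℝ, p.totalDegree ≤ k ∧
      ∀ r : MvPolynomial (Fin d) ℝ, r.totalDegree ≤ k →
        ∫ x, (g x - polyFun p x) * polyFun r x ∂μ = 0 := by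
  have hm : ∀ p : MvPolynomial (Fin d) ℝ, MemLp (polyFun p) 2 μ := fun p =>
    hμ _ (contDiff_polyFun p).continuous
  let T : MvPolynomial (Fin d) ℝ →ₗ[ℝ] Lp ℝ 2 μ :=
    { toFun := fun p => (hm p).toLp (polyFun p)
      map_add' := fun p q => by
        rw [← MemLp.toLp_add]
        congr 1
        ext x; simp [polyFun]
      map_smul' := fun c p => by
        rw [RingHom.id_apply, ← MemLp.toLp_const_smul]
        congr 1
        ext x; simp [polyFun] }
  -- The projection is taken onto the finite-dimensional image in `L²`. On a facet `T` is not
  -- injective, since nonzero polynomials can vanish on a hyperplane, but any preimage `p` will do.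
  set V := (MvPolynomial.restrictTotalDegree (Fin d) ℝ k).map T
  obtain ⟨p, hp, hpT⟩ := Submodule.mem_map.1 (V.starProjection_apply_mem (hg.toLp g))
  rw [MvPolynomial.mem_restrictTotalDegree] at hp
  refine ⟨p, hp, fun r hr => ?_⟩
  have h1 := V.starProjection_inner_eq_zero (hg.toLp g) (T r)
    (Submodule.mem_map_of_mem ((MvPolynomial.mem_restrictTotalDegree _ _ _).2 hr))
  rw [← hpT] at h1
  change inner ℝ (hg.toLp g - (hm p).toLp (polyFun p)) ((hm r).toLp (polyFun r)) = 0 at h1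
  rw [← MemLp.toLp_sub, L2.inner_def] at h1
  rw [← h1]
  refine integral_congr_ae ?_
  filter_upwards [(hg.sub (hm p)).coeFn_toLp, (hm r).coeFn_toLp] with x h2 h3
  rw [h2, h3, real_inner_comm]
  rfl

theorem polyProj_spec {μ : Measure (Space d)}
    (hμ : ∀ φ : Space d → ℝ, Continuous φ → MemLp φ 2 μ) (k : ℕ) {g : Space d → ℝ}
    (hg : MemLp g 2 μ) :
    (∃ p, polyProj μ k g = polyFun p) ∧
      ∀ r : MvPolynomial (Fin d) ℝ, r.totalDegree ≤ k →
        ∫ x, (g x - polyProj μ k g x) * polyFun r x ∂μ = 0 := by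
  have h := exists_polyProj hμ k hg
  rw [polyProj, dif_pos h]
  exact ⟨⟨_, rfl⟩, h.choose_spec.2⟩

theorem integral_polyProj {μ : Measure (Space d)}
    (hμ : ∀ φ : Space d → ℝ, Continuous φ → MemLp φ 2 μ) (k : ℕ) {g : Space d → ℝ}
    (hg : MemLp g 2 μ) : ∫ x, polyProj μ k g x ∂μ = ∫ x, g x ∂μ := by
  have hfin : IsFiniteMeasure μ := by
    have := hμ (fun _ => 1) continuous_const
    rw [memLp_const_iff (by norm_num) (by norm_num)] at this
    exact ⟨this.resolve_left one_ne_zero⟩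
  obtain ⟨⟨p, hp⟩, h⟩ := polyProj_spec hμ k hg
  -- Constants have degree at most any `k`, so the projection preserves the integral; this is why
  -- projected equilibration implies zero-order equilibration.
  have h1 := h 1 (by simp)
  have h2 : ∀ x : Space d, polyFun (1 : MvPolynomial (Fin d) ℝ) x = 1 := fun x => by simp [polyFun]
  simp only [h2, mul_one] at h1
  rw [integral_sub (hg.integrable (by norm_num)) ?_] at h1
  · linarith
  · rw [hp]
    exact (hμ _ (contDiff_polyFun p).continuous).integrable (by norm_num)

end Polynomials

/-! ### Classical gradients as weak gradients, and uniqueness. -/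

section WeakGradient

variable {d : ℕ}

/-- The gradient of a smooth function is its weak gradient. -/
theorem isWeakGradient_gradient (U : Set (Space d)) {p : Space d → ℝ}
    (hp : ContDiff ℝ ∞ p) : IsWeakGradient U p (gradient p) := by
  intro φ hφ hc hs
  have hgφ : Continuous (gradient φ) := continuous_gradient_of_contDiff hφ
  have hgp : Continuous (gradient p) := continuous_gradient_of_contDiff hp
  have hgc : HasCompactSupport (gradient φ) :=
    (hc.fderiv (𝕜 := ℝ)).comp_left (g := (InnerProductSpace.toDual ℝ (Space d)).symm) (map_zero _)
  rw [setIntegral_eq_integral_of_forall_compl_eq_zero,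
    setIntegral_eq_integral_of_forall_compl_eq_zero]
  · have i1 : Integrable fun x => p x • gradient φ x :=
      (hp.continuous.smul hgφ).integrable_of_hasCompactSupport hgc.smul_left
    have i2 : Integrable fun x => φ x • gradient p x :=
      (hφ.continuous.smul hgp).integrable_of_hasCompactSupport hc.smul_right
    -- Pairing with a fixed vector reduces the claim to integration by parts of a directional
    -- derivative.
    refine ext_inner_left ℝ fun v => ?_
    rw [inner_neg_right, ← integral_inner i1, ← integral_inner i2]
    have hd : ∀ {f : Space d → ℝ} (x : Space d), inner ℝ v (gradient f x) = fderiv ℝ f x v :=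
      fun x => by rw [real_inner_comm]; simp [gradient]
    simp only [inner_smul_right, hd]
    have hφd := hφ.differentiable (by simp)
    have hpd := hp.differentiable (by simp)
    have c1 : Continuous fun x => fderiv ℝ p x v := (hp.continuous_fderiv (by simp)).clm_apply
      continuous_const
    have c2 : Continuous fun x => fderiv ℝ φ x v := (hφ.continuous_fderiv (by simp)).clm_apply
      continuous_const
    have hc2 : HasCompactSupport fun x => fderiv ℝ φ x v := hc.fderiv_apply (𝕜 := ℝ) v
    rw [integral_mul_fderiv_eq_neg_fderiv_mul_of_integrable]
    · simp only [mul_comm]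
    · exact (c1.mul hφ.continuous).integrable_of_hasCompactSupport hc.mul_left
    · exact (hp.continuous.mul c2).integrable_of_hasCompactSupport hc2.mul_left
    · exact (hp.continuous.mul hφ.continuous).integrable_of_hasCompactSupport hc.mul_left
    · exact fun x _ => hpd x
    · exact fun x _ => hφd x
  · intro x hx
    rw [image_eq_zero_of_notMem_tsupport fun h => hx (hs h), zero_smul]
  · intro x hx
    rw [tsupport_gradient_subset fun h => hx (hs h), smul_zero]

/-- Uniqueness of the weak gradient. -/
theorem IsWeakGradient.ae_eq {U : Set (Space d)} (hU : IsOpen U) {w w' : Space d → ℝ}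
    {G G' : Space d → Space d} (hw : w =ᵐ[volume.restrict U] w')
    (hG : MemLp G 2 (volume.restrict U)) (hG' : MemLp G' 2 (volume.restrict U))
    (h : IsWeakGradient U w G) (h' : IsWeakGradient U w' G') : G =ᵐ[volume.restrict U] G' := by
  have hl : ∀ {G : Space d → Space d}, MemLp G 2 (volume.restrict U) →
      LocallyIntegrable G (volume.restrict U) := fun hf => hf.locallyIntegrable (by norm_num)
  have h1 := hU.ae_eq_zero_of_integral_contDiff_smul_eq_zero (μ := volume.restrict U)
    (f := fun x => G x - G' x) ((hl (hG.sub hG')).locallyIntegrableOn U) ?_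
  · filter_upwards [h1, ae_restrict_mem hU.measurableSet] with x hx hxU
    exact sub_eq_zero.1 (hx hxU)
  · intro φ hφ hc hs
    have i : ∀ {G : Space d → Space d}, MemLp G 2 (volume.restrict U) →
        Integrable (fun x => φ x • G x) (volume.restrict U) := fun hG =>
      (hl hG).integrable_smul_left_of_hasCompactSupport hφ.continuous hc
    simp only [smul_sub]
    rw [integral_sub (i hG) (i hG'), sub_eq_zero, ← neg_inj, ← h φ hφ hc hs, ← h' φ hφ hc hs]
    refine integral_congr_ae ?_
    filter_upwards [hw] with x hx
    rw [hx]

end WeakGradient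

/-! ### Traces of piecewise polynomials. -/

section PiecewisePolynomial

variable {n : ℕ} {Ω : Set (Space (n + 1))} {M : SimplicialMesh Ω}

/-- The trace of a piecewise polynomial function. -/
theorem traceOn_ae_eq_polyFun {ξ : SobolevH1 Ω} {K : Finset (Space (n + 1))}
    (hK : K ∈ M.elements) {a : Space (n + 1)} (ha : a ∈ K) (he : K.erase a ∈ M.boundaryFacets)
    {p : MvPolynomial (Fin (n + 1)) ℝ} (hp : ∀ᵐ x ∂(elementMeasure K), ξ.toFun x = polyFun p x) :
    traceOn M ξ (K.erase a) =ᵐ[facetMeasure (K.erase a)] polyFun p := by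
  have h1 := (isTrace_erase_iff hK he).1 (isTrace_traceOn he ξ)
  have h2 := isTraceFrom_of_contDiff (M.card_eq K hK) (M.affineIndependent K hK) ha
    (contDiff_polyFun p)
  -- The definition of a trace also involves the gradient. Uniqueness of weak gradients on the open
  -- simplex shows that `ξ.grad` is the gradient of the polynomial there.
  have hg : gradient (polyFun p) =ᵐ[elementMeasure K] ξ.grad := by
    have m1 : MemLp (gradient (polyFun p)) 2 (elementMeasure K) :=
      memLp_cell (continuous_gradient_of_contDiff (contDiff_polyFun p))
    have m2 : MemLp ξ.grad 2 (elementMeasure K) := ξ.memLp_grad.element hK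
    rw [SimplicialMesh.elementMeasure_eq] at hp m1 m2 ⊢
    exact (isWeakGradient_gradient _ (contDiff_polyFun p)).ae_eq isOpen_interior
      (EventuallyEq.symm hp) m1 m2 (ξ.isWeakGradient_element hK)
  exact h1.ae_eq (M.card_eq K hK) (M.affineIndependent K hK) ha (ξ.memLp_toFun.element hK)
    (ξ.memLp_grad.element hK) (EventuallyEq.symm hp) hg h2

end PiecewisePolynomial

/-! ### Elementwise integrability and boundedness of the coefficient. -/

section Final

variable {n : ℕ} {Ω : Set (Space (n + 1))} {M : SimplicialMesh Ω} {B : BoundaryPartition M}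

theorem SimplicialMesh.integrableOn_iff {F : Type*} [NormedAddCommGroup F] (M : SimplicialMesh Ω)
    {f : Space (n + 1) → F} :
    IntegrableOn f Ω ↔ ∀ K ∈ M.elements, Integrable f (elementMeasure K) := by
  rw [IntegrableOn, Measure.restrict_congr_set M.ae_eq_biUnion]
  simp only [elementMeasure_eq]
  exact integrableOn_finset_iUnion

theorem SimplicialMesh.ae_restrict_of_forall (M : SimplicialMesh Ω) {p : Space (n + 1) → Prop}
    (h : ∀ K ∈ M.elements, ∀ᵐ x ∂(elementMeasure K), p x) : ∀ᵐ x ∂(volume.restrict Ω), p x := by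
  rw [Measure.restrict_congr_set M.ae_eq_biUnion]
  simp only [elementMeasure_eq] at h
  exact (ae_restrict_biUnion_finset_iff _ _ _).2 h

theorem isFiniteMeasure_elementMeasure {d : ℕ} (K : Finset (Space d)) :
    IsFiniteMeasure (elementMeasure K) :=
  ⟨by simpa [elementMeasure] using (isCompact_cell K).measure_lt_top⟩

theorem ProblemData.memLp_nu_smul (D : ProblemData B) {G : Space (n + 1) → Space (n + 1)}
    (hG : MemLp G 2 (volume.restrict Ω)) :
    MemLp (fun x => D.nu x • G x) 2 (volume.restrict Ω) := by
  have h1 : IntegrableOn D.nu Ω := M.integrableOn_iff.2 fun K hK => by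
    have := isFiniteMeasure_elementMeasure K
    exact (integrable_const (D.nuK K)).congr (EventuallyEq.symm (D.nu_eq K hK))
  have h2 : MemLp D.nu ⊤ (volume.restrict Ω) := by
    -- A sum of positive numbers dominates each of them, so it serves as a bound for `ν` without
    -- forming a maximum.
    refine memLp_top_of_bound h1.1 (∑ K ∈ M.elements, D.nuK K) ?_
    refine M.ae_restrict_of_forall fun K hK => ?_
    filter_upwards [D.nu_eq K hK] with x hx
    rw [hx, Real.norm_of_nonneg (D.nuK_pos K hK).le]
    exact Finset.single_le_sum (f := D.nuK) (fun L hL => (D.nuK_pos L hL).le) hK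
  exact hG.smul h2

end Final

/-! ### The scalar quadratic inequality and a linearity formula for integrals. -/

section Algebra

/-- The quadratic inequality behind the error bound. -/
theorem neg_sq_div_le {κ x η S : ℝ} (hκ : 0 < κ) (h : |S| ≤ η * x) :
    -(1 / (4 * κ) * η ^ 2) ≤ κ * x ^ 2 + S := by
  have h1 := (abs_le.1 h).1
  have h2 : 1 / (4 * κ) * η ^ 2 - η * x + κ * x ^ 2 = κ * (x - η / (2 * κ)) ^ 2 := by
    field_simp; ring
  have h3 : 0 ≤ κ * (x - η / (2 * κ)) ^ 2 := by positivity
  linarith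

theorem integral_linear_comb_four {α : Type*} [MeasurableSpace α] {μ : Measure α}
    {f₁ f₂ f₃ f₄ : α → ℝ} (i₁ : Integrable f₁ μ) (i₂ : Integrable f₂ μ) (i₃ : Integrable f₃ μ)
    (i₄ : Integrable f₄ μ) (c₁ c₂ c₃ c₄ : ℝ) :
    ∫ x, (c₁ * f₁ x + c₂ * f₂ x + (c₃ * f₃ x + c₄ * f₄ x)) ∂μ
      = c₁ * (∫ x, f₁ x ∂μ) + c₂ * (∫ x, f₂ x ∂μ)
        + (c₃ * (∫ x, f₃ x ∂μ) + c₄ * ∫ x, f₄ x ∂μ) := by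
  rw [integral_add (f := fun x => c₁ * f₁ x + c₂ * f₂ x) (g := fun x => c₃ * f₃ x + c₄ * f₄ x)
    ((i₁.const_mul _).add (i₂.const_mul _)) ((i₃.const_mul _).add (i₄.const_mul _)),
    integral_add (i₁.const_mul _) (i₂.const_mul _), integral_add (i₃.const_mul _) (i₄.const_mul _)]
  simp only [integral_const_mul]

end Algebra

/-! ### Representation of the output error. -/

section Bound

variable {n : ℕ} {Ω : Set (Space (n + 1))} {M : SimplicialMesh Ω} {B : BoundaryPartition M}
  {D : ProblemData B}

theorem neumannPairing_add_mul {g g' : Space (n + 1) → ℝ}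
    (hg : ∀ e ∈ B.neumann, MemLp g 2 (facetMeasure e))
    (hg' : ∀ e ∈ B.neumann, MemLp g' 2 (facetMeasure e)) (c c' : ℝ) (w : SobolevH1 Ω) :
    neumannPairing B (fun x => c * g x + c' * g' x) w
      = c * neumannPairing B g w + c' * neumannPairing B g' w := by
  simp only [neumannPairing, Finset.mul_sum, ← Finset.sum_add_distrib]
  refine Finset.sum_congr rfl fun e he => ?_
  have hm := (isTrace_traceOn (B.mem_boundaryFacets_of_neumann he) w).memLp
  rw [← integral_const_mul, ← integral_const_mul, ← integral_add
    (((hg e he).integrable_fun_mul hm).const_mul c) (((hg' e he).integrable_fun_mul hm).const_mul c')]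
  congr 1; ext x; ring

/-- Representation of the error in the output. -/
theorem output_error_eq {u : SobolevH1 Ω} {q : SobolevHDiv Ω} (huq : IsExactSolution D u q)
    {w ξ : SobolevH1 Ω} {v ζ : SobolevHDiv Ω} {vn ζn : Space (n + 1) → ℝ}
    (hw : EqOnDirichlet B w D.gD) (hξ : EqOnDirichlet B ξ D.gDO) (hv : IsNormalTrace B v vn)
    (hζ : IsNormalTrace B ζ ζn) (σ κ : ℝ) :
    σ * (outputFunctional D u q D.gN - centralValue D w ξ) =
      κ * (∫ x in Ω, inner ℝ (D.nu x • (u.sub w).grad x) ((u.sub w).grad x))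
      - (∫ x in Ω, inner ℝ (σ • (ζ.toFun x + D.nu x • ξ.grad x)
          - κ • (v.toFun x + D.nu x • w.grad x)) ((u.sub w).grad x))
      + (∫ x in Ω, (σ * (D.fO x - ζ.div x) - κ * (D.f x - v.div x)) * (u.sub w).toFun x)
      - neumannPairing B (fun x => -σ * (D.gNO x + ζn x) - κ * (D.gN x - vn x)) (u.sub w) := by
  set e := u.sub w
  -- The error in the potential vanishes on the Dirichlet boundary, so the normal-trace identities
  -- of `ζ`, `q` and `v` can all be tested with it.
  have he0 : EqOnDirichlet B e 0 := huq.eqOnDirichlet.sub hw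
  have hB := hζ.2 e he0
  have hC := huq.isNormalTrace.2 e he0
  have hD := hv.2 e he0
  have mu := D.memLp_nu_smul u.memLp_grad
  have mw := D.memLp_nu_smul w.memLp_grad
  have mξ := D.memLp_nu_smul ξ.memLp_grad
  -- the exact flux
  have hqe : ∀ G : SobolevH1 Ω, greenForm q G
      = -(∫ x in Ω, inner ℝ (D.nu x • u.grad x) (G.grad x)) + ∫ x in Ω, D.f x * G.toFun x := by
    intro G
    rw [greenForm, ← integral_neg]
    congr 1
    · refine integral_congr_ae ?_
      filter_upwards [huq.flux_eq] with x hx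
      rw [hx, inner_neg_left]
    · refine integral_congr_ae ?_
      filter_upwards [huq.div_eq] with x hx
      rw [hx]
  have hsub : ∀ G : Space (n + 1) → Space (n + 1), MemLp G 2 (volume.restrict Ω) →
      ∫ x in Ω, inner ℝ (D.nu x • e.grad x) (G x)
        = (∫ x in Ω, inner ℝ (D.nu x • u.grad x) (G x))
          - ∫ x in Ω, inner ℝ (D.nu x • w.grad x) (G x) := by
    intro G hG
    rw [← integral_sub (mu.integrable_inner hG) (mw.integrable_inner hG)]
    congr 1; ext x
    rw [← inner_sub_left, ← smul_sub]
    rfl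
  have hf : ∀ {f : Space (n + 1) → ℝ}, MemLp f 2 (volume.restrict Ω) →
      ∫ x in Ω, f x * e.toFun x = (∫ x in Ω, f x * u.toFun x) - ∫ x in Ω, f x * w.toFun x := by
    intro f hf
    rw [← integral_sub (hf.integrable_fun_mul u.memLp_toFun)
      (hf.integrable_fun_mul w.memLp_toFun)]
    congr 1; ext x
    rw [← mul_sub]
    rfl
  have hξe : ∫ x in Ω, inner ℝ (D.nu x • ξ.grad x) (e.grad x)
      = ∫ x in Ω, inner ℝ (D.nu x • e.grad x) (ξ.grad x) := by
    congr 1; ext x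
    rw [real_inner_smul_left, real_inner_smul_left, real_inner_comm]
  have hNO := neumannPairing_sub (B := B) D.memLp_gNO u w
  have hZ : ∫ x in Ω, inner ℝ (σ • (ζ.toFun x + D.nu x • ξ.grad x)
          - κ • (v.toFun x + D.nu x • w.grad x)) (e.grad x)
      = σ * ((∫ x in Ω, inner ℝ (ζ.toFun x) (e.grad x))
          + ∫ x in Ω, inner ℝ (D.nu x • ξ.grad x) (e.grad x))
        - κ * ((∫ x in Ω, inner ℝ (v.toFun x) (e.grad x))
          + ∫ x in Ω, inner ℝ (D.nu x • w.grad x) (e.grad x)) := by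
    have i1 := ζ.memLp_toFun.integrable_inner e.memLp_grad
    have i2 := mξ.integrable_inner e.memLp_grad
    have i3 := v.memLp_toFun.integrable_inner e.memLp_grad
    have i4 := mw.integrable_inner e.memLp_grad
    have h := integral_linear_comb_four i1 i2 i3 i4 σ σ (-κ) (-κ)
    refine Eq.trans ?_ (h.trans (by ring))
    congr 1; ext x
    rw [inner_sub_left, real_inner_smul_left (_ + _) _ σ, real_inner_smul_left (_ + _) _ κ,
      inner_add_left, inner_add_left]
    ring
  have hR : ∫ x in Ω, (σ * (D.fO x - ζ.div x) - κ * (D.f x - v.div x)) * e.toFun x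
      = σ * ((∫ x in Ω, D.fO x * e.toFun x) - ∫ x in Ω, ζ.div x * e.toFun x)
        - κ * ((∫ x in Ω, D.f x * e.toFun x) - ∫ x in Ω, v.div x * e.toFun x) := by
    have i1 := D.memLp_fO.integrable_fun_mul e.memLp_toFun
    have i2 := ζ.memLp_div.integrable_fun_mul e.memLp_toFun
    have i3 := D.memLp_f.integrable_fun_mul e.memLp_toFun
    have i4 := v.memLp_div.integrable_fun_mul e.memLp_toFun
    have h := integral_linear_comb_four i1 i2 i3 i4 σ (-σ) (-κ) κ
    refine Eq.trans ?_ (h.trans (by ring))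
    congr 1; ext x
    ring
  have hN : neumannPairing B (fun x => -σ * (D.gNO x + ζn x) - κ * (D.gN x - vn x)) e
      = -σ * (neumannPairing B D.gNO e + neumannPairing B ζn e)
        - κ * (neumannPairing B D.gN e - neumannPairing B vn e) := by
    have h1 := neumannPairing_add_mul D.memLp_gNO hζ.1 (-σ) (-σ) e
    have h2 := neumannPairing_add_mul D.memLp_gN hv.1 (-κ) κ e
    have h3 := neumannPairing_add_mul (B := B)
      (g := fun x => -σ * D.gNO x + -σ * ζn x) (g' := fun x => -κ * D.gN x + κ * vn x)
      (fun e he => ((D.memLp_gNO e he).const_mul _).add ((hζ.1 e he).const_mul _))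
      (fun e he => ((D.memLp_gN e he).const_mul _).add ((hv.1 e he).const_mul _)) 1 1 e
    rw [h1, h2] at h3
    have h4 : (fun x => -σ * (D.gNO x + ζn x) - κ * (D.gN x - vn x))
        = fun x => 1 * (-σ * D.gNO x + -σ * ζn x) + 1 * (-κ * D.gN x + κ * vn x) := by
      ext x; ring
    rw [h4, h3]; ring
  rw [hqe] at hC
  rw [greenForm] at hB hD
  rw [outputFunctional, centralValue, dirichletPairing_eq hξ huq.isNormalTrace, hqe, hZ, hR, hN,
    hξe]
  have s1 := hsub _ e.memLp_grad
  have s2 := hsub _ ξ.memLp_grad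
  have s3 := hf D.memLp_fO
  rw [s1, s2]
  rw [s3]
  rw [hNO]
  -- The identity for `ζ` reduces the terms with `σ` to `(fO, e) + ⟨gNO, e⟩ - (ν∇e, ∇ξ)`, which is
  -- the output error. By those for `q` and `v` the terms with `κ` add up to zero.
  rw [← hB, ← hD, ← hC]
  ring

end Bound

/-! ### Elementwise estimate, summation and projected reconstructions. -/

section Bound

variable {n : ℕ} {Ω : Set (Space (n + 1))} {M : SimplicialMesh Ω} {B : BoundaryPartition M}
  {D : ProblemData B}

theorem ProblemData.integral_nu_smul (D : ProblemData B) {K : Finset (Space (n + 1))}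
    (hK : K ∈ M.elements) (G : Space (n + 1) → Space (n + 1)) :
    ∫ x, inner ℝ (D.nu x • G x) (G x) ∂(elementMeasure K)
      = (√(D.nuK K) * √(∫ x, ‖G x‖ ^ 2 ∂(elementMeasure K))) ^ 2 := by
  rw [mul_pow, Real.sq_sqrt (D.nuK_pos K hK).le,
    Real.sq_sqrt (integral_nonneg fun x => sq_nonneg _), ← integral_const_mul]
  refine integral_congr_ae ?_
  filter_upwards [D.nu_eq K hK] with x hx
  rw [hx, real_inner_smul_left, real_inner_self_eq_norm_sq]

theorem ProblemData.energyNorm_eq (D : ProblemData B) {K : Finset (Space (n + 1))}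
    (hK : K ∈ M.elements) (Z : Space (n + 1) → Space (n + 1)) :
    energyNorm D.nu K Z = (√(D.nuK K))⁻¹ * √(∫ x, ‖Z x‖ ^ 2 ∂(elementMeasure K)) := by
  rw [energyNorm, ← Real.sqrt_inv, ← Real.sqrt_mul (inv_nonneg.2 (D.nuK_pos K hK).le),
    ← integral_const_mul]
  congr 1
  refine integral_congr_ae ?_
  filter_upwards [D.nu_eq K hK] with x hx
  rw [hx, real_inner_self_eq_norm_sq]

open scoped Classical in
/-- The contribution of one element to the error. -/
theorem neg_indicator_sq_le {κ : ℝ} (hκ : 0 < κ) {K : Finset (Space (n + 1))}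
    (hK : K ∈ M.elements) (e : SobolevH1 Ω) {Z : Space (n + 1) → Space (n + 1)}
    {r g : Space (n + 1) → ℝ} (hZ : MemLp Z 2 (elementMeasure K))
    (hr : MemLp r 2 (elementMeasure K)) (hr0 : ∫ x, r x ∂(elementMeasure K) = 0)
    (hg : ∀ f ∈ B.neumann, MemLp g 2 (facetMeasure f))
    (hg0 : ∀ f ∈ B.neumann, ∫ x, g x ∂(facetMeasure f) = 0) :
    -(1 / (4 * κ) * (energyNorm D.nu K Z
        + constC1 K * (√(D.nuK K))⁻¹ * normL2 (elementMeasure K) r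
        + ∑ a ∈ K.filter (fun a => K.erase a ∈ B.neumann),
          constC2 K (K.erase a) a * (√(D.nuK K))⁻¹ * normL2 (facetMeasure (K.erase a)) g) ^ 2)
      ≤ κ * (∫ x, inner ℝ (D.nu x • e.grad x) (e.grad x) ∂(elementMeasure K))
        - (∫ x, inner ℝ (Z x) (e.grad x) ∂(elementMeasure K))
        + (∫ x, r x * e.toFun x ∂(elementMeasure K))
        - ∑ a ∈ K.filter (fun a => K.erase a ∈ B.neumann),
          ∫ x, g x * traceOn M e (K.erase a) x ∂(facetMeasure (K.erase a)) := by
  have hν := D.nuK_pos K hK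
  have hs : √(D.nuK K) ≠ 0 := (Real.sqrt_pos.2 hν).ne'
  have hcard := M.card_eq K hK
  have hai := M.affineIndependent K hK
  have mG := e.memLp_grad.element hK
  set N := √(∫ x, ‖e.grad x‖ ^ 2 ∂(elementMeasure K)) with hN
  -- With `x = √ν_K ‖∇e‖` the energy term is `κ x²`; what remains is to bound the other three terms
  -- by `η_K x`.
  rw [D.integral_nu_smul hK, ← hN, add_sub_assoc, sub_add, sub_eq_add_neg (κ * _)]
  apply neg_sq_div_le hκ
  rw [abs_neg]
  have b1 := abs_integral_inner_le_sqrt hZ mG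
  have b2 := abs_integral_mul_le_constC1 hcard hai (e.memLp_toFun.element hK) mG
    (e.isWeakGradient_element hK) hr hr0
  have b3 : |∑ a ∈ K.filter (fun a => K.erase a ∈ B.neumann),
      ∫ x, g x * traceOn M e (K.erase a) x ∂(facetMeasure (K.erase a))| ≤
      ∑ a ∈ K.filter (fun a => K.erase a ∈ B.neumann),
        normL2 (facetMeasure (K.erase a)) g * (constC2 K (K.erase a) a * N) := by
    refine (Finset.abs_sum_le_sum_abs _ _).trans (Finset.sum_le_sum fun a ha => ?_)
    obtain ⟨haK, haN⟩ := Finset.mem_filter.1 ha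
    have hb : K.erase a ∈ M.boundaryFacets := B.mem_boundaryFacets_of_neumann haN
    exact abs_integral_mul_le_constC2 hcard hai haK mG
      ((isTrace_erase_iff hK hb).1 (isTrace_traceOn hb e)) (hg _ haN) (hg0 _ haN)
  -- Each summand of the indicator carries a factor `ν_K^(-1/2)`, cancelled by the `√ν_K` in `x`.
  have e1 : (energyNorm D.nu K Z + constC1 K * (√(D.nuK K))⁻¹ * normL2 (elementMeasure K) r
      + ∑ a ∈ K.filter (fun a => K.erase a ∈ B.neumann),
        constC2 K (K.erase a) a * (√(D.nuK K))⁻¹ * normL2 (facetMeasure (K.erase a)) g)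
        * (√(D.nuK K) * N)
      = √(∫ x, ‖Z x‖ ^ 2 ∂(elementMeasure K)) * N
        + normL2 (elementMeasure K) r * (constC1 K * N)
        + ∑ a ∈ K.filter (fun a => K.erase a ∈ B.neumann),
          normL2 (facetMeasure (K.erase a)) g * (constC2 K (K.erase a) a * N) := by
    rw [D.energyNorm_eq hK, add_mul, add_mul, Finset.sum_mul]
    congr 1
    · field_simp
    · refine Finset.sum_congr rfl fun a _ => ?_
      field_simp
  rw [e1]
  rw [abs_le] at b1 b2 b3 ⊢
  constructor <;> linarith [b1.1, b1.2, b2.1, b2.2, b3.1, b3.2]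

/-- Sum of the element estimates, in which the equilibration conditions enter only through the
vanishing means `hr0` and `hg0` of the combined residuals. -/
theorem neg_sum_etaZeroOrder_le {u : SobolevH1 Ω} {q : SobolevHDiv Ω}
    (huq : IsExactSolution D u q) {w ξ : SobolevH1 Ω} {v ζ : SobolevHDiv Ω}
    {vn ζn : Space (n + 1) → ℝ} (h : IsZeroOrderReconstruction D w v vn ξ ζ ζn) (σ : ℝ) {κ : ℝ}
    (hκ : 0 < κ) :
    σ * outputFunctional D u q D.gN ≥ σ * centralValue D w ξ
      - 1 / (4 * κ) * ∑ K ∈ M.elements, etaZeroOrder D σ κ w v vn ξ ζ ζn K ^ 2 := by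
  classical
  have h1 := output_error_eq huq h.primal_potential h.adjoint_potential h.primal_trace
    h.adjoint_trace σ κ
  set e := u.sub w
  set Z : Space (n + 1) → Space (n + 1) := fun x => σ • (ζ.toFun x + D.nu x • ξ.grad x)
    - κ • (v.toFun x + D.nu x • w.grad x)
  set r : Space (n + 1) → ℝ := fun x => σ * (D.fO x - ζ.div x) - κ * (D.f x - v.div x)
  set g : Space (n + 1) → ℝ := fun x => -σ * (D.gNO x + ζn x) - κ * (D.gN x - vn x)
  have mZ : MemLp Z 2 (volume.restrict Ω) :=
    ((ζ.memLp_toFun.add (D.memLp_nu_smul ξ.memLp_grad)).const_smul σ).sub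
      ((v.memLp_toFun.add (D.memLp_nu_smul w.memLp_grad)).const_smul κ)
  have mr : MemLp r 2 (volume.restrict Ω) :=
    ((D.memLp_fO.sub ζ.memLp_div).const_mul σ).sub ((D.memLp_f.sub v.memLp_div).const_mul κ)
  have mg : ∀ f ∈ B.neumann, MemLp g 2 (facetMeasure f) := fun f hf =>
    (((D.memLp_gNO f hf).add (h.adjoint_trace.1 f hf)).const_mul (-σ)).sub
      (((D.memLp_gN f hf).sub (h.primal_trace.1 f hf)).const_mul κ)
  have hr0 : ∀ K ∈ M.elements, ∫ x, r x ∂(elementMeasure K) = 0 := by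
    intro K hK
    have := isFiniteMeasure_elementMeasure K
    have i : ∀ {f : Space (n + 1) → ℝ}, MemLp f 2 (volume.restrict Ω) →
        Integrable f (elementMeasure K) := fun hf => (hf.element hK).integrable (by norm_num)
    have h2 := integral_linear_comb_four (i D.memLp_fO) (i ζ.memLp_div) (i D.memLp_f)
      (i v.memLp_div) σ (-σ) (-κ) κ
    rw [h.primal_div K hK, h.adjoint_div K hK] at h2
    calc ∫ x, r x ∂(elementMeasure K) = _ := by congr 1; ext x; ring
      _ = _ := h2
      _ = 0 := by ring
  have hg0 : ∀ f ∈ B.neumann, ∫ x, g x ∂(facetMeasure f) = 0 := by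
    intro f hf
    obtain ⟨K, hK, ⟨a, ha, rfl⟩, -⟩ := M.exists_eq_erase (B.mem_boundaryFacets_of_neumann hf)
    have := isFiniteMeasure_facetMeasure (M.card_eq K hK) (M.affineIndependent K hK) ha
    have i : ∀ {f : Space (n + 1) → ℝ}, MemLp f 2 (facetMeasure (K.erase a)) →
        Integrable f (facetMeasure (K.erase a)) := fun hf => hf.integrable (by norm_num)
    have h2 := integral_linear_comb_four (i (D.memLp_gNO _ hf)) (i (h.adjoint_trace.1 _ hf))
      (i (D.memLp_gN _ hf)) (i (h.primal_trace.1 _ hf)) (-σ) (-σ) (-κ) κ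
    rw [h.primal_neumann _ hf, h.adjoint_neumann _ hf, integral_neg] at h2
    calc ∫ x, g x ∂(facetMeasure (K.erase a)) = _ := by congr 1; ext x; ring
      _ = _ := h2
      _ = 0 := by ring
  have hsum := Finset.sum_le_sum fun K hK => neg_indicator_sq_le (D := D) hκ hK e (mZ.element hK)
    (mr.element hK) (hr0 K hK) mg hg0
  rw [M.setIntegral_eq_sum ((D.memLp_nu_smul e.memLp_grad).integrable_inner e.memLp_grad),
    M.setIntegral_eq_sum (mZ.integrable_inner e.memLp_grad),
    M.setIntegral_eq_sum (mr.integrable_fun_mul e.memLp_toFun), neumannPairing, B.sum_neumann,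
    Finset.mul_sum, ← Finset.sum_sub_distrib, ← Finset.sum_add_distrib,
    ← Finset.sum_sub_distrib] at h1
  rw [Finset.sum_neg_distrib, ← Finset.mul_sum] at hsum
  have h3 : -(1 / (4 * κ) * ∑ K ∈ M.elements, etaZeroOrder D σ κ w v vn ξ ζ ζn K ^ 2)
      ≤ σ * (outputFunctional D u q D.gN - centralValue D w ξ) := by
    rw [h1]
    refine le_trans (le_of_eq ?_) (hsum.trans (le_of_eq ?_))
    · rfl
    · rfl
  rw [mul_sub] at h3
  linarith

theorem memLp_elementMeasure {φ : Space (n + 1) → ℝ} (hφ : Continuous φ)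
    (K : Finset (Space (n + 1))) : MemLp φ 2 (elementMeasure K) := memLp_cell hφ

theorem memLp_boundaryFacet {e : Finset (Space (n + 1))} (he : e ∈ M.boundaryFacets)
    {φ : Space (n + 1) → ℝ} (hφ : Continuous φ) : MemLp φ 2 (facetMeasure e) := by
  obtain ⟨K, hK, ⟨a, ha, rfl⟩, -⟩ := M.exists_eq_erase he
  exact memLp_facetMeasure (M.card_eq K hK) (M.affineIndependent K hK) ha hφ

/-- Projected equilibrated fluxes are zero-order equilibrated fluxes. -/
theorem IsProjectedReconstruction.isZeroOrder {k l : ℕ} {w ξ : SobolevH1 Ω}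
    {v ζ : SobolevHDiv Ω} {vn ζn : Space (n + 1) → ℝ}
    (h : IsProjectedReconstruction D k l w v vn ξ ζ ζn) :
    IsZeroOrderReconstruction D w v vn ξ ζ ζn where
  primal_potential := h.primal_potential
  adjoint_potential := h.adjoint_potential
  primal_trace := h.primal_trace
  adjoint_trace := h.adjoint_trace
  primal_div K hK := by
    rw [integral_congr_ae (h.primal_div K hK)]
    exact integral_polyProj (fun φ hφ => memLp_elementMeasure hφ K) k (D.memLp_f.element hK)
  adjoint_div K hK := by
    rw [integral_congr_ae (h.adjoint_div K hK)]
    exact integral_polyProj (fun φ hφ => memLp_elementMeasure hφ K) k (D.memLp_fO.element hK)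
  primal_neumann e he := by
    rw [integral_congr_ae (h.primal_neumann e he)]
    exact integral_polyProj
      (fun φ hφ => memLp_boundaryFacet (B.mem_boundaryFacets_of_neumann he) hφ) l (D.memLp_gN e he)
  adjoint_neumann e he := by
    rw [integral_congr_ae (h.adjoint_neumann e he), integral_neg, integral_neg]
    congr 1
    exact integral_polyProj
      (fun φ hφ => memLp_boundaryFacet (B.mem_boundaryFacets_of_neumann he) hφ) l (D.memLp_gNO e he)

theorem normL2_congr {d : ℕ} {μ : Measure (Space d)} {f g : Space d → ℝ} (h : f =ᵐ[μ] g) :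
    normL2 μ f = normL2 μ g := by
  rw [normL2, normL2]
  congr 1
  refine integral_congr_ae ?_
  filter_upwards [h] with x hx
  rw [hx]

/-- Divergences and normal components of projected fluxes coincide almost everywhere with the
projections of the data, with the sign change for the adjoint Neumann datum. -/
theorem IsProjectedReconstruction.eta_eq {k l : ℕ} {w ξ : SobolevH1 Ω}
    {v ζ : SobolevHDiv Ω} {vn ζn : Space (n + 1) → ℝ}
    (h : IsProjectedReconstruction D k l w v vn ξ ζ ζn) (σ κ : ℝ) {K : Finset (Space (n + 1))}
    (hK : K ∈ M.elements) :
    etaProjected D k l σ κ w v ξ ζ K = etaZeroOrder D σ κ w v vn ξ ζ ζn K := by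
  rw [etaProjected, etaZeroOrder, localIndicator, localIndicator]
  congr 1
  · congr 2
    apply normL2_congr
    filter_upwards [h.primal_div K hK, h.adjoint_div K hK] with x h1 h2
    rw [h1, h2]
  · refine Finset.sum_congr rfl fun a ha => ?_
    have haN := (Finset.mem_filter.1 ha).2
    congr 1
    apply normL2_congr
    filter_upwards [h.primal_neumann _ haN, h.adjoint_neumann _ haN] with x h1 h2
    rw [h1, h2, sub_eq_add_neg (D.gNO x)]

/-- The residuals `f - Π_K f` and `g_N - Π_e g_N` are orthogonal to `ξ`, so `f` and `g_N` may be
replaced by `∇·v` and `v·n`. Green's formula with `ξ` itself as extension of the adjoint Dirichlet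
datum then yields the duality pairing. -/
theorem IsProjectedReconstruction.centralValue_eq {k l m : ℕ} {w ξ : SobolevH1 Ω}
    {v ζ : SobolevHDiv Ω} {vn ζn : Space (n + 1) → ℝ}
    (h : IsProjectedReconstruction D k l w v vn ξ ζ ζn) (hξ : IsPiecewisePolynomial M m ξ)
    (hk : m ≤ k) (hl : m ≤ l) : centralValue D w ξ = centralValueAlt D w v vn ξ := by
  have hvol : ∫ x in Ω, D.f x * ξ.toFun x = ∫ x in Ω, v.div x * ξ.toFun x := by
    rw [M.setIntegral_eq_sum (D.memLp_f.integrable_fun_mul ξ.memLp_toFun),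
      M.setIntegral_eq_sum (v.memLp_div.integrable_fun_mul ξ.memLp_toFun)]
    refine Finset.sum_congr rfl fun K hK => ?_
    obtain ⟨p, hp, hpξ⟩ := hξ K hK
    have h1 := (polyProj_spec (fun φ hφ => memLp_elementMeasure hφ K) k
      (D.memLp_f.element hK)).2 p (hp.trans hk)
    rw [← sub_eq_zero, ← h1, ← integral_sub
      ((D.memLp_f.element hK).integrable_fun_mul (ξ.memLp_toFun.element hK))
      ((v.memLp_div.element hK).integrable_fun_mul (ξ.memLp_toFun.element hK))]
    refine integral_congr_ae ?_
    filter_upwards [hpξ, h.primal_div K hK] with x h2 h3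
    rw [h2, h3, sub_mul]
  have hbd : neumannPairing B D.gN ξ = neumannPairing B vn ξ := by
    refine Finset.sum_congr rfl fun e he => ?_
    have hb := B.mem_boundaryFacets_of_neumann he
    obtain ⟨K, hK, ⟨a, ha, rfl⟩, -⟩ := M.exists_eq_erase hb
    obtain ⟨p, hp, hpξ⟩ := hξ K hK
    have mT := (isTrace_traceOn hb ξ).memLp
    have h1 := (polyProj_spec (fun φ hφ => memLp_boundaryFacet hb hφ) l
      (D.memLp_gN _ he)).2 p (hp.trans hl)
    rw [← sub_eq_zero, ← h1, ← integral_sub ((D.memLp_gN _ he).integrable_fun_mul mT)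
      ((h.primal_trace.1 _ he).integrable_fun_mul mT)]
    refine integral_congr_ae ?_
    filter_upwards [traceOn_ae_eq_polyFun hK ha hb hpξ, h.primal_neumann _ he] with x h2 h3
    rw [h2, h3, sub_mul]
  have hsum : ∫ x in Ω, inner ℝ (v.toFun x + D.nu x • w.grad x) (ξ.grad x)
      = (∫ x in Ω, inner ℝ (v.toFun x) (ξ.grad x))
        + ∫ x in Ω, inner ℝ (D.nu x • w.grad x) (ξ.grad x) := by
    rw [← integral_add (v.memLp_toFun.integrable_inner ξ.memLp_grad)
      ((D.memLp_nu_smul w.memLp_grad).integrable_inner ξ.memLp_grad)]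
    simp only [inner_add_left]
  rw [centralValueAlt, outputFunctional, dirichletPairing_eq h.adjoint_potential h.primal_trace,
    greenForm, centralValue, hvol, hbd, hsum]
  ring

end Bound

end

/-! ### The main theorem. -/

theorem theorem2 (d : ℕ) (hd : d = 2 ∨ d = 3) (Ω : Set (Space d)) (hΩ : IsConnected Ω)
    (M : SimplicialMesh Ω) (B : BoundaryPartition M) (D : ProblemData B)
    (u : SobolevH1 Ω) (q : SobolevHDiv Ω) (huq : IsExactSolution D u q)
    (w : SobolevH1 Ω) (v : SobolevHDiv Ω) (vn : Space d → ℝ)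
    (ξ : SobolevH1 Ω) (ζ : SobolevHDiv Ω) (ζn : Space d → ℝ) (κ : ℝ) (hκ : 0 < κ) :
    (IsZeroOrderReconstruction D w v vn ξ ζ ζn →
      ∀ σ : ℝ, σ = 1 ∨ σ = -1 →
        σ * outputFunctional D u q D.gN ≥ σ * centralValue D w ξ
          - 1 / (4 * κ) * ∑ K ∈ M.elements, etaZeroOrder D σ κ w v vn ξ ζ ζn K ^ 2) ∧
    (∀ k l : ℕ, IsProjectedReconstruction D k l w v vn ξ ζ ζn →
      (∀ σ : ℝ, σ = 1 ∨ σ = -1 →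
        σ * outputFunctional D u q D.gN ≥ σ * centralValue D w ξ
          - 1 / (4 * κ) * ∑ K ∈ M.elements, etaProjected D k l σ κ w v ξ ζ K ^ 2) ∧
      (∀ m : ℕ, IsPiecewisePolynomial M m ξ → m ≤ k → m ≤ l →
        centralValue D w ξ = centralValueAlt D w v vn ξ ∧
        ∀ σ : ℝ, σ = 1 ∨ σ = -1 →
          σ * outputFunctional D u q D.gN ≥ σ * centralValueAlt D w v vn ξ
            - 1 / (4 * κ) * ∑ K ∈ M.elements, etaProjected D k l σ κ w v ξ ζ K ^ 2)) := by
  -- Writing `d = n + 1` makes the facet dimension `d - 1` reduce to `n` and provides the coordinate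
  -- that is split off in the geometric lemmas.
  obtain ⟨n, rfl⟩ : ∃ n, d = n + 1 := ⟨d - 1, by omega⟩
  have hproj : ∀ k l : ℕ, IsProjectedReconstruction D k l w v vn ξ ζ ζn → ∀ σ : ℝ,
      σ * outputFunctional D u q D.gN ≥ σ * centralValue D w ξ
        - 1 / (4 * κ) * ∑ K ∈ M.elements, etaProjected D k l σ κ w v ξ ζ K ^ 2 := by
    intro k l h σ
    rw [Finset.sum_congr rfl fun K hK => by rw [h.eta_eq σ κ hK]]
    exact neg_sum_etaZeroOrder_le huq h.isZeroOrder σ hκ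
  refine ⟨fun h σ _ => neg_sum_etaZeroOrder_le huq h σ hκ, fun k l h =>
    ⟨fun σ _ => hproj k l h σ, fun m hm hk hl => ⟨h.centralValue_eq hm hk hl, fun σ _ => ?_⟩⟩⟩
  rw [← h.centralValue_eq hm hk hl]
  exact hproj k l h σ
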